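/- **Setting.** Let $F$ be a $p$-adic field with $p$ odd, with ring of integers $\mathcal O_F$, maximal ideal $\mathcal P_F$ and residue cardinality $q$, and let $D$ be the quaternion division algebra over $F$, with reduced trace $\mathrm{Trd}$, ring of integers $\mathcal O_D$ and maximal ideal $\mathcal P_D$. Fix a primitive $(q^2-1)$-st root of unity $\zeta\in D$ and a uniformizer $\varpi$ of $D$ such that $\varpi^2=\varpi_F$ is a uniformizer of $F$ and $\varpi\zeta\varpi^{-1}=\zeta^q$. Put $M=F(\zeta)$, $K=F(\varpi)$, $L=F(\zeta\varpi)$, $\mathbb D=\langle\zeta\rangle\cup\{0\}$ and $\mathbb F=\mathbb D\cap F$. For $E\in\{D,M,K,L\}$, $1+\mathcal P_E^0$ means $\mathcal O_E^\times$. Characters are homomorphisms to $\mathbb C^\times$. Fix an additive character $\psi_0$ of $F$ with $\psi_0(\mathcal O_F)=1$ and $\psi_0(\mathcal P_F^{-1})\neq1$. Let $m\ge 0$ and let $\psi$ be a smooth character of $M^\times$ of conductor $m+1$ (the least $\nu\ge0$ with $\psi|_{1+\mathcal P_M^{\nu}}=1$) which is minimal, i.e. its conductor is at most that of $\psi\cdot(\phi\circ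 \mathrm{Nm}_{M/F})$ for every smooth character $\phi$ of $F^\times$. Let $c\in\mathcal P_M^{-m-1}$, $c\notin F+\mathcal P_M^{-m}$, be such that $\psi(1+x)=\psi_0(\mathrm{Tr}_{M/F}(cx))$ for all $x\in\mathcal P_M^{[(m+2)/2]}$, and put $\psi_c(1+x)=\psi_0(\mathrm{Trd}(cx))$ for $x\in\mathcal P_D^{m+1}$. Let $H=M^\times(1+\mathcal P_D^m)$. Define a representation $\theta_\psi^\#$ of $H$ on a space $W$ as follows. * If $m$ is even, then $H=M^\times(1+\mathcal P_D^{m+1})$, $W=\mathbb C$ and $\theta_\psi^\#$ is the character $\theta_\psi^\#(y(1+x))=\psi(y)\psi_c(1+x)$ for $y\in M^\times$, $x\in\mathcal P_D^{m+1}$. * If $m$ is odd, put $H''=F^\times(1+\mathcal P_M)(1+\mathcal P_D^{m+1})$, $H'=F^\times(1+\mathcal P_M)(1+\mathcal P_D^m)$ and $H_1'=F^\times(1+\mathcal P_M)(1+\mathcal P_L^m)(1+\mathcal P_D^{m+1})$. Let $\psi'$ be any character of $H_1'$ extending the character $a(1+y)(1+x)\mapsto\psi(a)\psi(1+y)\psi_c(1+x)$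 of $H''$ (with $a\in F^\times$, $y\in\mathcal P_M$, $x\in\mathcal P_D^{m+1}$), let $\theta_\psi=\mathrm{Ind}_{H_1'}^{H'}\psi'$ with space $W$, and let $\theta_\psi^\#$ be the extension of $\theta_\psi$ to $H$ on $W$ with $\det\theta_\psi^\#=\psi^q$ on $\langle\zeta\rangle$. For $a\in\mathbb F$ let $f_a\in W$ be the function on $H'$ supported on $H_1'(1+a\varpi^m)$ with $f_a(h_1(1+a\varpi^m))=\psi'(h_1)$ for $h_1\in H_1'$. Let $\pi_\psi=\mathrm{Ind}_H^{D^\times}\theta_\psi^\#$. (An induced representation $\mathrm{Ind}_S^G\rho$ is the space of functions $f$ on $G$ with $f(sg)=\rho(s)f(g)$ for $s\in S$, on which $G$ acts by right translations.) Let $\mathcal R'$ be the set of tuples $\underline\alpha=(\alpha_1,0,\alpha_3,0,\dots,\alpha_{m-1})$ with entries in $\mathbb F$ which vanish at the even places. For $i\in\{0,1\}$ and $\underline\alpha\in\mathcal R'$ put $\Delta_{i,\underline\alpha}=\varpi^i\bigl(1+\sum_{r=1}^{m-1}\alpha_r\varpi^r\bigr)\in K^\times$. If $m$ is even, let $\phi_{i,\underline\alpha}\in\pi_\psi$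 be supported on $H\Delta_{i,\underline\alpha}$ with $\phi_{i,\underline\alpha}(h\Delta_{i,\underline\alpha})=\theta_\psi^\#(h)$ for $h\in H$. If $m$ is odd and $a\in\mathbb F$, let $\phi_{i,\underline\alpha,a}\in\pi_\psi$ be supported on $H\Delta_{i,\underline\alpha}$ with $\phi_{i,\underline\alpha,a}(h\Delta_{i,\underline\alpha})=\theta_\psi^\#(h)f_a$ for $h\in H$. **Proposition.** If $m$ is odd then $H_1'\cap K^\times=F^\times(1+\mathcal P_K^{m+1})$, and if $m$ is even then $H\cap K^\times=F^\times(1+\mathcal P_K^m)$. Let $\chi$ be a smooth character of $K^\times$ such that $$\chi=\psi'\ \text{ on }F^\times(1+\mathcal P_K^{m+1})\ \text{ if } m \text{ is odd},\qquad \chi=\theta_\psi^\#\ \text{ on }F^\times(1+\mathcal P_K^{m})\ \text{ if } m\text{ is even}.$$ Then $\chi$ occurs with multiplicity one in the restriction of $\pi_\psi$ to $K^\times$, and the nonzero vector $$v_\chi=\begin{cases}\displaystyle\sum_{i=0,1}\ \sum_{\underline\alpha\in\mathcal R'}\ \sum_{a\in\mathbb F}\chi(\Delta_{i,\underline\alpha})\,\chi(1+a\varpi^m)\,\phi_{i,\underline\alpha,a}&\text{if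 } m\text{ is odd},\\[2mm] \displaystyle\sum_{i=0,1}\ \sum_{\underline\alpha\in\mathcal R'}\chi(\Delta_{i,\underline\alpha})\,\phi_{i,\underline\alpha}&\text{if } m\text{ is even}\end{cases}$$ lies in the $\chi$-isotypic component of $\pi_\psi$, i.e. $\pi_\psi(z)v_\chi=\chi(z)v_\chi$ for all $z\in K^\times$. -/

import Mathlib

open ValuativeRel

namespace QuaternionTori

noncomputable section

/-! ### Generalities -/

section General

/-- A character `χ : G → ℂˣ`, viewed as a one-dimensional representation on `ℂ`. -/
def charRep {G : Type*} [Group G] (χ : G →* ℂˣ) : Representation ℂ G ℂ :=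
  ((Algebra.lmul ℂ ℂ : ℂ →* Module.End ℂ ℂ).comp (Units.coeHom ℂ)).comp χ

/-- The `χ`-isotypic component of the restriction of `π` along `ι : T → G`, i.e.
`{v | π(ι z) v = χ(z) v for all z}`; its dimension is the multiplicity of `χ` in `π|_T`. -/
def isotypic {T G V : Type*} [Group T] [Group G] [AddCommMonoid V] [Module ℂ V]
    (ι : T →* G) (π : Representation ℂ G V) (χ : T →* ℂˣ) : Submodule ℂ V where
  carrier := {v | ∀ z : T, π (ι z) v = (χ z : ℂ) • v}
  add_mem' := by
    intro a b ha hb z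
    rw [map_add, ha z, hb z, smul_add]
  zero_mem' := by
    intro z
    simp
  smul_mem' := by
    intro c v hv z
    rw [map_smul, hv z, smul_comm]

open Classical in
/-- Let `ρ` be a representation of `S` on `W`, and let `S → G → A` be injective group
homomorphisms (inclusions of subgroups). For `g₀ ∈ A` and `w ∈ W` this is the function `G → W`
in the induced representation `Ind_S^G ρ` which is supported on `S g₀` and takes the value
`ρ(s) w` at `s g₀`. -/
def supportedOn {S G A W : Type*} [Group S] [Group G] [Group A] [AddCommGroup W] [Module ℂ W]
    (φ : S →* G) (j : G →* A) (hinj : Function.Injective (j.comp φ))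
    (ρ : Representation ℂ S W) (g₀ : A) (w : W) : Representation.coindV φ ρ :=
  ⟨fun g => if h : ∃ s : S, j g = j (φ s) * g₀ then ρ h.choose w else 0, by
    intro s g
    change (if h : ∃ t : S, j (φ s * g) = j (φ t) * g₀ then ρ h.choose w else 0) =
      ρ s (if h : ∃ t : S, j g = j (φ t) * g₀ then ρ h.choose w else 0)
    by_cases h : ∃ t : S, j g = j (φ t) * g₀
    · have h' : ∃ t : S, j (φ s * g) = j (φ t) * g₀ := by
        obtain ⟨t, ht⟩ := h
        exact ⟨s * t, by rw [map_mul, ht, map_mul, map_mul, mul_assoc]⟩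
      have key : h'.choose = s * h.choose := by
        apply hinj
        have e3 : j (φ h'.choose) * g₀ = j (φ s) * j (φ h.choose) * g₀ := by
          rw [mul_assoc, ← h.choose_spec, ← map_mul, ← h'.choose_spec]
        simpa using mul_right_cancel e3
      rw [dif_pos h', dif_pos h, key, map_mul]
      rfl
    · have h' : ¬ ∃ t : S, j (φ s * g) = j (φ t) * g₀ := by
        rintro ⟨t, ht⟩
        refine h ⟨s⁻¹ * t, ?_⟩
        rw [map_mul] at ht
        rw [map_mul, map_mul, mul_assoc, ← ht, map_inv, map_inv, inv_mul_cancel_left]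
      rw [dif_neg h', dif_neg h, map_zero]⟩

end General

/-! ### Absolute value, prime ideals and unit groups in a division algebra -/

section DivisionAlgebra

variable {F D : Type*} [Field F] [ValuativeRel F] [DivisionRing D] [Algebra F D]

variable (F) in
/-- The absolute value `|x| = |N(x)|_F` of `D`, where `N(x)` is the determinant over `F` of
multiplication by `x` on `D` (the square of the reduced norm). The ring of integers `𝒪_D` is
`{|x| ≤ 1}`. -/
def dAbs (x : D) : ValueGroupWithZero F := valuation F (Algebra.norm F x)

/-- The fractional ideal `𝒫_E ^ n` of a subfield `E ⊆ D` with uniformizer `t`, for `n : ℤ`. For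
`E = ⊤` and `t` a uniformizer of `D` it is `𝒫_D ^ n`. -/
def primePow (E : Subalgebra F D) (t : D) (n : ℤ) : Set D :=
  {x | x ∈ E ∧ dAbs F x ≤ dAbs F t ^ n}

/-- The group `1 + 𝒫_E ^ n` (which means `𝒪_E^×` when `n = 0`) as a subgroup of `D^×`. The set
inside the closure is already a group. -/
def unitGroup (E : Subalgebra F D) (t : D) (n : ℕ) : Subgroup Dˣ :=
  Subgroup.closure {u | (u : D) ∈ E ∧ dAbs F (u : D) = 1 ∧ (u : D) - 1 ∈ primePow E t n}

/-- The inclusion `E^× → D^×`. -/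
def toDUnits (E : Subalgebra F D) : (↥E)ˣ →* Dˣ := Units.map (E.val : ↥E →* D)

/-- The torus `E^×` as a subgroup of `D^×`. -/
def torus (E : Subalgebra F D) : Subgroup Dˣ := (toDUnits E).range

variable (F D) in
/-- `F^×` as a subgroup of `D^×`. -/
def center : Subgroup Dˣ := (Units.map (algebraMap F D : F →* D)).range

/-- A character of `E^×` is trivial on `1 + 𝒫_E ^ n`. -/
def TrivialOn (E : Subalgebra F D) (t : D) (χ : (↥E)ˣ →* ℂˣ) (n : ℕ) : Prop :=
  ∀ u : (↥E)ˣ, toDUnits E u ∈ unitGroup E t n → χ u = 1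

/-- Smooth characters of `E^×`. -/
def IsSmooth (E : Subalgebra F D) (t : D) (χ : (↥E)ˣ →* ℂˣ) : Prop :=
  ∃ n : ℕ, TrivialOn E t χ n

/-- The conductor of a (smooth) character of `E^×`: the least `ν ≥ 0` such that the character is
trivial on `1 + 𝒫_E ^ ν`. -/
def conductor (E : Subalgebra F D) (t : D) (χ : (↥E)ˣ →* ℂˣ) : ℕ :=
  sInf {ν | TrivialOn E t χ ν}

/-- Smooth characters of `F^×`. -/
def IsSmoothBase (t : F) (φ : Fˣ →* ℂˣ) : Prop :=
  ∃ n : ℕ, ∀ u : Fˣ, valuation F (u : F) = 1 →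
    valuation F ((u : F) - 1) ≤ valuation F t ^ n → φ u = 1

/-- A smooth character `χ` of `E^×` is minimal if `f(χ) ≤ f(χ · φ ∘ Nm_{E/F})` for all smooth
characters `φ` of `F^×`. Here `tE`, `tF` are uniformizers of `E`, `F`. -/
def IsMinimal (E : Subalgebra F D) (tE : D) (tF : F) (χ : (↥E)ˣ →* ℂˣ) : Prop :=
  ∀ φ : Fˣ →* ℂˣ, IsSmoothBase tF φ →
    conductor E tE χ ≤ conductor E tE (χ * φ.comp (Units.map (Algebra.norm F : ↥E →* F)))

/-- An additive character of `F` of conductor `0`: trivial on `𝒪_F`, not on `𝒫_F⁻¹`. -/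
def IsConductorZero (t : F) (ψ₀ : AddChar F ℂ) : Prop :=
  (∀ x : F, valuation F x ≤ 1 → ψ₀ x = 1) ∧ ∃ x : F, valuation F (t * x) ≤ 1 ∧ ψ₀ x ≠ 1

/-- The trace over `F` of the multiplication by `x` on `A`; it is `Tr_{A/F}` when `A` is a field. -/
def mulTrace (F : Type*) {A : Type*} [Field F] [Ring A] [Algebra F A] (x : A) : F :=
  LinearMap.trace F A (LinearMap.mulLeft F x)

variable (F) in
/-- The reduced trace of a quaternion algebra (in characteristic not two): half of the trace of
the multiplication by `x` on the four-dimensional space `D`. -/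
def reducedTrace (x : D) : F := mulTrace F x / 2

/-- A nonzero element of `E`, as an element of `E^×`. -/
def unitOfMem [FiniteDimensional F D] (E : Subalgebra F D) (x : D) (hx : x ∈ E) (h0 : x ≠ 0) :
    (↥E)ˣ where
  val := ⟨x, hx⟩
  inv := ⟨x⁻¹, (Algebra.IsIntegral.isIntegral (R := F) x).inv_mem hx⟩
  val_inv := Subtype.ext (mul_inv_cancel₀ h0)
  inv_val := Subtype.ext (inv_mul_cancel₀ h0)

end DivisionAlgebra

/-! ### The elements `ζ` and `ϖ`, and the objects built from them -/

/-- The choices of a primitive `(q² - 1)`-st root of unity `ζ` in `D` and a uniformizer `ϖ` of `D`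
such that `ϖ² = ϖ_F` is a uniformizer of `F` and `ϖ ζ ϖ⁻¹ = ζ ^ q`, where `q` is the residue
cardinality of `F`. -/
structure Frame (F D : Type*) [Field F] [ValuativeRel F] [DivisionRing D] [Algebra F D] where
  ζ : D
  ϖ : D
  ϖF : 𝒪[F]
  irreducible_ϖF : Irreducible ϖF
  orderOf_ζ : orderOf ζ = Nat.card 𝓀[F] ^ 2 - 1
  sq_ϖ : ϖ ^ 2 = algebraMap F D (ϖF : F)
  conj_ζ : ϖ * ζ * ϖ⁻¹ = ζ ^ Nat.card 𝓀[F]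

namespace Frame

section Basic

variable {F D : Type*} [Field F] [ValuativeRel F] [DivisionRing D] [Algebra F D] (X : Frame F D)

/-- The unramified quadratic extension `M = F(ζ)`. -/
def M : Subalgebra F D := Algebra.adjoin F {X.ζ}

/-- The ramified quadratic extension `K = F(ϖ)`. -/
def K : Subalgebra F D := Algebra.adjoin F {X.ϖ}

/-- The ramified quadratic extension `L = F(ζϖ)`. -/
def L : Subalgebra F D := Algebra.adjoin F {X.ζ * X.ϖ}

/-- The uniformizer `ϖ_F` of `F`, which is also one of `M`, as an element of `D`. -/
def ϖM : D := algebraMap F D (X.ϖF : F)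

/-- `1 + 𝒫_D ^ n`. -/
def UD (n : ℕ) : Subgroup Dˣ := unitGroup (⊤ : Subalgebra F D) X.ϖ n

/-- `1 + 𝒫_M ^ n`. -/
def UM (n : ℕ) : Subgroup Dˣ := unitGroup X.M X.ϖM n

/-- `1 + 𝒫_K ^ n`. -/
def UK (n : ℕ) : Subgroup Dˣ := unitGroup X.K X.ϖ n

/-- `1 + 𝒫_L ^ n`. -/
def UL (n : ℕ) : Subgroup Dˣ := unitGroup X.L (X.ζ * X.ϖ) n

/-- `H = M^× (1 + 𝒫_D ^ m)`. -/
def H (m : ℕ) : Subgroup Dˣ := torus X.M ⊔ X.UD m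

/-- `H' = F^× (1 + 𝒫_M) (1 + 𝒫_D ^ m)`. -/
def H' (m : ℕ) : Subgroup Dˣ := center F D ⊔ X.UM 1 ⊔ X.UD m

/-- `H₁' = F^× (1 + 𝒫_M) (1 + 𝒫_L ^ m) (1 + 𝒫_D ^ (m+1))`. -/
def H₁' (m : ℕ) : Subgroup Dˣ := center F D ⊔ X.UM 1 ⊔ X.UL m ⊔ X.UD (m + 1)

open Classical in
/-- The set `𝔽 = 𝔻 ∩ F` of representatives of `𝒪_F / 𝒫_F`, where `𝔻 = ⟨ζ⟩ ∪ {0}`. -/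
def reps : Finset F :=
  (insert 0 ((Finset.range (Nat.card 𝓀[F] ^ 2 - 1)).image fun i => X.ζ ^ i) : Finset D).preimage
    (algebraMap F D) (algebraMap F D).injective.injOn

/-- The index set `R'` of tuples `(α₁, 0, α₃, 0, …, α_{m-1})` with entries in `𝔽`, which vanish at
the even places. Only the entries at the `m / 2` odd places `r = 2 j + 1 ≤ m - 1` are recorded. -/
def R' (m : ℕ) : Finset (Fin (m / 2) → F) := Fintype.piFinset fun _ => X.reps

/-- `Δ_{i,α} = ϖ ^ i (1 + ∑ α_r ϖ ^ r)`, the sum over odd `r = 2 j + 1 ≤ m - 1`. -/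
def Δ (m i : ℕ) (α : Fin (m / 2) → F) : D :=
  X.ϖ ^ i * (1 + ∑ j, algebraMap F D (α j) * X.ϖ ^ (2 * (j : ℕ) + 1))

/-- `c ∈ 𝒫_M ^ (-m-1)`, `c ∉ F + 𝒫_M ^ (-m)`, and `ψ(1 + x) = ψ₀(Tr_{M/F}(c x))` for all
`x ∈ 𝒫_M ^ [(m+2)/2]`. -/
def Represents (m : ℕ) (ψ₀ : AddChar F ℂ) (ψ : (↥X.M)ˣ →* ℂˣ) (c : ↥X.M) : Prop :=
  (c : D) ∈ primePow X.M X.ϖM (-(m : ℤ) - 1) ∧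
  (∀ a : F, (c : D) - algebraMap F D a ∉ primePow X.M X.ϖM (-(m : ℤ))) ∧
  ∀ u : (↥X.M)ˣ, toDUnits X.M u ∈ X.UM ((m + 2) / 2) →
    (ψ u : ℂ) = ψ₀ (mulTrace F (c * ((u : ↥X.M) - 1)))

/-- `ψ_c(1 + x) = ψ₀(Trd(c x))`, evaluated at `u = 1 + x`. -/
def ψc (ψ₀ : AddChar F ℂ) (c : ↥X.M) (u : Dˣ) : ℂ :=
  ψ₀ (reducedTrace F ((c : D) * ((u : D) - 1)))

/-- For `m` even, `H = M^× (1 + 𝒫_D ^ (m+1))`, and `θ` is the character `θ_ψ^#` of `H`: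
`θ(y (1 + x)) = ψ(y) ψ_c(1 + x)` for `y ∈ M^×`, `1 + x ∈ 1 + 𝒫_D ^ (m+1)`. -/
def IsThetaEven (m : ℕ) (ψ₀ : AddChar F ℂ) (ψ : (↥X.M)ˣ →* ℂˣ) (c : ↥X.M)
    (θ : ↥(X.H m) →* ℂˣ) : Prop :=
  ∀ (h : ↥(X.H m)) (y : (↥X.M)ˣ) (u : Dˣ), u ∈ X.UD (m + 1) →
    (h : Dˣ) = toDUnits X.M y * u → (θ h : ℂ) = (ψ y : ℂ) * X.ψc ψ₀ c u

/-- For `m` odd, `ψ'` is a character of `H₁'` extending the character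
`ψ''(a (1 + y) (1 + x)) = ψ(a) ψ(1 + y) ψ_c(1 + x)` of `H'' = F^× (1 + 𝒫_M) (1 + 𝒫_D ^ (m+1))`. -/
def IsPsiPrime (m : ℕ) (ψ₀ : AddChar F ℂ) (ψ : (↥X.M)ˣ →* ℂˣ) (c : ↥X.M)
    (ψ' : ↥(X.H₁' m) →* ℂˣ) : Prop :=
  ∀ (h : ↥(X.H₁' m)) (a y : (↥X.M)ˣ) (u : Dˣ), toDUnits X.M a ∈ center F D →
    toDUnits X.M y ∈ X.UM 1 → u ∈ X.UD (m + 1) →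
    (h : Dˣ) = toDUnits X.M a * toDUnits X.M y * u →
      (ψ' h : ℂ) = (ψ a : ℂ) * (ψ y : ℂ) * X.ψc ψ₀ c u

lemma ϖ_ne_zero : X.ϖ ≠ 0 := by
  intro h
  have h1 := X.sq_ϖ
  rw [h, zero_pow two_ne_zero] at h1
  have h2 := (map_eq_zero (algebraMap F D)).1 h1.symm
  exact X.irreducible_ϖF.ne_zero (Subtype.ext h2)

lemma ϖ_odd_pow (k : ℕ) : X.ϖ ^ (2 * k + 1) = algebraMap F D ((X.ϖF : F) ^ k) * X.ϖ := by
  rw [pow_succ, pow_mul, X.sq_ϖ, map_pow]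

lemma ϖ_mem_K : X.ϖ ∈ X.K := Algebra.subset_adjoin rfl

lemma dAbs_ϖ_le : dAbs F X.ϖ ≤ 1 := by
  have h : dAbs F X.ϖ ^ 2 ≤ 1 := by
    rw [dAbs, ← map_pow, ← map_pow, X.sq_ϖ, Algebra.norm_algebraMap, map_pow]
    exact pow_le_one' X.ϖF.2 _
  exact (pow_le_one_iff two_ne_zero).1 h

lemma one_add_pow_mem_K (m : ℕ) (a : F) : 1 + algebraMap F D a * X.ϖ ^ m ∈ X.K :=
  add_mem (one_mem _) (mul_mem (X.K.algebraMap_mem _) (pow_mem X.ϖ_mem_K _))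

lemma Δ_mem_K (m i : ℕ) (α : Fin (m / 2) → F) : X.Δ m i α ∈ X.K :=
  mul_mem (pow_mem X.ϖ_mem_K _) (add_mem (one_mem _) (sum_mem fun _ _ =>
    mul_mem (X.K.algebraMap_mem _) (pow_mem X.ϖ_mem_K _)))

lemma UD_succ_le (n : ℕ) : X.UD (n + 1) ≤ X.UD n := by
  refine Subgroup.closure_mono ?_
  rintro u ⟨-, h1, -, h2⟩
  refine ⟨trivial, h1, trivial, h2.trans ?_⟩
  rw [zpow_natCast, zpow_natCast]
  exact pow_le_pow_right_of_le_one' X.dAbs_ϖ_le (Nat.le_succ n)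

end Basic

section LocalField

variable {F D : Type*} [Field F] [ValuativeRel F] [TopologicalSpace F]
  [IsNonarchimedeanLocalField F] [DivisionRing D] [Algebra F D] (X : Frame F D)

lemma one_lt_q (F : Type*) [Field F] [ValuativeRel F] [TopologicalSpace F]
    [IsNonarchimedeanLocalField F] : 1 < Nat.card 𝓀[F] := Finite.one_lt_card

lemma q_ne (F : Type*) [Field F] [ValuativeRel F] [TopologicalSpace F]
    [IsNonarchimedeanLocalField F] : Nat.card 𝓀[F] ^ 2 - 1 ≠ 0 := by
  have := one_lt_q F
  have : 1 < Nat.card 𝓀[F] ^ 2 := Nat.one_lt_pow (by norm_num) this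
  omega

lemma one_add_ne_zero (b : F) : 1 + algebraMap F D b * X.ϖ ≠ 0 := by
  intro h
  have hq := one_lt_q F
  have hb : b ≠ 0 := by
    rintro rfl
    simp at h
  have e : X.ϖ = algebraMap F D (-b⁻¹) := by
    have hb' : algebraMap F D b ≠ 0 := by simpa using hb
    apply mul_left_cancel₀ hb'
    rw [← map_mul, mul_neg, mul_inv_cancel₀ hb, map_neg, map_one]
    exact (neg_eq_of_add_eq_zero_right h).symm
  have hc := X.conj_ζ
  have hcomm : X.ϖ * X.ζ = X.ζ * X.ϖ := by rw [e]; exact Algebra.commutes _ _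
  rw [hcomm, mul_assoc, mul_inv_cancel₀ X.ϖ_ne_zero, mul_one] at hc
  have hz : X.ζ ≠ 0 := by
    intro h0
    have h1 := pow_orderOf_eq_one X.ζ
    rw [X.orderOf_ζ, h0, zero_pow (q_ne F)] at h1
    exact zero_ne_one h1
  have h1 : X.ζ ^ (Nat.card 𝓀[F] - 1) = 1 := by
    apply mul_right_cancel₀ hz
    rw [← pow_succ, Nat.sub_add_cancel hq.le, one_mul]
    exact hc.symm
  have h2 := Nat.le_of_dvd (by omega) (orderOf_dvd_of_pow_eq_one h1)
  rw [X.orderOf_ζ] at h2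
  have h3 : Nat.card 𝓀[F] < Nat.card 𝓀[F] ^ 2 := by nlinarith
  omega

lemma Δ_ne_zero (m i : ℕ) (α : Fin (m / 2) → F) : X.Δ m i α ≠ 0 := by
  refine mul_ne_zero (pow_ne_zero _ X.ϖ_ne_zero) ?_
  simp only [ϖ_odd_pow, ← mul_assoc, ← map_mul, ← Finset.sum_mul, ← map_sum]
  exact X.one_add_ne_zero _

lemma one_add_pow_ne_zero {m : ℕ} (hm : Odd m) (a : F) :
    1 + algebraMap F D a * X.ϖ ^ m ≠ 0 := by
  obtain ⟨k, rfl⟩ := hm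
  rw [ϖ_odd_pow, ← mul_assoc, ← map_mul]
  exact X.one_add_ne_zero _

lemma dAbs_ζ : dAbs F X.ζ = 1 := by
  have h : dAbs F X.ζ ^ (Nat.card 𝓀[F] ^ 2 - 1) = 1 := by
    rw [dAbs, ← map_pow, ← map_pow, ← X.orderOf_ζ, pow_orderOf_eq_one, map_one, map_one]
  exact (pow_eq_one_iff_of_nonneg zero_le (q_ne F)).1 h

lemma dAbs_ζϖ : dAbs F (X.ζ * X.ϖ) = dAbs F X.ϖ := by
  have h := X.dAbs_ζ
  rw [dAbs] at h ⊢
  rw [map_mul, map_mul, h, one_mul, dAbs]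

lemma UL_le_UD (n : ℕ) : X.UL n ≤ X.UD n := by
  refine Subgroup.closure_mono ?_
  rintro u ⟨-, h1, -, h2⟩
  refine ⟨trivial, h1, trivial, ?_⟩
  rwa [dAbs_ζϖ] at h2

lemma H₁'_le_H' (m : ℕ) : X.H₁' m ≤ X.H' m :=
  sup_le (sup_le_sup_left (X.UL_le_UD m) _)
    ((X.UD_succ_le m).trans le_sup_right)

/-- The inclusion `H₁' → H'`. -/
def incl (m : ℕ) : ↥(X.H₁' m) →* ↥(X.H' m) := Subgroup.inclusion (X.H₁'_le_H' m)

/-- For `m` odd, the space `W` of the representation `θ_ψ = Ind_{H₁'}^{H'} ψ'`: functions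
`f : H' → ℂ` with `f(h₁ h) = ψ'(h₁) f(h)`. -/
abbrev W (m : ℕ) (ψ' : ↥(X.H₁' m) →* ℂˣ) : Submodule ℂ (↥(X.H' m) → ℂ) :=
  Representation.coindV (X.incl m) (charRep ψ')

/-- For `m` odd, the representation `θ_ψ = Ind_{H₁'}^{H'} ψ'` of `H'` by right translations. -/
def θψ (m : ℕ) (ψ' : ↥(X.H₁' m) →* ℂˣ) : Representation ℂ ↥(X.H' m) (X.W m ψ') :=
  Representation.coind (X.incl m) (charRep ψ')

/-- For `m` odd, `Θ` is the representation `θ_ψ^#` of `H`: it extends `θ_ψ`, and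
`det Θ = ψ ^ q` on `⟨ζ⟩`. -/
def IsThetaOdd (m : ℕ) (ψ : (↥X.M)ˣ →* ℂˣ) (ψ' : ↥(X.H₁' m) →* ℂˣ)
    (Θ : Representation ℂ ↥(X.H m) (X.W m ψ')) : Prop :=
  (∀ (h : ↥(X.H m)) (h' : ↥(X.H' m)), (h : Dˣ) = h' → Θ h = X.θψ m ψ' h') ∧
  ∀ (h : ↥(X.H m)) (y : (↥X.M)ˣ) (i : ℕ), ((y : ↥X.M) : D) = X.ζ ^ i →
    (h : Dˣ) = toDUnits X.M y → LinearMap.det (Θ h) = (ψ y : ℂ) ^ Nat.card 𝓀[F]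

/-- `π_ψ = Ind_H^{D^×} Θ`: functions `f : D^× → W` with `f(h g) = Θ(h) f(g)`, on which `D^×` acts
by right translations. -/
def πψ (m : ℕ) {V : Type*} [AddCommGroup V] [Module ℂ V] (Θ : Representation ℂ ↥(X.H m) V) :
    Representation ℂ Dˣ (Representation.coindV (X.H m).subtype Θ) :=
  Representation.coind (X.H m).subtype Θ

/-- The function `D^× → W` supported on `H g₀` with value `Θ(h) w` at `h g₀`. -/
def φ (m : ℕ) {V : Type*} [AddCommGroup V] [Module ℂ V] (Θ : Representation ℂ ↥(X.H m) V)
    (g₀ : Dˣ) (w : V) : Representation.coindV (X.H m).subtype Θ :=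
  supportedOn (X.H m).subtype (MonoidHom.id Dˣ) Subtype.coe_injective Θ g₀ w

variable [FiniteDimensional F D]

/-- `Δ_{i,α}` as an element of `K^×`. -/
def ΔK (m i : ℕ) (α : Fin (m / 2) → F) : (↥X.K)ˣ :=
  unitOfMem X.K (X.Δ m i α) (X.Δ_mem_K m i α) (X.Δ_ne_zero m i α)

/-- `1 + a ϖ ^ m`, for `m` odd, as an element of `K^×`. -/
def oneAdd {m : ℕ} (hm : Odd m) (a : F) : (↥X.K)ˣ :=
  unitOfMem X.K (1 + algebraMap F D a * X.ϖ ^ m) (X.one_add_pow_mem_K m a)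
    (X.one_add_pow_ne_zero hm a)

/-- For `m` odd, the function `f_a ∈ W` supported on `H₁' (1 + a ϖ ^ m)` which takes the value
`ψ'(h₁)` at `h₁ (1 + a ϖ ^ m)`. -/
def f {m : ℕ} (hm : Odd m) (ψ' : ↥(X.H₁' m) →* ℂˣ) (a : F) : X.W m ψ' :=
  supportedOn (X.incl m) (X.H' m).subtype
    (Subtype.coe_injective.comp (Subgroup.inclusion_injective (X.H₁'_le_H' m)))
    (charRep ψ') (toDUnits X.K (X.oneAdd hm a)) 1

/-- For `m` odd, the vector
`v_χ = ∑_{i, α, a} χ(Δ_{i,α}) χ(1 + a ϖ ^ m) φ_{i,α,a}`, where `φ_{i,α,a}` is supported on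
`H Δ_{i,α}` with `φ_{i,α,a}(h Δ_{i,α}) = Θ(h) f_a`. -/
def vOdd {m : ℕ} (hm : Odd m) (ψ' : ↥(X.H₁' m) →* ℂˣ)
    (Θ : Representation ℂ ↥(X.H m) (X.W m ψ')) (χ : (↥X.K)ˣ →* ℂˣ) :
    Representation.coindV (X.H m).subtype Θ :=
  ∑ i ∈ Finset.range 2, ∑ α ∈ X.R' m, ∑ a ∈ X.reps,
    ((χ (X.ΔK m i α) : ℂ) * (χ (X.oneAdd hm a) : ℂ)) •
      X.φ m Θ (toDUnits X.K (X.ΔK m i α)) (X.f hm ψ' a)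

/-- For `m` even, the vector `v_χ = ∑_{i, α} χ(Δ_{i,α}) φ_{i,α}`, where `φ_{i,α}` is supported on
`H Δ_{i,α}` with `φ_{i,α}(h Δ_{i,α}) = θ(h)`. -/
def vEven (m : ℕ) (θ : ↥(X.H m) →* ℂˣ) (χ : (↥X.K)ˣ →* ℂˣ) :
    Representation.coindV (X.H m).subtype (charRep θ) :=
  ∑ i ∈ Finset.range 2, ∑ α ∈ X.R' m,
    (χ (X.ΔK m i α) : ℂ) • X.φ m (charRep θ) (toDUnits X.K (X.ΔK m i α)) 1

end LocalField

end Frame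

end

end QuaternionTori

namespace QuaternionTori

set_option linter.unusedSectionVars false

noncomputable section

/-! ### The valuation and the residue field of `F`. -/

section BaseField

variable {F : Type*} [Field F] [ValuativeRel F] [TopologicalSpace F]
  [IsNonarchimedeanLocalField F] {ϖ : 𝒪[F]}

/-! The argument is Mackey theory for the pair `H`, `K^×` in `D^×`, made explicit in coordinates.
Put `ω = ζ^(q+1)`, a unit of `F` that is not a square modulo `𝒫_F`, and `η = ζ^((q+1)/2)`. Then `η²
= ω` and `ϖη = -ηϖ`, so `D` is the quaternion algebra with basis `1, η, ϖ, ηϖ`, and `D = M ⊕ Mϖ`.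
Values on `M` are even powers of `p = |ϖ|`, values on `Mϖ` odd ones, so `|d|` is the larger of the
values of the two components (`abs_eq_max`). Membership in `H` becomes the inequality `Near`: the
`Mϖ`-component is at most `p^m` times the `M`-component. The intersections with `K^×` are then read
off from coordinates; for `H₁'` the additional ingredient is the condition `SmallL`, which sees the
direction of `L` inside `Mϖ`.

Let `f` be `χ`-isotypic with `f(g) ≠ 0`. For `k ∈ 1 + 𝒫_K^(m+1)`, computing `f(gk)` from the right
and from the left shows that `ψ_c(gkg⁻¹) = ψ_c(k)`. This bounds the `ϖ`-coordinate of `g⁻¹ηg` by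
`p^[m/2]`, and an approximate form of Hilbert 90 in `K` then yields `g ∈ H K^×`
(`exists_mul_of_ψc_conj_eq`). Hence `f` lives on a single double coset and is determined by `f(1)`,
a vector on which `H ∩ K^×` acts by `χ` (`finrank_isotypic_coind_eq_one`). The `Δ_{i,α}` represent
`(H ∩ K^×) \ K^×`, which gives the vector `v_χ`.

For `m` even, `W = ℂ` and every vector is admissible. For `m` odd, `H ∩ K^× ⊆ H'`, and the elements
`1 + aϖ^m` of `K^×` represent `H₁' \ H'` (`exists_oneAdd`, `oneAdd_unique`). So an admissible vector
of `W` is determined by its value at `1`, and `∑ χ(1 + aϖ^m) f_a` is one. The same construction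
`equivariantVector` serves at both levels of induction. -/

lemma valuation_ne_zero_of_irreducible (hϖ : Irreducible ϖ) : valuation F (ϖ : F) ≠ 0 := by
  rw [Valuation.ne_zero_iff]
  exact fun h => hϖ.ne_zero (Subtype.ext h)

lemma valuation_pos_of_irreducible (hϖ : Irreducible ϖ) : 0 < valuation F (ϖ : F) :=
  zero_lt_iff.2 (valuation_ne_zero_of_irreducible hϖ)

lemma isUnit_integer_iff (x : 𝒪[F]) : IsUnit x ↔ valuation F (x : F) = 1 :=
  (Valuation.integer.integers (valuation F)).isUnit_iff_valuation_eq_one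

lemma valuation_lt_one_of_irreducible (hϖ : Irreducible ϖ) : valuation F (ϖ : F) < 1 :=
  lt_of_le_of_ne ϖ.2 fun h => hϖ.not_isUnit ((isUnit_integer_iff ϖ).2 h)

lemma exists_valuation_eq_zpow (hϖ : Irreducible ϖ) {x : F} (hx : x ≠ 0) :
    ∃ k : ℤ, valuation F x = valuation F (ϖ : F) ^ k := by
  have key : ∀ y : F, y ≠ 0 → valuation F y ≤ 1 →
      ∃ k : ℕ, valuation F y = valuation F (ϖ : F) ^ k := by
    intro y hy h
    obtain ⟨n, u, hu⟩ := IsDiscreteValuationRing.eq_unit_mul_pow_irreducible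
      (x := (⟨y, h⟩ : 𝒪[F])) (fun h0 => hy (congrArg Subtype.val h0)) hϖ
    refine ⟨n, ?_⟩
    have h1 : y = (u : 𝒪[F]) * (ϖ : F) ^ n := congrArg Subtype.val hu
    rw [h1, map_mul, map_pow, (isUnit_integer_iff _).1 u.isUnit, one_mul]
  rcases le_total (valuation F x) 1 with h | h
  · obtain ⟨k, hk⟩ := key x hx h
    exact ⟨k, by rw [hk, zpow_natCast]⟩
  · obtain ⟨k, hk⟩ := key x⁻¹ (inv_ne_zero hx) (by rw [map_inv₀]; exact inv_le_one_of_one_le₀ h)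
    refine ⟨-k, ?_⟩
    rw [zpow_neg, zpow_natCast, ← hk, map_inv₀, inv_inv]

lemma zpow_le_zpow_iff_of_irreducible (hϖ : Irreducible ϖ) (k n : ℤ) :
    valuation F (ϖ : F) ^ k ≤ valuation F (ϖ : F) ^ n ↔ n ≤ k :=
  zpow_le_zpow_iff_right_of_lt_one₀ (valuation_pos_of_irreducible hϖ)
    (valuation_lt_one_of_irreducible hϖ)

/-- Values are integral powers of that of the uniformizer, so halving the exponent `j` means
rounding up to `n = ⌈j/2⌉`. This rounding is behind every parity argument below. -/
lemma sq_le_zpow_iff (hϖ : Irreducible ϖ) (x : F) {n j : ℤ} (h : 2 * n = j ∨ 2 * n = j + 1) :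
    valuation F x ^ 2 ≤ valuation F (ϖ : F) ^ j ↔ valuation F x ≤ valuation F (ϖ : F) ^ n := by
  rcases eq_or_ne x 0 with rfl | hx
  · simp
  · obtain ⟨k, hk⟩ := exists_valuation_eq_zpow hϖ hx
    rw [hk, ← zpow_natCast, ← zpow_mul, zpow_le_zpow_iff_of_irreducible hϖ,
      zpow_le_zpow_iff_of_irreducible hϖ]
    push_cast
    omega

lemma valuation_lt_zpow_iff (hϖ : Irreducible ϖ) (x : F) (n : ℤ) :
    valuation F x < valuation F (ϖ : F) ^ n ↔ valuation F x ≤ valuation F (ϖ : F) ^ (n + 1) := by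
  rcases eq_or_ne x 0 with rfl | hx
  · simp [zpow_pos (valuation_pos_of_irreducible hϖ)]
  · obtain ⟨k, hk⟩ := exists_valuation_eq_zpow hϖ hx
    rw [hk, ← not_le, zpow_le_zpow_iff_of_irreducible hϖ, zpow_le_zpow_iff_of_irreducible hϖ]
    omega

lemma valuation_lt_one_iff (hϖ : Irreducible ϖ) (x : F) :
    valuation F x < 1 ↔ valuation F x ≤ valuation F (ϖ : F) := by
  simpa using valuation_lt_zpow_iff hϖ x 0

/-- A value which is an even power of a uniformizer is not an odd one. -/
lemma sq_ne_mul_sq (hϖ : Irreducible ϖ) {x y : F} (hx : x ≠ 0) :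
    valuation F x ^ 2 ≠ valuation F (ϖ : F) * valuation F y ^ 2 := by
  rcases eq_or_ne y 0 with rfl | hy
  · simp [hx]
  obtain ⟨k, hk⟩ := exists_valuation_eq_zpow hϖ hx
  obtain ⟨l, hl⟩ := exists_valuation_eq_zpow hϖ hy
  intro h
  have h0 := valuation_ne_zero_of_irreducible hϖ
  rw [hk, hl, ← zpow_natCast, ← zpow_natCast, ← zpow_mul, ← zpow_mul,
    ← zpow_one_add₀ h0] at h
  have h1 := (zpow_right_injective₀ (valuation_pos_of_irreducible hϖ)
    (valuation_lt_one_of_irreducible hϖ).ne) h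
  push_cast at h1
  omega

/-- If `y` were not integral, then `x / y` would be integral for every `x ∈ 𝒫_F⁻¹`, and `ψ₀` would
be trivial on `𝒫_F⁻¹`. -/
lemma valuation_le_one_of_addChar (hϖ : Irreducible ϖ) {ψ₀ : AddChar F ℂ}
    (hψ₀ : IsConductorZero (ϖ : F) ψ₀) {y : F}
    (h : ∀ t : F, valuation F t ≤ 1 → ψ₀ (t * y) = 1) : valuation F y ≤ 1 := by
  by_contra hy
  obtain ⟨x, hx, hx1⟩ := hψ₀.2
  have hy0 : y ≠ 0 := by
    rintro rfl
    simp at hy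
  refine hx1 ?_
  have := h (x / y) ?_
  · rwa [div_mul_cancel₀ _ hy0] at this
  · have h2 : valuation F y⁻¹ ≤ valuation F (ϖ : F) := by
      rw [← valuation_lt_one_iff hϖ, map_inv₀]
      exact inv_lt_one_of_one_lt₀ (not_le.1 hy)
    rw [div_eq_mul_inv, map_mul, mul_comm]
    rw [map_mul] at hx
    exact (mul_le_mul_left h2 _).trans hx

lemma valuation_natCast_le (n : ℕ) : valuation F (n : F) ≤ 1 := by
  have h : valuation F ((n : 𝒪[F]) : F) ≤ 1 := (n : 𝒪[F]).2
  push_cast at h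
  exact h

lemma residue_eq_zero_iff' (x : 𝒪[F]) :
    IsLocalRing.residue 𝒪[F] x = 0 ↔ valuation F (x : F) < 1 := by
  rw [IsLocalRing.residue_eq_zero_iff, IsLocalRing.mem_maximalIdeal, mem_nonunits_iff,
    isUnit_integer_iff]
  exact ⟨fun h => lt_of_le_of_ne x.2 h, fun h => h.ne⟩

variable (F) in
lemma valuation_card_lt_one : valuation F ((Nat.card 𝓀[F] : ℕ) : F) < 1 := by
  have h : IsLocalRing.residue 𝒪[F] (Nat.card 𝓀[F] : 𝒪[F]) = 0 := by
    rw [map_natCast]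
    have := Fintype.ofFinite 𝓀[F]
    rw [Nat.card_eq_fintype_card]
    exact Nat.cast_card_eq_zero _
  simpa using (residue_eq_zero_iff' _).1 h

lemma valuation_two (hp : ringChar 𝓀[F] ≠ 2) : valuation F (2 : F) = 1 := by
  have h : IsLocalRing.residue 𝒪[F] (2 : 𝒪[F]) ≠ 0 := by
    rw [map_ofNat]
    exact Ring.two_ne_zero hp
  rw [Ne, residue_eq_zero_iff', not_lt] at h
  refine le_antisymm ?_ h
  exact_mod_cast valuation_natCast_le (F := F) 2

lemma odd_card (hp : ringChar 𝓀[F] ≠ 2) : Odd (Nat.card 𝓀[F]) := by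
  have := Fintype.ofFinite 𝓀[F]
  rw [Nat.card_eq_fintype_card, Nat.odd_iff]
  exact FiniteField.odd_card_of_char_ne_two hp

/-- A set of `q` integers of `F` which are pairwise incongruent represents all residue classes. -/
lemma exists_rep_of_card (S : Finset F) (h1 : ∀ a ∈ S, valuation F a ≤ 1)
    (h2 : ∀ a ∈ S, ∀ b ∈ S, valuation F (a - b) < 1 → a = b) (hS : Nat.card 𝓀[F] ≤ S.card)
    {x : F} (hx : valuation F x ≤ 1) : ∃ a ∈ S, valuation F (x - a) < 1 := by
  have := Fintype.ofFinite 𝓀[F]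
  let g : S → 𝓀[F] := fun a => IsLocalRing.residue 𝒪[F] ⟨a, h1 a a.2⟩
  have hg : Function.Injective g := by
    intro a b hab
    rw [← sub_eq_zero, ← map_sub, residue_eq_zero_iff'] at hab
    exact Subtype.ext (h2 a a.2 b b.2 hab)
  have hb : Function.Bijective g := by
    rw [Fintype.bijective_iff_injective_and_card]
    refine ⟨hg, le_antisymm (Fintype.card_le_of_injective g hg) ?_⟩
    rw [← Nat.card_eq_fintype_card, Fintype.card_coe]
    exact hS
  obtain ⟨a, ha⟩ := hb.2 (IsLocalRing.residue 𝒪[F] ⟨x, hx⟩)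
  refine ⟨a, a.2, ?_⟩
  rw [eq_comm, ← sub_eq_zero, ← map_sub, residue_eq_zero_iff'] at ha
  exact ha

end BaseField

namespace Frame

/-! ### Powers of `ζ`, the representatives `𝔽`, and bases of `D`. -/

section Construction

variable {F D : Type*} [Field F] [ValuativeRel F] [TopologicalSpace F]
  [IsNonarchimedeanLocalField F] [DivisionRing D] [Algebra F D] (X : Frame F D)

lemma ζ_ne_zero : X.ζ ≠ 0 := by
  intro h0
  have h1 := pow_orderOf_eq_one X.ζ
  rw [X.orderOf_ζ, h0, zero_pow (q_ne F)] at h1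
  exact zero_ne_one h1

lemma ϖ_mul_ζ_pow (k : ℕ) : X.ϖ * X.ζ ^ k = X.ζ ^ (Nat.card 𝓀[F] * k) * X.ϖ := by
  have h : X.ϖ * X.ζ = X.ζ ^ Nat.card 𝓀[F] * X.ϖ := by
    rw [← X.conj_ζ, mul_assoc, inv_mul_cancel₀ X.ϖ_ne_zero, mul_one]
  induction k with
  | zero => simp
  | succ k ih => rw [pow_succ, ← mul_assoc, ih, mul_assoc, h, ← mul_assoc, ← pow_add]; rfl

/-- Commuting with `ϖ` forces `ζ^((q-1)k) = 1`, while `ζ` has order `(q-1)(q+1)`. This identifies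
the powers of `ζ` in `F`, and shows that `ζ` and `ζ^((q+1)/2)` do not commute with `ϖ`. -/
lemma dvd_of_commute_ζ_pow {k : ℕ} (h : Commute X.ϖ (X.ζ ^ k)) : Nat.card 𝓀[F] + 1 ∣ k := by
  have hq := one_lt_q F
  have h1 : X.ζ ^ (Nat.card 𝓀[F] * k) = X.ζ ^ k := by
    have h2 := h.eq
    rw [ϖ_mul_ζ_pow] at h2
    exact mul_right_cancel₀ X.ϖ_ne_zero h2
  have h2 : X.ζ ^ ((Nat.card 𝓀[F] - 1) * k) = 1 := by
    apply mul_right_cancel₀ (pow_ne_zero k X.ζ_ne_zero)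
    rw [one_mul, ← pow_add, ← h1]
    congr 1
    obtain ⟨r, hr⟩ := Nat.exists_eq_add_of_lt hq
    rw [hr]
    simp only [Nat.add_sub_cancel]
    ring
  have h3 := orderOf_dvd_of_pow_eq_one h2
  rw [X.orderOf_ζ] at h3
  have h4 : Nat.card 𝓀[F] ^ 2 - 1 = (Nat.card 𝓀[F] - 1) * (Nat.card 𝓀[F] + 1) := by
    rw [mul_comm, ← Nat.sq_sub_sq, one_pow]
  rw [h4] at h3
  exact Nat.dvd_of_mul_dvd_mul_left (by omega) h3

/-- If `Y` does not commute with `ϖ`, then `1, Y, ϖ, Yϖ` are linearly independent over `F`. -/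
lemma eq_zero_of_combination {Y : D} (hY : ¬ Commute X.ϖ Y) {x y z w : F}
    (h : algebraMap F D x + algebraMap F D y * Y + (algebraMap F D z + algebraMap F D w * Y) * X.ϖ
      = 0) : x = 0 ∧ y = 0 ∧ z = 0 ∧ w = 0 := by
  have aux : ∀ a b : F, algebraMap F D a + algebraMap F D b * Y = 0 → a = 0 ∧ b = 0 := by
    intro a b hab
    have hb : b = 0 := by
      by_contra hb
      apply hY
      have hb' : algebraMap F D b ≠ 0 := by simpa using hb
      have : Y = algebraMap F D (b⁻¹ * -a) := by
        apply mul_left_cancel₀ hb'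
        rw [← map_mul, mul_inv_cancel_left₀ hb, map_neg]
        exact eq_neg_of_add_eq_zero_right hab
      rw [this]
      exact (Algebra.commutes _ _).symm
    subst hb
    simpa using hab
  -- Otherwise `ϖ = -(z + wY)⁻¹(x + yY)` would commute with `Y`.
  have hu : algebraMap F D z + algebraMap F D w * Y = 0 := by
    by_contra hu
    apply hY
    have : X.ϖ = (algebraMap F D z + algebraMap F D w * Y)⁻¹ *
        -(algebraMap F D x + algebraMap F D y * Y) := by
      apply mul_left_cancel₀ hu
      rw [mul_inv_cancel_left₀ hu]
      exact eq_neg_of_add_eq_zero_right h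
    have hc : ∀ a b : F, Commute (algebraMap F D a + algebraMap F D b * Y) Y := fun a b =>
      (Algebra.commute_algebraMap_left a Y).add_left
        ((Algebra.commute_algebraMap_left b Y).mul_left (Commute.refl Y))
    rw [this]
    exact ((hc z w).inv_left₀).mul_left ((hc x y).neg_left)
  rw [hu, zero_mul, add_zero] at h
  exact ⟨(aux x y h).1, (aux x y h).2, (aux z w hu).1, (aux z w hu).2⟩

/-- If `Y` does not commute with `ϖ`, then `1, Y, ϖ, Yϖ` span `D` over `F`. -/
lemma exists_combination (hD : Module.finrank F D = 4) {Y : D} (hY : ¬ Commute X.ϖ Y) (d : D) :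
    ∃ x y z w : F, d = algebraMap F D x + algebraMap F D y * Y +
      (algebraMap F D z + algebraMap F D w * Y) * X.ϖ := by
  have hli : LinearIndependent F ![1, Y, X.ϖ, Y * X.ϖ] := by
    rw [Fintype.linearIndependent_iff]
    intro g hg
    simp only [Fin.sum_univ_four, Matrix.cons_val, Algebra.smul_def] at hg
    obtain ⟨h0, h1, h2, h3⟩ := X.eq_zero_of_combination hY (x := g 0) (y := g 1) (z := g 2)
      (w := g 3) (by rw [← hg]; noncomm_ring)
    intro i
    fin_cases i <;> assumption
  have := hli.span_eq_top_of_card_eq_finrank (by simp [hD])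
  have hd : d ∈ Submodule.span F (Set.range ![1, Y, X.ϖ, Y * X.ϖ]) := by
    rw [this]; trivial
  rw [Submodule.mem_span_range_iff_exists_fun] at hd
  obtain ⟨g, hg⟩ := hd
  refine ⟨g 0, g 1, g 2, g 3, ?_⟩
  simp only [Fin.sum_univ_four, Matrix.cons_val, Algebra.smul_def] at hg
  rw [← hg]
  noncomm_ring

/-- Since `q(q+1) ≡ q+1` modulo `q² - 1`, the element `ζ^(q+1)` commutes with `ϖ` as well as with
`ζ`, and these generate `D`; so it is central. -/
lemma exists_algebraMap_eq_ζ_pow [Algebra.IsCentral F D] (hD : Module.finrank F D = 4) :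
    ∃ ω : F, algebraMap F D ω = X.ζ ^ (Nat.card 𝓀[F] + 1) := by
  have hq := one_lt_q F
  have h1 : ¬ Commute X.ϖ X.ζ := by
    intro h
    have := X.dvd_of_commute_ζ_pow (k := 1) (by simpa using h)
    have := Nat.le_of_dvd one_pos this
    omega
  have hϖ : Commute (X.ζ ^ (Nat.card 𝓀[F] + 1)) X.ϖ := by
    have h := X.ϖ_mul_ζ_pow (Nat.card 𝓀[F] + 1)
    rw [show Nat.card 𝓀[F] * (Nat.card 𝓀[F] + 1) =
        Nat.card 𝓀[F] ^ 2 - 1 + (Nat.card 𝓀[F] + 1) by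
      have : 1 ≤ Nat.card 𝓀[F] ^ 2 := Nat.one_le_pow _ _ (by omega)
      zify [this]; ring] at h
    rw [pow_add _ (_ - 1), ← X.orderOf_ζ, pow_orderOf_eq_one, one_mul] at h
    exact h.symm
  have hζ : Commute (X.ζ ^ (Nat.card 𝓀[F] + 1)) X.ζ := Commute.pow_self _ _
  have hc : X.ζ ^ (Nat.card 𝓀[F] + 1) ∈ Subalgebra.center F D := by
    rw [Subalgebra.mem_center_iff]
    intro d
    obtain ⟨x, y, z, w, rfl⟩ := X.exists_combination hD h1 d
    have hF : ∀ a : F, Commute (X.ζ ^ (Nat.card 𝓀[F] + 1)) (algebraMap F D a) := fun a =>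
      (Algebra.commutes a _).symm
    exact ((((hF x).add_right ((hF y).mul_right hζ)).add_right
      (((hF z).add_right ((hF w).mul_right hζ)).mul_right hϖ))).symm.eq
  have := Algebra.IsCentral.out hc
  exact this

variable {X}

lemma isPrimitiveRoot_ω {ω : F} (hω : algebraMap F D ω = X.ζ ^ (Nat.card 𝓀[F] + 1)) :
    IsPrimitiveRoot ω (Nat.card 𝓀[F] - 1) := by
  have h4 : Nat.card 𝓀[F] ^ 2 - 1 = (Nat.card 𝓀[F] + 1) * (Nat.card 𝓀[F] - 1) := by
    rw [← Nat.sq_sub_sq, one_pow]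
  have h : orderOf ω = Nat.card 𝓀[F] - 1 := by
    rw [← orderOf_injective (algebraMap F D : F →* D) (algebraMap F D).injective ω]
    change orderOf (algebraMap F D ω) = _
    rw [hω, orderOf_pow_of_dvd (by omega) (by rw [X.orderOf_ζ, h4]; exact Dvd.intro _ rfl),
      X.orderOf_ζ, h4, Nat.mul_div_cancel_left _ (by omega)]
  rw [← h]
  exact IsPrimitiveRoot.orderOf _

lemma mem_reps_iff {ω : F} (hω : algebraMap F D ω = X.ζ ^ (Nat.card 𝓀[F] + 1)) (a : F) :
    a ∈ X.reps ↔ a = 0 ∨ ∃ j < Nat.card 𝓀[F] - 1, a = ω ^ j := by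
  have hq := one_lt_q F
  have h4 : Nat.card 𝓀[F] ^ 2 - 1 = (Nat.card 𝓀[F] + 1) * (Nat.card 𝓀[F] - 1) := by
    rw [← Nat.sq_sub_sq, one_pow]
  simp only [reps, Finset.mem_preimage, Finset.mem_insert, map_eq_zero, Finset.mem_image,
    Finset.mem_range]
  refine or_congr_right ⟨?_, ?_⟩
  · rintro ⟨i, hi, hia⟩
    obtain ⟨j, rfl⟩ := X.dvd_of_commute_ζ_pow (k := i)
      (by rw [hia]; exact Algebra.commute_algebraMap_right _ _)
    refine ⟨j, ?_, ?_⟩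
    · rw [h4] at hi
      exact lt_of_mul_lt_mul_left hi (Nat.zero_le _)
    · apply (algebraMap F D).injective
      rw [← hia, map_pow, hω, pow_mul]
  · rintro ⟨j, hj, rfl⟩
    refine ⟨(Nat.card 𝓀[F] + 1) * j, ?_, by rw [map_pow, hω, pow_mul]⟩
    rw [h4]
    exact Nat.mul_lt_mul_of_pos_left hj (by omega)

lemma valuation_eq_one_of_pow_eq_one {x : F} {n : ℕ} (hn : n ≠ 0) (h : x ^ n = 1) :
    valuation F x = 1 := by
  have : valuation F x ^ n = 1 := by rw [← map_pow, h, map_one]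
  exact (pow_eq_one_iff_of_nonneg zero_le hn).1 this

/-- Distinct roots of unity of order dividing `q - 1` are incongruent. -/
lemma eq_zero_of_valuation_one_sub_pow {ω : F} (hω : IsPrimitiveRoot ω (Nat.card 𝓀[F] - 1))
    {j : ℕ} (h : valuation F (1 - ω ^ j) < 1) : ω ^ j = 1 := by
  have hq := one_lt_q F
  have hω1 : valuation F ω = 1 := valuation_eq_one_of_pow_eq_one (by omega) hω.pow_eq_one
  obtain ⟨n, hn⟩ : ∃ n, Nat.card 𝓀[F] - 1 = n + 1 := ⟨_, (Nat.sub_add_cancel (by omega)).symm⟩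
  rw [hn] at hω
  -- The factors `1 - ω^k` with `0 < k < q - 1` are integral and their product `q - 1` is a unit,
  -- hence each of them is a unit.
  have hprod := hω.prod_one_sub_pow_eq_order
  have hle : ∀ k : ℕ, valuation F (1 - ω ^ k) ≤ 1 := fun k =>
    (Valuation.map_sub _ _ _).trans (by simp [hω1])
  have hv : valuation F ((n + 1 : ℕ) : F) = 1 := by
    have h1 : ((n + 1 : ℕ) : F) = (Nat.card 𝓀[F] : F) - 1 := by
      rw [← hn, Nat.cast_sub hq.le, Nat.cast_one]
    rw [h1, Valuation.map_sub_swap, Valuation.map_one_sub_of_lt _ (valuation_card_lt_one F)]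
  have key : ∀ k < n, valuation F (1 - ω ^ (k + 1)) = 1 := by
    intro k hk
    have h1 : ∏ k ∈ Finset.range n, valuation F (1 - ω ^ (k + 1)) = 1 := by
      rw [← map_prod, hprod]
      exact_mod_cast hv
    by_contra hne
    have hlt := lt_of_le_of_ne (hle (k + 1)) hne
    have h2 : ∏ k ∈ Finset.range n, valuation F (1 - ω ^ (k + 1)) < 1 := by
      rw [← Finset.mul_prod_erase _ _ (Finset.mem_range.2 hk)]
      exact mul_lt_one_of_lt_of_le hlt (Finset.prod_le_one' fun i _ => hle (i + 1))
    exact h2.ne h1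
  rw [← pow_mod_orderOf, ← hω.eq_orderOf] at h ⊢
  have hlt : j % (n + 1) < n + 1 := Nat.mod_lt _ (by omega)
  rcases Nat.eq_zero_or_pos (j % (n + 1)) with h0 | h0
  · rw [h0, pow_zero]
  · obtain ⟨k, hk⟩ := Nat.exists_eq_add_of_le' h0
    rw [hk] at h hlt
    exact absurd (key k (by omega)) h.ne

lemma valuation_le_one_of_mem_reps {ω : F}
    (hω : algebraMap F D ω = X.ζ ^ (Nat.card 𝓀[F] + 1)) {a : F} (ha : a ∈ X.reps) :
    valuation F a ≤ 1 := by
  have hq := one_lt_q F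
  have h := isPrimitiveRoot_ω hω
  rw [mem_reps_iff hω] at ha
  rcases ha with rfl | ⟨j, -, rfl⟩
  · simp
  · rw [map_pow, valuation_eq_one_of_pow_eq_one (by omega) h.pow_eq_one, one_pow]

lemma eq_of_mem_reps {ω : F} (hω : algebraMap F D ω = X.ζ ^ (Nat.card 𝓀[F] + 1)) {a b : F}
    (ha : a ∈ X.reps) (hb : b ∈ X.reps) (hab : valuation F (a - b) < 1) : a = b := by
  have hq := one_lt_q F
  have h := isPrimitiveRoot_ω hω
  have h1 : valuation F ω = 1 := valuation_eq_one_of_pow_eq_one (by omega) h.pow_eq_one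
  have key : ∀ i j : ℕ, j ≤ i → valuation F (ω ^ i - ω ^ j) < 1 → ω ^ i = ω ^ j := by
    intro i j hij hv
    obtain ⟨k, rfl⟩ := Nat.exists_eq_add_of_le hij
    have e : ω ^ (j + k) - ω ^ j = -(ω ^ j * (1 - ω ^ k)) := by ring
    rw [e, Valuation.map_neg, map_mul, map_pow, h1, one_pow, one_mul] at hv
    rw [pow_add, eq_zero_of_valuation_one_sub_pow h hv, mul_one]
  rw [mem_reps_iff hω] at ha hb
  rcases ha with rfl | ⟨i, -, rfl⟩ <;> rcases hb with rfl | ⟨j, -, rfl⟩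
  · rfl
  · simp [h1] at hab
  · simp [h1] at hab
  · rcases le_total j i with hij | hij
    · exact key i j hij hab
    · rw [Valuation.map_sub_swap] at hab
      exact (key j i hij hab).symm

lemma exists_mem_reps {ω : F} (hω : algebraMap F D ω = X.ζ ^ (Nat.card 𝓀[F] + 1)) {x : F}
    (hx : valuation F x ≤ 1) : ∃ a ∈ X.reps, valuation F (x - a) < 1 := by
  have hq := one_lt_q F
  have h := isPrimitiveRoot_ω hω
  refine exists_rep_of_card X.reps (fun a ha => valuation_le_one_of_mem_reps hω ha)
    (fun a ha b hb => eq_of_mem_reps hω ha hb) ?_ hx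
  classical
  have hsub : insert 0 ((Finset.range (Nat.card 𝓀[F] - 1)).image fun j => ω ^ j) ⊆ X.reps := by
    intro a ha
    rw [mem_reps_iff hω]
    simp only [Finset.mem_insert, Finset.mem_image, Finset.mem_range] at ha
    rcases ha with rfl | ⟨j, hj, rfl⟩
    · exact Or.inl rfl
    · exact Or.inr ⟨j, hj, rfl⟩
  refine le_trans ?_ (Finset.card_le_card hsub)
  rw [Finset.card_insert_of_notMem, Finset.card_image_of_injOn, Finset.card_range]
  · omega
  · intro i hi j hj hij
    exact h.pow_inj (by simpa using hi) (by simpa using hj) hij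
  · simp only [Finset.mem_image, not_exists, not_and]
    intro j _ hj
    exact pow_ne_zero _ (h.ne_zero (by omega)) hj

/-- `ω = ζ ^ (q + 1)` is not a square modulo the maximal ideal. -/
lemma valuation_sq_sub_mul_sq (hp : ringChar 𝓀[F] ≠ 2) {ω : F}
    (hω : algebraMap F D ω = X.ζ ^ (Nat.card 𝓀[F] + 1)) (x y : F) :
    valuation F (x ^ 2 - ω * y ^ 2) = max (valuation F x) (valuation F y) ^ 2 := by
  have hq := one_lt_q F
  obtain ⟨r, hr⟩ := odd_card (F := F) hp
  have h := isPrimitiveRoot_ω hω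
  have h1 : valuation F ω = 1 := valuation_eq_one_of_pow_eq_one (by omega) h.pow_eq_one
  rcases lt_or_ge (valuation F y) (valuation F x) with hxy | hxy
  · rw [max_eq_left hxy.le, Valuation.map_sub_eq_of_lt_left, map_pow]
    rw [map_mul, h1, one_mul, map_pow, map_pow]
    exact pow_lt_pow_left₀ hxy zero_le two_ne_zero
  · rw [max_eq_right hxy]
    rcases eq_or_ne y 0 with rfl | hy
    · have : x = 0 := by simpa using hxy
      simp [this]
    have hy' : valuation F y ≠ 0 := by simpa using hy
    have hx1 : valuation F (x / y) ≤ 1 := by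
      rw [map_div₀]
      exact div_le_one_of_le₀ hxy zero_le
    have e : x ^ 2 - ω * y ^ 2 = ((x / y) ^ 2 - ω) * y ^ 2 := by field_simp
    have key : valuation F ((x / y) ^ 2 - ω) = 1 := by
      have hle : valuation F ((x / y) ^ 2 - ω) ≤ 1 :=
        (Valuation.map_sub _ _ _).trans (by simpa [h1] using pow_le_one' (by simpa using hx1) 2)
      refine hle.eq_of_not_lt fun hlt => ?_
      obtain ⟨a, ha, hxa⟩ := exists_mem_reps hω hx1
      have ha1 := valuation_le_one_of_mem_reps hω ha
      have h2 : valuation F (a ^ 2 - ω) < 1 := by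
        have e2 : a ^ 2 - ω = ((x / y) ^ 2 - ω) - (x / y - a) * (x / y + a) := by ring
        rw [e2]
        refine (Valuation.map_sub _ _ _).trans_lt (max_lt hlt ?_)
        rw [map_mul]
        exact mul_lt_one_of_lt_of_le hxa ((Valuation.map_add _ _ _).trans (max_le hx1 ha1))
      rw [mem_reps_iff hω] at ha
      rcases ha with rfl | ⟨j, -, rfl⟩
      · simp [h1] at h2
      · have e3 : (ω ^ j) ^ 2 - ω = ω ^ (2 * j) - ω ^ 1 := by ring
        -- With `q - 1 = 2r`, the exponent `2j - 1` is shifted by `2r` to stay a natural number. It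
        -- is odd, so the power cannot be `1`, the order `2r` of `ω` being even.
        have e4 : (ω ^ j) ^ 2 - ω = - (ω * (1 - ω ^ (2 * j + (2 * r - 1)))) := by
          have e5 : ω ^ (2 * r) = 1 := by
            rw [← h.pow_eq_one, hr]; rfl
          have e6 : ω * ω ^ (2 * j + (2 * r - 1)) = ω ^ (2 * j) * ω ^ (2 * r) := by
            rw [← pow_succ', ← pow_add]
            congr 1
            omega
          rw [mul_sub, e6, e5, ← pow_mul, mul_comm j]
          ring
        rw [e4, Valuation.map_neg, map_mul, h1, one_mul] at h2
        have h3 := (h.pow_eq_one_iff_dvd _).1 (eq_zero_of_valuation_one_sub_pow h h2)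
        rw [hr, Nat.add_sub_cancel] at h3
        have := (Dvd.intro _ rfl : 2 ∣ 2 * r).trans h3
        omega
    rw [e, map_mul, key, one_mul, map_pow]

end Construction

end Frame

/-! ### Norm and trace of left multiplication on a quaternion algebra. -/

section QuaternionNorm

open QuaternionAlgebra

variable {F : Type*} [Field F] {a b : F}

lemma leftMulMatrix_quaternion (x : QuaternionAlgebra F a 0 b) :
    Algebra.leftMulMatrix (basisOneIJK a 0 b) x =
      !![x.re, a * x.imI, b * x.imJ, -(a * b * x.imK);
        x.imI, x.re, b * x.imK, -(b * x.imJ);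
        x.imJ, -(a * x.imK), x.re, a * x.imI;
        x.imK, -x.imJ, x.imI, x.re] := by
  ext i j
  rw [Algebra.leftMulMatrix_eq_repr_mul]
  have h : ∀ j, basisOneIJK a 0 b j = (linearEquivTuple a 0 b).symm (Pi.single j 1) := fun j =>
    congrFun (Module.Basis.coe_ofEquivFun _) j
  rw [h, coe_basisOneIJK_repr]
  fin_cases i <;> fin_cases j <;> simp

lemma norm_quaternion (x : QuaternionAlgebra F a 0 b) :
    Algebra.norm F x =
      (x.re ^ 2 - a * x.imI ^ 2 - b * (x.imJ ^ 2 - a * x.imK ^ 2)) ^ 2 := by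
  rw [Algebra.norm_eq_matrix_det (basisOneIJK a 0 b), leftMulMatrix_quaternion]
  simp [Matrix.det_succ_row_zero, Fin.sum_univ_succ, Fin.succAbove]
  ring

lemma mulTrace_quaternion (x : QuaternionAlgebra F a 0 b) : mulTrace F x = 4 * x.re := by
  have h : LinearMap.toMatrix (basisOneIJK a 0 b) (basisOneIJK a 0 b) (LinearMap.mulLeft F x) =
      Algebra.leftMulMatrix (basisOneIJK a 0 b) x := rfl
  rw [mulTrace, LinearMap.trace_eq_matrix_trace F (basisOneIJK a 0 b), h, leftMulMatrix_quaternion]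
  simp [Matrix.trace, Fin.sum_univ_succ]
  ring

end QuaternionNorm

/-! ### Quaternion coordinates on `D`. -/

namespace Frame

/-- An isomorphism of `D` with the quaternion algebra `F⟨η, ϖ⟩`, where `η ^ 2 = ω` is a unit which
is not a square modulo the maximal ideal and `M = F(η)`. -/
structure Coords {F D : Type*} [Field F] [ValuativeRel F] [DivisionRing D] [Algebra F D]
    (X : Frame F D) where
  ω : F
  e : D ≃ₐ[F] QuaternionAlgebra F ω 0 (X.ϖF : F)
  e_ϖ : e X.ϖ = ⟨0, 0, 1, 0⟩
  s : F
  t : F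
  e_ζ : e X.ζ = ⟨s, t, 0, 0⟩
  norm_ζ : s ^ 2 - ω * t ^ 2 = ω
  val_two : valuation F (2 : F) = 1
  val_ω : valuation F ω = 1
  val_norm : ∀ x y : F,
    valuation F (x ^ 2 - ω * y ^ 2) = max (valuation F x) (valuation F y) ^ 2
  val_reps : ∀ a ∈ X.reps, valuation F a ≤ 1
  reps_unique : ∀ a ∈ X.reps, ∀ b ∈ X.reps, valuation F (a - b) < 1 → a = b
  exists_rep : ∀ x : F, valuation F x ≤ 1 → ∃ a ∈ X.reps, valuation F (x - a) < 1

variable {F D : Type*} [Field F] [ValuativeRel F] [TopologicalSpace F]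
  [IsNonarchimedeanLocalField F] [DivisionRing D] [Algebra F D] (X : Frame F D)

/-- With `q = 2r + 1`, take `η = ζ^(r+1)`, so `η² = ζ^(q+1) = ω`. From `q(r+1) = 2r(r+1) + (r+1)`
and `ζ^(2r(r+1)) = ζ^((q²-1)/2) = -1` it follows that `ϖη = -ηϖ`. These are the relations of the
quaternion algebra. -/
lemma nonempty_coords [CharZero F] [Algebra.IsCentral F D] (hp : ringChar 𝓀[F] ≠ 2)
    (hD : Module.finrank F D = 4) : Nonempty X.Coords := by
  have hq := one_lt_q F
  obtain ⟨r, hr⟩ := odd_card (F := F) hp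
  obtain ⟨ω, hω⟩ := X.exists_algebraMap_eq_ζ_pow hD
  have hω1 : valuation F ω = 1 :=
    valuation_eq_one_of_pow_eq_one (by omega) (isPrimitiveRoot_ω hω).pow_eq_one
  have hω0 : ω ≠ 0 := by
    rintro rfl
    simp at hω1
  have hη2 : X.ζ ^ (r + 1) * X.ζ ^ (r + 1) = algebraMap F D ω := by
    rw [hω, hr, ← pow_add]
    congr 1
    omega
  have hη : ¬ Commute X.ϖ (X.ζ ^ (r + 1)) := by
    intro h
    have := Nat.le_of_dvd (by omega) (X.dvd_of_commute_ζ_pow h)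
    omega
  have hneg : X.ζ ^ (2 * r * (r + 1)) = -1 := by
    have hlt : 2 * r * (r + 1) < Nat.card 𝓀[F] ^ 2 - 1 := by
      rw [hr, show (2 * r + 1) ^ 2 = 2 * r * (r + 1) + 2 * r * (r + 1) + 1 by ring]
      have : 0 < 2 * r * (r + 1) := by
        apply Nat.mul_pos <;> omega
      omega
    have h2 : X.ζ ^ (2 * r * (r + 1)) * X.ζ ^ (2 * r * (r + 1)) = 1 := by
      rw [← pow_add, ← pow_orderOf_eq_one X.ζ, X.orderOf_ζ, hr,
        show (2 * r + 1) ^ 2 = 2 * r * (r + 1) + 2 * r * (r + 1) + 1 by ring]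
      rfl
    rcases mul_self_eq_one_iff.1 h2 with h | h
    · have := Nat.le_of_dvd (by apply Nat.mul_pos <;> omega) (orderOf_dvd_of_pow_eq_one h)
      rw [X.orderOf_ζ] at this
      omega
    · exact h
  have hanti : X.ϖ * X.ζ ^ (r + 1) = -(X.ζ ^ (r + 1) * X.ϖ) := by
    rw [X.ϖ_mul_ζ_pow, hr, show (2 * r + 1) * (r + 1) = 2 * r * (r + 1) + (r + 1) by ring, pow_add,
      hneg]
    simp
  let B : QuaternionAlgebra.Basis D ω 0 (X.ϖF : F) :=
    { i := X.ζ ^ (r + 1)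
      j := X.ϖ
      k := X.ζ ^ (r + 1) * X.ϖ
      i_mul_i := by rw [hη2, zero_smul, add_zero, Algebra.algebraMap_eq_smul_one]
      j_mul_j := by rw [← pow_two, X.sq_ϖ, Algebra.algebraMap_eq_smul_one]
      i_mul_j := rfl
      j_mul_i := by rw [hanti, zero_smul, zero_sub] }
  have hlift : ∀ x, B.liftHom x = algebraMap F D x.re + algebraMap F D x.imI * X.ζ ^ (r + 1) +
      (algebraMap F D x.imJ + algebraMap F D x.imK * X.ζ ^ (r + 1)) * X.ϖ := by
    intro x
    simp only [QuaternionAlgebra.Basis.liftHom_apply, QuaternionAlgebra.Basis.lift,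
      Algebra.smul_def, B]
    noncomm_ring
  have hbij : Function.Bijective B.liftHom := by
    constructor
    · rw [injective_iff_map_eq_zero]
      intro x hx
      rw [hlift] at hx
      obtain ⟨h0, h1, h2, h3⟩ := X.eq_zero_of_combination hη hx
      exact QuaternionAlgebra.ext h0 h1 h2 h3
    · intro d
      obtain ⟨x, y, z, w, rfl⟩ := X.exists_combination hD hη d
      exact ⟨⟨x, y, z, w⟩, hlift _⟩
  let e := (AlgEquiv.ofBijective B.liftHom hbij).symm
  have he : ∀ d x, B.liftHom x = d → e d = x := by
    rintro d x rfl
    exact (AlgEquiv.ofBijective B.liftHom hbij).symm_apply_apply x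
  have heϖ : e X.ϖ = ⟨0, 0, 1, 0⟩ := he _ _ (by rw [hlift]; simp)
  have heη : e (X.ζ ^ (r + 1)) = ⟨0, 1, 0, 0⟩ := he _ _ (by rw [hlift]; simp)
  -- As `ζ` commutes with its power `η`, its coordinates along `ϖ` and `ηϖ` are killed by `2` and
  -- `2ω`.
  have hcomm : e X.ζ * ⟨0, 1, 0, 0⟩ = ⟨0, 1, 0, 0⟩ * e X.ζ := by
    rw [← heη, ← map_mul, ← map_mul, ← pow_succ, ← pow_succ']
  have hJ := congrArg QuaternionAlgebra.imJ hcomm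
  have hK := congrArg QuaternionAlgebra.imK hcomm
  simp at hJ hK
  have hJ0 : (e X.ζ).imJ = 0 := by
    have h2 : (2 : F) * (e X.ζ).imJ = 0 := by linear_combination -hK
    simpa using h2
  have hK0 : (e X.ζ).imK = 0 := by
    have h2 : (2 * ω : F) * (e X.ζ).imK = 0 := by linear_combination -hJ
    simpa [hω0] using h2
  have heζ : e X.ζ = ⟨(e X.ζ).re, (e X.ζ).imI, 0, 0⟩ :=
    QuaternionAlgebra.ext rfl rfl hJ0 hK0
  have hn : (e X.ζ).re ^ 2 - ω * (e X.ζ).imI ^ 2 = ω := by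
    -- The `ϖ`-coordinate of `(s + tη)ϖ(s + tη)` is `s² - ωt²`.
    have h1 : X.ζ * X.ϖ * X.ζ = algebraMap F D ω * X.ϖ := by
      have := X.ϖ_mul_ζ_pow 1
      rw [pow_one, mul_one] at this
      rw [mul_assoc, this, ← mul_assoc, ← pow_succ', hω]
    have h2 := congrArg QuaternionAlgebra.imJ (congrArg e h1)
    rw [map_mul, map_mul, map_mul, heϖ, AlgEquiv.commutes, heζ] at h2
    simp [QuaternionAlgebra.algebraMap_eq] at h2
    linear_combination h2
  exact ⟨⟨ω, e, heϖ, _, _, heζ, hn, valuation_two hp, hω1, valuation_sq_sub_mul_sq hp hω,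
    fun a ha => valuation_le_one_of_mem_reps hω ha, fun a ha b hb => eq_of_mem_reps hω ha hb,
    fun x hx => exists_mem_reps hω hx⟩⟩

end Frame

/-! ### The absolute value of `D` and the decomposition `D = M ⊕ Mϖ`. -/

namespace Frame

variable {F D : Type*} [Field F] [ValuativeRel F] [TopologicalSpace F]
  [IsNonarchimedeanLocalField F] [DivisionRing D] [Algebra F D] {X : Frame F D}

/-- The value of the uniformizer `ϖ_F` of `F`. -/
abbrev p (X : Frame F D) : ValueGroupWithZero F := valuation F (X.ϖF : F)

lemma p_pos (X : Frame F D) : 0 < X.p := valuation_pos_of_irreducible X.irreducible_ϖF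

lemma p_ne_zero (X : Frame F D) : X.p ≠ 0 := X.p_pos.ne'

lemma p_lt_one (X : Frame F D) : X.p < 1 := valuation_lt_one_of_irreducible X.irreducible_ϖF

namespace Coords

variable (C : X.Coords)

/-- The reduced norm of `D`. -/
def nrd (d : D) : F :=
  (C.e d).re ^ 2 - C.ω * (C.e d).imI ^ 2 - X.ϖF * ((C.e d).imJ ^ 2 - C.ω * (C.e d).imK ^ 2)

/-- The absolute value `|Nrd(d)|` of `D`. -/
def abs (d : D) : ValueGroupWithZero F := valuation F (C.nrd d)

/-- The component of `d` in `M` with respect to `D = M ⊕ Mϖ`. -/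
def mPart (d : D) : D := C.e.symm ⟨(C.e d).re, (C.e d).imI, 0, 0⟩

/-- The component of `d` in `Mϖ` with respect to `D = M ⊕ Mϖ`. -/
def jPart (d : D) : D := C.e.symm ⟨0, 0, (C.e d).imJ, (C.e d).imK⟩

/-- The conjugate of `d`. -/
def conj (d : D) : D := C.e.symm (star (C.e d))

@[simp] lemma e_mPart (d : D) : C.e (C.mPart d) = ⟨(C.e d).re, (C.e d).imI, 0, 0⟩ := by
  simp [mPart]

@[simp] lemma e_jPart (d : D) : C.e (C.jPart d) = ⟨0, 0, (C.e d).imJ, (C.e d).imK⟩ := by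
  simp [jPart]

@[simp] lemma e_algebraMap (a : F) : C.e (algebraMap F D a) = ⟨a, 0, 0, 0⟩ := by
  rw [AlgEquiv.commutes, QuaternionAlgebra.algebraMap_eq]

lemma ext {d d' : D} (h0 : (C.e d).re = (C.e d').re) (h1 : (C.e d).imI = (C.e d').imI)
    (h2 : (C.e d).imJ = (C.e d').imJ) (h3 : (C.e d).imK = (C.e d').imK) : d = d' :=
  C.e.injective (QuaternionAlgebra.ext h0 h1 h2 h3)

lemma mPart_add_jPart (d : D) : C.mPart d + C.jPart d = d := by
  apply C.ext <;> simp

lemma nrd_mul (d d' : D) : C.nrd (d * d') = C.nrd d * C.nrd d' := by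
  simp [nrd]
  ring

lemma mul_conj (d : D) : d * C.conj d = algebraMap F D (C.nrd d) := by
  have h : ∀ n : F, n = C.nrd d → d * C.conj d = algebraMap F D n := by
    intro n hn
    rw [nrd] at hn
    apply C.ext <;> simp only [e_algebraMap, hn] <;> simp [conj] <;> ring
  exact h _ rfl

lemma nrd_algebraMap (a : F) : C.nrd (algebraMap F D a) = a ^ 2 := by
  simp [nrd]

lemma nrd_neg (d : D) : C.nrd (-d) = C.nrd d := by
  simp [nrd]

lemma norm_eq (d : D) : Algebra.norm F d = C.nrd d ^ 2 := by
  rw [← Algebra.norm_eq_of_algEquiv C.e, norm_quaternion, nrd]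

lemma dAbs_eq (d : D) : dAbs F d = C.abs d ^ 2 := by
  rw [dAbs, C.norm_eq, map_pow, abs]

lemma reducedTrace_eq (d : D) : reducedTrace F d = 2 * (C.e d).re := by
  have h : mulTrace F d = mulTrace F (C.e d) := by
    rw [mulTrace, mulTrace, ← LinearMap.trace_conj' _ C.e.toLinearEquiv]
    congr 1
    ext x : 1
    simp [LinearEquiv.conj_apply]
  rw [reducedTrace, h, mulTrace_quaternion]
  have h2 : (2 : F) ≠ 0 := by
    intro h0
    have := C.val_two
    rw [h0, map_zero] at this
    exact zero_ne_one this
  rw [div_eq_iff h2]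
  ring

lemma abs_mul (d d' : D) : C.abs (d * d') = C.abs d * C.abs d' := by
  rw [abs, nrd_mul, map_mul, abs, abs]

lemma abs_algebraMap (a : F) : C.abs (algebraMap F D a) = valuation F a ^ 2 := by
  rw [abs, nrd_algebraMap, map_pow]

@[simp] lemma abs_one : C.abs (1 : D) = 1 := by
  simpa using C.abs_algebraMap 1

@[simp] lemma abs_zero : C.abs (0 : D) = 0 := by
  simpa using C.abs_algebraMap 0

lemma abs_neg (d : D) : C.abs (-d) = C.abs d := by
  rw [abs, nrd_neg, abs]

/-- The absolute value as a homomorphism of monoids with zero. -/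
def absHom : D →*₀ ValueGroupWithZero F where
  toFun := C.abs
  map_zero' := C.abs_zero
  map_one' := C.abs_one
  map_mul' := C.abs_mul

lemma abs_inv (d : D) : C.abs d⁻¹ = (C.abs d)⁻¹ := map_inv₀ C.absHom d

lemma abs_pow (d : D) (n : ℕ) : C.abs (d ^ n) = C.abs d ^ n := map_pow C.absHom d n

@[simp] lemma abs_eq_zero {d : D} : C.abs d = 0 ↔ d = 0 := map_eq_zero C.absHom

lemma abs_ne_zero {d : D} (h : d ≠ 0) : C.abs d ≠ 0 := mt C.abs_eq_zero.1 h

lemma abs_pos {d : D} (h : d ≠ 0) : 0 < C.abs d := zero_lt_iff.2 (C.abs_ne_zero h)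

lemma abs_unit_ne_zero (u : Dˣ) : C.abs (u : D) ≠ 0 := C.abs_ne_zero u.ne_zero

lemma abs_mPart (d : D) :
    C.abs (C.mPart d) = max (valuation F (C.e d).re) (valuation F (C.e d).imI) ^ 2 := by
  rw [abs, nrd, e_mPart]
  simp [C.val_norm]

lemma abs_jPart (d : D) : C.abs (C.jPart d) =
    X.p * max (valuation F (C.e d).imJ) (valuation F (C.e d).imK) ^ 2 := by
  rw [abs, nrd, e_jPart]
  simp only [ne_eq, OfNat.ofNat_ne_zero, not_false_eq_true, zero_pow, mul_zero, sub_zero, zero_sub,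
    Valuation.map_neg, map_mul, C.val_norm]

lemma exists_abs_mPart (d : D) : ∃ x : F, C.abs (C.mPart d) = valuation F x ^ 2 ∧
    (C.mPart d ≠ 0 → x ≠ 0) := by
  have h : ∃ x : F, C.abs (C.mPart d) = valuation F x ^ 2 := by
    rw [abs_mPart]
    rcases max_choice (valuation F (C.e d).re) (valuation F (C.e d).imI) with h | h
    · exact ⟨_, by rw [h]⟩
    · exact ⟨_, by rw [h]⟩
  obtain ⟨x, hx⟩ := h
  refine ⟨x, hx, ?_⟩
  rintro h rfl
  apply h
  rw [← C.abs_eq_zero, hx]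
  simp

lemma exists_abs_jPart (d : D) : ∃ x : F, C.abs (C.jPart d) = X.p * valuation F x ^ 2 := by
  rw [abs_jPart]
  rcases max_choice (valuation F (C.e d).imJ) (valuation F (C.e d).imK) with h | h
  · exact ⟨_, by rw [h]⟩
  · exact ⟨_, by rw [h]⟩

lemma abs_mPart_ne_abs_jPart {d : D} (hd : C.mPart d ≠ 0) :
    C.abs (C.mPart d) ≠ C.abs (C.jPart d) := by
  obtain ⟨x, hx, hx0⟩ := C.exists_abs_mPart d
  obtain ⟨y, hy⟩ := C.exists_abs_jPart d
  rw [hx, hy]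
  exact sq_ne_mul_sq X.irreducible_ϖF (hx0 hd)

/-- The reduced norm is additive on `M ⊕ Mϖ`, and the two summands have values of different parity
in `p`, so they cannot cancel. The ultrametric inequality for `abs` follows from this formula. -/
lemma abs_eq_max (d : D) : C.abs d = max (C.abs (C.mPart d)) (C.abs (C.jPart d)) := by
  have h : C.nrd d = C.nrd (C.mPart d) + C.nrd (C.jPart d) := by
    simp [nrd]
    ring
  rcases eq_or_ne (C.mPart d) 0 with h0 | h0
  · rw [abs, h, h0]
    have h1 : C.nrd (0 : D) = 0 := by simp [nrd]
    rw [h1, zero_add, abs_zero, max_eq_right zero_le, abs]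
  · rw [abs, h]
    exact Valuation.map_add_of_distinct_val _ (C.abs_mPart_ne_abs_jPart h0)

lemma abs_mPart_le (d : D) : C.abs (C.mPart d) ≤ C.abs d := by
  rw [C.abs_eq_max d]
  exact le_max_left _ _

lemma abs_jPart_le (d : D) : C.abs (C.jPart d) ≤ C.abs d := by
  rw [C.abs_eq_max d]
  exact le_max_right _ _

lemma abs_add_le (d d' : D) : C.abs (d + d') ≤ max (C.abs d) (C.abs d') := by
  have hmax : ∀ a b c e : F, max (valuation F (a + b)) (valuation F (c + e)) ≤
      max (max (valuation F a) (valuation F c)) (max (valuation F b) (valuation F e)) := by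
    intro a b c e
    refine max_le ((Valuation.map_add _ _ _).trans ?_) ((Valuation.map_add _ _ _).trans ?_)
    · exact max_le_max (le_max_left _ _) (le_max_left _ _)
    · exact max_le_max (le_max_right _ _) (le_max_right _ _)
  have hmono : Monotone fun x : ValueGroupWithZero F => x ^ 2 := fun x y h =>
    pow_le_pow_left₀ zero_le h 2
  rw [C.abs_eq_max (d + d')]
  refine max_le ?_ ?_
  · refine le_trans ?_ (max_le_max (C.abs_mPart_le d) (C.abs_mPart_le d'))
    simp only [abs_mPart, map_add, QuaternionAlgebra.re_add, QuaternionAlgebra.imI_add]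
    rw [← hmono.map_max]
    exact hmono (hmax _ _ _ _)
  · refine le_trans ?_ (max_le_max (C.abs_jPart_le d) (C.abs_jPart_le d'))
    simp only [abs_jPart, map_add, QuaternionAlgebra.imJ_add, QuaternionAlgebra.imK_add]
    have hp : Monotone fun x : ValueGroupWithZero F => X.p * x := fun x y h =>
      mul_le_mul' le_rfl h
    rw [← hp.map_max, ← hmono.map_max]
    exact hp (hmono (hmax _ _ _ _))

/-- The absolute value as a valuation on the division ring `D`. -/
def val : Valuation D (ValueGroupWithZero F) where
  __ := C.absHom
  map_add_le_max' := C.abs_add_le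

lemma abs_sub_le (d d' : D) : C.abs (d - d') ≤ max (C.abs d) (C.abs d') := C.val.map_sub d d'

lemma abs_ϖ : C.abs X.ϖ = X.p := by
  rw [abs, nrd, C.e_ϖ]
  simp

lemma abs_ζ : C.abs X.ζ = 1 := by
  rw [abs, nrd, C.e_ζ]
  simp [C.norm_ζ, C.val_ω]

lemma abs_ϖM : C.abs X.ϖM = X.p ^ 2 := C.abs_algebraMap _

lemma max_s_t : max (valuation F C.s) (valuation F C.t) = 1 := by
  have h := C.val_norm C.s C.t
  rw [C.norm_ζ, C.val_ω] at h
  exact (pow_eq_one_iff_of_nonneg zero_le two_ne_zero).1 h.symm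

lemma val_s_le : valuation F C.s ≤ 1 := C.max_s_t ▸ le_max_left _ _

/-- Both sides of `s² - ω·1² = ωt²` have value `1`. That `t` is a unit keeps the direction `ζϖ = sϖ
+ tηϖ` of `L` away from the direction `ϖ` of `K`, even modulo `𝒫_F`. -/
lemma val_t : valuation F C.t = 1 := by
  have h := C.val_norm C.s 1
  have e : C.s ^ 2 - C.ω * 1 ^ 2 = C.ω * C.t ^ 2 := by linear_combination C.norm_ζ
  rw [e, map_mul, C.val_ω, one_mul, map_pow, map_one, max_eq_right C.val_s_le] at h
  exact (pow_eq_one_iff_of_nonneg zero_le two_ne_zero).1 (by simpa using h)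

lemma t_ne_zero : C.t ≠ 0 := by
  intro h
  have := C.val_t
  simp [h] at this

lemma mem_M_iff (d : D) : d ∈ X.M ↔ (C.e d).imJ = 0 ∧ (C.e d).imK = 0 := by
  constructor
  · intro h
    induction h using Algebra.adjoin_induction with
    | mem x hx => rw [Set.mem_singleton_iff.1 hx, C.e_ζ]; exact ⟨rfl, rfl⟩
    | algebraMap r => simp
    | add x y _ _ hx hy => simp [hx, hy]
    | mul x y _ _ hx hy => simp [hx, hy]
  · rintro ⟨h2, h3⟩
    obtain ⟨a, ha⟩ : ∃ a : F, (C.e d).imI = a * C.t :=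
      ⟨(C.e d).imI / C.t, (div_mul_cancel₀ _ C.t_ne_zero).symm⟩
    have e : d = algebraMap F D ((C.e d).re - a * C.s) + algebraMap F D a * X.ζ := by
      apply C.ext <;> simp [C.e_ζ, h2, h3, ha]
    rw [e]
    exact add_mem (X.M.algebraMap_mem _)
      (mul_mem (X.M.algebraMap_mem _) (Algebra.subset_adjoin rfl))

lemma mem_K_iff (d : D) : d ∈ X.K ↔ (C.e d).imI = 0 ∧ (C.e d).imK = 0 := by
  constructor
  · intro h
    induction h using Algebra.adjoin_induction with
    | mem x hx => rw [Set.mem_singleton_iff.1 hx, C.e_ϖ]; exact ⟨rfl, rfl⟩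
    | algebraMap r => simp
    | add x y _ _ hx hy => simp [hx, hy]
    | mul x y _ _ hx hy => simp [hx, hy]
  · rintro ⟨h2, h3⟩
    have e : d = algebraMap F D (C.e d).re + algebraMap F D (C.e d).imJ * X.ϖ := by
      apply C.ext <;> simp [C.e_ϖ, h2, h3]
    rw [e]
    exact add_mem (X.K.algebraMap_mem _) (mul_mem (X.K.algebraMap_mem _) X.ϖ_mem_K)

lemma imI_eq_zero_of_mem_L {d : D} (h : d ∈ X.L) :
    (C.e d).imI = 0 ∧ C.t * (C.e d).imJ = C.s * (C.e d).imK := by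
  induction h using Algebra.adjoin_induction with
  | mem x hx =>
    rw [Set.mem_singleton_iff.1 hx, map_mul, C.e_ζ, C.e_ϖ]
    simp [mul_comm]
  | algebraMap r => simp
  | add x y _ _ hx hy =>
    simp only [map_add, QuaternionAlgebra.imI_add, QuaternionAlgebra.imJ_add,
      QuaternionAlgebra.imK_add, hx.1, hy.1]
    exact ⟨by ring, by linear_combination hx.2 + hy.2⟩
  | mul x y _ _ hx hy =>
    simp only [map_mul, QuaternionAlgebra.imI_mul, QuaternionAlgebra.imJ_mul,
      QuaternionAlgebra.imK_mul, hx.1, hy.1]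
    constructor
    · apply mul_left_cancel₀ C.t_ne_zero
      linear_combination (-(X.ϖF : F)) * ((C.e y).imK * hx.2 - (C.e x).imK * hy.2)
    · linear_combination (C.e x).re * hy.2 + (C.e y).re * hx.2

lemma mPart_mem_M (d : D) : C.mPart d ∈ X.M := by
  rw [C.mem_M_iff]
  simp

lemma mPart_mul {y : D} (h : y ∈ X.M) (d : D) : C.mPart (y * d) = y * C.mPart d := by
  rw [C.mem_M_iff] at h
  apply C.ext <;> simp [h]

lemma jPart_mul {y : D} (h : y ∈ X.M) (d : D) : C.jPart (y * d) = y * C.jPart d := by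
  rw [C.mem_M_iff] at h
  apply C.ext <;> simp [h]

lemma jPart_sub_one (d : D) : C.jPart (d - 1) = C.jPart d := by
  apply C.ext <;> simp

lemma mPart_sub_one (d : D) : C.mPart (d - 1) = C.mPart d - 1 := by
  apply C.ext <;> simp

lemma abs_mPart_eq_of_lt {d : D} (h : C.abs (C.jPart d) < C.abs d) :
    C.abs (C.mPart d) = C.abs d := by
  rcases max_choice (C.abs (C.mPart d)) (C.abs (C.jPart d)) with h1 | h1
  · rw [C.abs_eq_max d, h1]
  · rw [C.abs_eq_max d, h1] at h
    exact absurd h (lt_irrefl _)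

/-- An element of even absolute value is dominated by its component in `M`. -/
lemma abs_mPart_eq_of_abs_eq_sq {d : D} {x : F} (hx : x ≠ 0) (h : C.abs d = valuation F x ^ 2) :
    C.abs (C.mPart d) = C.abs d := by
  apply C.abs_mPart_eq_of_lt
  refine lt_of_le_of_ne (C.abs_jPart_le d) ?_
  rw [h]
  obtain ⟨y, hy⟩ := C.exists_abs_jPart d
  rw [hy]
  exact (sq_ne_mul_sq X.irreducible_ϖF hx).symm

lemma abs_mPart_eq_one {d : D} (h : C.abs d = 1) : C.abs (C.mPart d) = 1 :=
  (C.abs_mPart_eq_of_abs_eq_sq (x := 1) one_ne_zero (by simpa using h)).trans h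

end Coords

end Frame

/-! ### Unit groups, `H` and `H'` in terms of the absolute value. -/

namespace Frame

variable {F D : Type*} [Field F] [ValuativeRel F] [TopologicalSpace F]
  [IsNonarchimedeanLocalField F] [DivisionRing D] [Algebra F D] {X : Frame F D}

lemma mem_center_iff (g : Dˣ) : g ∈ center F D ↔ ∃ a : F, (g : D) = algebraMap F D a := by
  constructor
  · rintro ⟨a, rfl⟩
    exact ⟨a, rfl⟩
  · rintro ⟨a, ha⟩
    have ha0 : a ≠ 0 := by
      rintro rfl
      simp at ha
    exact ⟨Units.mk0 a ha0, Units.ext ha.symm⟩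

lemma center_commute {g : Dˣ} (hg : g ∈ center F D) (h : Dˣ) : g * h = h * g := by
  obtain ⟨a, ha⟩ := (mem_center_iff g).1 hg
  apply Units.ext
  rw [Units.val_mul, Units.val_mul, ha, Algebra.commutes]

instance center_normal : (center F D).Normal :=
  ⟨fun n hn g => by rwa [← center_commute hn g, mul_inv_cancel_right]⟩

lemma inv_mem_subalgebra [FiniteDimensional F D] (E : Subalgebra F D) {x : D} (hx : x ∈ E) :
    x⁻¹ ∈ E :=
  (Algebra.IsIntegral.isIntegral (R := F) x).inv_mem hx

lemma mem_torus_iff [FiniteDimensional F D] (E : Subalgebra F D) (g : Dˣ) :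
    g ∈ torus E ↔ (g : D) ∈ E := by
  constructor
  · rintro ⟨u, rfl⟩
    exact (u : ↥E).2
  · intro h
    exact ⟨unitOfMem E g h g.ne_zero, Units.ext rfl⟩

namespace Coords

variable (C : X.Coords)

lemma dAbs_le_iff (x t : D) (n : ℤ) :
    dAbs F x ≤ dAbs F t ^ n ↔ C.abs x ≤ C.abs t ^ n := by
  rw [C.dAbs_eq, C.dAbs_eq, ← zpow_natCast (C.abs t) 2, zpow_comm, zpow_natCast]
  exact pow_le_pow_iff_left₀ zero_le zero_le two_ne_zero

lemma dAbs_eq_one_iff (x : D) : dAbs F x = 1 ↔ C.abs x = 1 := by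
  rw [C.dAbs_eq]
  exact pow_eq_one_iff_of_nonneg zero_le two_ne_zero

/-- The generating set is already a group, by `xy - 1 = x(y - 1) + (x - 1)` and `x⁻¹ - 1 = -x⁻¹(x -
1)`. -/
lemma mem_unitGroup_iff [FiniteDimensional F D] (E : Subalgebra F D) (t : D) (n : ℕ) (u : Dˣ) :
    u ∈ unitGroup E t n ↔ (u : D) ∈ E ∧ C.abs (u : D) = 1 ∧ C.abs ((u : D) - 1) ≤ C.abs t ^ n := by
  have hiff : ∀ u : Dˣ,
      ((u : D) ∈ E ∧ dAbs F (u : D) = 1 ∧ (u : D) - 1 ∈ primePow E t n) ↔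
      ((u : D) ∈ E ∧ C.abs (u : D) = 1 ∧ C.abs ((u : D) - 1) ≤ C.abs t ^ n) := by
    intro u
    rw [C.dAbs_eq_one_iff, primePow, Set.mem_ofPred_eq, C.dAbs_le_iff, zpow_natCast]
    exact ⟨fun h => ⟨h.1, h.2.1, h.2.2.2⟩,
      fun h => ⟨h.1, h.2.1, sub_mem h.1 (one_mem _), h.2.2⟩⟩
  constructor
  · intro h
    induction h using Subgroup.closure_induction with
    | mem x hx => exact (hiff x).1 hx
    | one => simp
    | mul x y _ _ hx hy =>
      refine ⟨mul_mem hx.1 hy.1, by rw [Units.val_mul, C.abs_mul, hx.2.1, hy.2.1, one_mul], ?_⟩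
      have e : ((x * y : Dˣ) : D) - 1 = x * (y - 1) + (x - 1) := by
        rw [Units.val_mul]; noncomm_ring
      rw [e]
      refine (C.abs_add_le _ _).trans (max_le ?_ hx.2.2)
      rw [C.abs_mul, hx.2.1, one_mul]
      exact hy.2.2
    | inv x _ hx =>
      have h1 : C.abs ((x⁻¹ : Dˣ) : D) = 1 := by
        rw [Units.val_inv_eq_inv_val, C.abs_inv, hx.2.1, inv_one]
      refine ⟨?_, h1, ?_⟩
      · rw [Units.val_inv_eq_inv_val]
        exact inv_mem_subalgebra E hx.1
      · have e : ((x⁻¹ : Dˣ) : D) - 1 = -(((x⁻¹ : Dˣ) : D) * (x - 1)) := by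
          rw [mul_sub, Units.inv_mul]; noncomm_ring
        rw [e, C.abs_neg, C.abs_mul, h1, one_mul]
        exact hx.2.2
  · intro h
    exact Subgroup.subset_closure ((hiff u).2 h)

section Groups

variable [FiniteDimensional F D]

lemma mem_UD_iff (n : ℕ) (u : Dˣ) :
    u ∈ X.UD n ↔ C.abs (u : D) = 1 ∧ C.abs ((u : D) - 1) ≤ X.p ^ n := by
  rw [UD, C.mem_unitGroup_iff, C.abs_ϖ]
  exact ⟨fun h => h.2, fun h => ⟨trivial, h⟩⟩

lemma mem_UM_iff (n : ℕ) (u : Dˣ) : u ∈ X.UM n ↔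
    (u : D) ∈ X.M ∧ C.abs (u : D) = 1 ∧ C.abs ((u : D) - 1) ≤ X.p ^ (2 * n) := by
  rw [UM, C.mem_unitGroup_iff, C.abs_ϖM, pow_mul]

lemma mem_UK_iff (n : ℕ) (u : Dˣ) : u ∈ X.UK n ↔
    (u : D) ∈ X.K ∧ C.abs (u : D) = 1 ∧ C.abs ((u : D) - 1) ≤ X.p ^ n := by
  rw [UK, C.mem_unitGroup_iff, C.abs_ϖ]

lemma mem_UL_iff (n : ℕ) (u : Dˣ) : u ∈ X.UL n ↔
    (u : D) ∈ X.L ∧ C.abs (u : D) = 1 ∧ C.abs ((u : D) - 1) ≤ X.p ^ n := by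
  rw [UL, C.mem_unitGroup_iff, C.abs_mul, C.abs_ϖ, C.abs_ζ, one_mul]

/-- For `n ≥ 1`, the condition `|u| = 1` is implied by `|u - 1| ≤ p ^ n`. -/
lemma abs_eq_one_of_sub {u : D} (h : C.abs (u - 1) < 1) : C.abs u = 1 := by
  have h2 : C.val (u - 1) < C.val 1 := h.trans_eq C.abs_one.symm
  have h1 := C.val.map_add_eq_of_lt_left h2
  rw [add_sub_cancel, map_one] at h1
  exact h1

lemma conj_mem_UD {n : ℕ} {u : Dˣ} (C : X.Coords) (hu : u ∈ X.UD n) (g : Dˣ) :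
    g * u * g⁻¹ ∈ X.UD n := by
  rw [C.mem_UD_iff] at hu ⊢
  have hg : C.abs (g : D) ≠ 0 := C.abs_unit_ne_zero g
  have e : ((g * u * g⁻¹ : Dˣ) : D) - 1 = g * ((u : D) - 1) * ((g⁻¹ : Dˣ) : D) := by
    rw [mul_sub, sub_mul, mul_one, Units.mul_inv]
    rfl
  have hc : ∀ d : D, C.abs (g * d * ((g⁻¹ : Dˣ) : D)) = C.abs d := by
    intro d
    rw [C.abs_mul, C.abs_mul, Units.val_inv_eq_inv_val, C.abs_inv, mul_comm, ← mul_assoc,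
      inv_mul_cancel₀ hg, one_mul]
  refine ⟨?_, ?_⟩
  · rw [Units.val_mul, Units.val_mul, hc, hu.1]
  · rw [e, hc]
    exact hu.2

lemma UD_normal (C : X.Coords) (n : ℕ) : (X.UD n).Normal := ⟨fun _ hu g => C.conj_mem_UD hu g⟩

/-- `d` is congruent to its component in `M` modulo `𝒫_D ^ n`, up to a factor in `M^×`. -/
def Near (n : ℕ) (d : D) : Prop := C.abs (C.jPart d) ≤ X.p ^ n * C.abs (C.mPart d)

lemma mPart_ne_zero_of_near {n : ℕ} {d : D} (h : C.Near n d) (hd : d ≠ 0) : C.mPart d ≠ 0 := by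
  intro h0
  rw [Near, h0, C.abs_zero, mul_zero, le_zero_iff, C.abs_eq_zero] at h
  exact hd (by rw [← C.mPart_add_jPart d, h0, h, add_zero])

lemma abs_mPart_eq_of_near {n : ℕ} {d : D} (h : C.Near n d) : C.abs (C.mPart d) = C.abs d := by
  rw [C.abs_eq_max d, max_eq_left]
  exact h.trans (mul_le_of_le_one_left zero_le (pow_le_one' X.p_lt_one.le n))

lemma near_mul_iff {n : ℕ} {y d : D} (hy : y ∈ X.M) (hy0 : y ≠ 0) :
    C.Near n (y * d) ↔ C.Near n d := by
  rw [Near, Near, C.mPart_mul hy, C.jPart_mul hy, C.abs_mul, C.abs_mul, mul_left_comm]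
  exact mul_le_mul_iff_right₀ (C.abs_pos hy0)

lemma near_of_mem_UD {n : ℕ} {u : Dˣ} (hu : u ∈ X.UD n) : C.Near n (u : D) := by
  rw [C.mem_UD_iff] at hu
  rw [Near, C.abs_mPart_eq_one hu.1, mul_one, ← C.jPart_sub_one]
  exact (C.abs_jPart_le _).trans hu.2

lemma mem_UD_of_mPart_eq_one {n : ℕ} {u : Dˣ} (h1 : C.mPart (u : D) = 1) (h : C.Near n (u : D)) :
    u ∈ X.UD n := by
  have h0 := C.abs_mPart_eq_of_near h
  rw [Near, h1, C.abs_one, mul_one, ← C.jPart_sub_one] at h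
  rw [C.mem_UD_iff, ← h0, h1, C.abs_one, C.abs_eq_max, C.mPart_sub_one, h1, sub_self, C.abs_zero,
    max_eq_right zero_le]
  exact ⟨rfl, h⟩

/-- `Near` is unchanged by left multiplication by `M^×`. Dividing by the `M`-component, which is
nonzero, reduces to elements with `M`-component `1`, for which `Near` places them in `1 + 𝒫_D^m`. -/
lemma mem_H_iff (m : ℕ) (h : Dˣ) : h ∈ X.H m ↔ C.Near m (h : D) := by
  have := C.UD_normal m
  rw [H, Subgroup.mem_sup_of_normal_right]
  constructor
  · rintro ⟨y, hy, u, hu, rfl⟩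
    rw [mem_torus_iff] at hy
    rw [Units.val_mul, C.near_mul_iff hy y.ne_zero]
    exact C.near_of_mem_UD hu
  · intro hn
    have h0 := C.mPart_ne_zero_of_near hn h.ne_zero
    have hy : C.mPart (h : D) ∈ X.M := C.mPart_mem_M _
    refine ⟨Units.mk0 _ h0, (mem_torus_iff _ _).2 hy, (Units.mk0 _ h0)⁻¹ * h, ?_, by simp⟩
    have e : (((Units.mk0 _ h0)⁻¹ * h : Dˣ) : D) = (C.mPart (h : D))⁻¹ * h := by simp
    have hyi : (C.mPart (h : D))⁻¹ ∈ X.M := inv_mem_subalgebra _ hy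
    apply C.mem_UD_of_mPart_eq_one
    · rw [e, C.mPart_mul hyi, inv_mul_cancel₀ h0]
    · rwa [e, C.near_mul_iff hyi (inv_ne_zero h0)]

/-- The same normalisation as for `H`: the `M`-component of an element of `K` lies in `F`, so
dividing by it does not leave `K`. -/
lemma mem_center_sup_UK_iff (n : ℕ) (g : Dˣ) :
    g ∈ center F D ⊔ X.UK n ↔ (g : D) ∈ X.K ∧ C.Near n (g : D) := by
  rw [Subgroup.mem_sup_of_normal_left]
  constructor
  · rintro ⟨y, hy, u, hu, rfl⟩
    obtain ⟨a, ha⟩ := (mem_center_iff y).1 hy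
    rw [C.mem_UK_iff] at hu
    refine ⟨mul_mem (ha ▸ X.K.algebraMap_mem a) hu.1, ?_⟩
    rw [Units.val_mul, C.near_mul_iff (ha ▸ X.M.algebraMap_mem a) y.ne_zero]
    exact C.near_of_mem_UD ((C.mem_UD_iff n u).2 hu.2)
  · rintro ⟨hK, hn⟩
    have h0 := C.mPart_ne_zero_of_near hn g.ne_zero
    have ha : C.mPart (g : D) = algebraMap F D (C.e (g : D)).re := by
      have := (C.mem_K_iff _).1 hK
      apply C.ext <;> simp [this]
    refine ⟨Units.mk0 _ h0, (mem_center_iff _).2 ⟨_, ha⟩, (Units.mk0 _ h0)⁻¹ * g, ?_, by simp⟩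
    have e : (((Units.mk0 _ h0)⁻¹ * g : Dˣ) : D) = (C.mPart (g : D))⁻¹ * g := by simp
    have hyi : (C.mPart (g : D))⁻¹ ∈ X.M := inv_mem_subalgebra _ (C.mPart_mem_M _)
    rw [C.mem_UK_iff]
    refine ⟨?_, (C.mem_UD_iff n _).1 (C.mem_UD_of_mPart_eq_one ?_ ?_)⟩
    · rw [e, ha]
      exact mul_mem (inv_mem_subalgebra _ (X.K.algebraMap_mem _)) hK
    · rw [e, C.mPart_mul hyi, inv_mul_cancel₀ h0]
    · rwa [e, C.near_mul_iff hyi (inv_ne_zero h0)]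

lemma H_inf_torus (C : X.Coords) (m : ℕ) : X.H m ⊓ torus X.K = center F D ⊔ X.UK m := by
  ext g
  rw [Subgroup.mem_inf, C.mem_center_sup_UK_iff, C.mem_H_iff, mem_torus_iff, and_comm]

lemma UK_le_UD (C : X.Coords) (n : ℕ) : X.UK n ≤ X.UD n := fun u hu =>
  (C.mem_UD_iff n u).2 ((C.mem_UK_iff n u).1 hu).2

lemma H'_le_H {m : ℕ} : X.H' m ≤ X.H m := by
  refine sup_le_sup (sup_le ?_ ?_) le_rfl
  · rintro g hg
    obtain ⟨a, ha⟩ := (mem_center_iff g).1 hg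
    exact (mem_torus_iff _ _).2 (ha ▸ X.M.algebraMap_mem a)
  · refine (Subgroup.closure_le _).2 ?_
    rintro u ⟨hu, -⟩
    exact (mem_torus_iff _ _).2 hu

lemma center_sup_UK_le_H' (C : X.Coords) (m : ℕ) : center F D ⊔ X.UK m ≤ X.H' m :=
  sup_le (le_sup_left.trans le_sup_left) ((C.UK_le_UD m).trans le_sup_right)

lemma center_sup_UK_le_H₁' (C : X.Coords) (m : ℕ) : center F D ⊔ X.UK (m + 1) ≤ X.H₁' m :=
  sup_le (le_sup_left.trans (le_sup_left.trans le_sup_left))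
    ((C.UK_le_UD (m + 1)).trans le_sup_right)

/-! ### The group `H₁'` and its intersection with `K^×`. -/

lemma jPart_mul_eq (d d' : D) :
    C.jPart (d * d') = C.mPart d * C.jPart d' + C.jPart d * C.mPart d' := by
  apply C.ext <;> simp <;> ring

lemma abs_jPart_add_le (d d' : D) :
    C.abs (C.jPart (d + d')) ≤ max (C.abs (C.jPart d)) (C.abs (C.jPart d')) := by
  have e : C.jPart (d + d') = C.jPart d + C.jPart d' := by apply C.ext <;> simp
  rw [e]
  exact C.abs_add_le _ _

/-- The component of `d` transversal to `L` in `Mϖ`. -/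
def lPart (d : D) : F := C.t * (C.e d).imJ - C.s * (C.e d).imK

lemma lPart_add (d d' : D) : C.lPart (d + d') = C.lPart d + C.lPart d' := by
  simp [lPart]
  ring

lemma p_mul_lPart_le (d : D) : X.p * valuation F (C.lPart d) ^ 2 ≤ C.abs (C.jPart d) := by
  rw [abs_jPart]
  refine mul_le_mul' le_rfl (pow_le_pow_left₀ zero_le ?_ 2)
  refine (Valuation.map_sub _ _ _).trans (max_le_max ?_ ?_)
  · rw [map_mul, C.val_t, one_mul]
  · rw [map_mul]
    exact mul_le_of_le_one_left zero_le C.val_s_le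

/-- The non-unital ring `N` such that `H₁'` is contained in `F^× (1 + N)`. -/
def SmallL (m : ℕ) (n : D) : Prop :=
  C.abs n < 1 ∧ C.abs (C.jPart n) ≤ X.p ^ m ∧ X.p * valuation F (C.lPart n) ^ 2 ≤ X.p ^ (m + 1)

variable {C} in
lemma SmallL.add {m : ℕ} {n n' : D} (h : C.SmallL m n) (h' : C.SmallL m n') :
    C.SmallL m (n + n') := by
  refine ⟨(C.abs_add_le _ _).trans_lt (max_lt h.1 h'.1),
    (C.abs_jPart_add_le _ _).trans (max_le h.2.1 h'.2.1), ?_⟩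
  rw [lPart_add]
  have h1 := Valuation.map_add (valuation F) (C.lPart n) (C.lPart n')
  rcases le_max_iff.1 h1 with h1 | h1
  · exact (mul_le_mul' le_rfl (pow_le_pow_left₀ zero_le h1 2)).trans h.2.2
  · exact (mul_le_mul' le_rfl (pow_le_pow_left₀ zero_le h1 2)).trans h'.2.2

lemma smallL_of_abs_le {m : ℕ} {n : D} (h : C.abs n < 1) (h' : C.abs (C.jPart n) ≤ X.p ^ (m + 1)) :
    C.SmallL m n :=
  ⟨h, h'.trans (pow_le_pow_right_of_le_one' X.p_lt_one.le (Nat.le_succ m)),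
    (C.p_mul_lPart_le n).trans h'⟩

lemma le_p_of_lt_one_mPart {d : D} (h : C.abs d < 1) : C.abs (C.mPart d) ≤ X.p := by
  obtain ⟨x, hx, -⟩ := C.exists_abs_mPart d
  have h1 := (C.abs_mPart_le d).trans_lt h
  rw [hx] at h1 ⊢
  have h2 : valuation F x < 1 := (pow_lt_one_iff_of_nonneg zero_le two_ne_zero).1 h1
  rw [valuation_lt_one_iff X.irreducible_ϖF] at h2
  calc valuation F x ^ 2 ≤ X.p ^ 2 := pow_le_pow_left₀ zero_le h2 2
    _ ≤ X.p ^ 1 := pow_le_pow_right_of_le_one' X.p_lt_one.le (by norm_num)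
    _ = X.p := pow_one _

-- Each term of the `Mϖ`-component of `nn'` pairs an `M`-component of value at most `p` with an
-- `Mϖ`-component of value at most `p^m`. It is thus at most `p^(m+1)`, and the condition on `lPart`
-- is automatic.
variable {C} in
lemma SmallL.mul {m : ℕ} {n n' : D} (h : C.SmallL m n) (h' : C.SmallL m n') :
    C.SmallL m (n * n') := by
  apply C.smallL_of_abs_le
  · rw [C.abs_mul]
    exact mul_lt_one_of_lt_of_le h.1 h'.1.le
  · rw [C.jPart_mul_eq]
    refine (C.abs_add_le _ _).trans (max_le ?_ ?_)
    · rw [C.abs_mul, pow_succ']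
      exact mul_le_mul' (C.le_p_of_lt_one_mPart h.1) h'.2.1
    · rw [C.abs_mul, pow_succ]
      exact mul_le_mul' h.2.1 (C.le_p_of_lt_one_mPart h'.1)

-- Needed for inverses: `(1 + n)⁻¹` is `1 + conj n` up to the scalar `nrd (1 + n)`.
variable {C} in
lemma SmallL.conj {m : ℕ} {n : D} (h : C.SmallL m n) : C.SmallL m (C.conj n) := by
  have e1 : C.abs (C.conj n) = C.abs n := by simp [Coords.abs, nrd, Coords.conj]
  have e2 : C.abs (C.jPart (C.conj n)) = C.abs (C.jPart n) := by
    simp [abs_jPart, Coords.conj]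
  have e3 : C.lPart (C.conj n) = -C.lPart n := by
    simp [lPart, Coords.conj]
    ring
  refine ⟨e1 ▸ h.1, e2 ▸ h.2.1, ?_⟩
  rw [e3, Valuation.map_neg]
  exact h.2.2

lemma smallL_zero (m : ℕ) : C.SmallL m 0 := by
  have : C.jPart (0 : D) = 0 := by apply C.ext <;> simp
  refine C.smallL_of_abs_le ?_ ?_ <;> simp [this]

/-- The set `F^×(1 + N)` is a group containing the four subgroups that generate `H₁'`. For `1 +
𝒫_L^m` this holds because `lPart` vanishes on `L`. -/
lemma exists_of_mem_H₁' {m : ℕ} (hm : Odd m) {h : Dˣ} (hh : h ∈ X.H₁' m) :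
    ∃ (a : F) (n : D), a ≠ 0 ∧ C.SmallL m n ∧ (h : D) = algebraMap F D a * (1 + n) := by
  have hp1 : X.p ^ m < 1 := pow_lt_one' X.p_lt_one (by rcases hm with ⟨k, rfl⟩; omega)
  have hsub : ∀ u : Dˣ, C.SmallL m ((u : D) - 1) →
      ∃ (a : F) (n : D), a ≠ 0 ∧ C.SmallL m n ∧ (u : D) = algebraMap F D a * (1 + n) :=
    fun u hu => ⟨1, _, one_ne_zero, hu, by simp⟩
  let S : Subgroup Dˣ :=
    { carrier := {u | ∃ (a : F) (n : D), a ≠ 0 ∧ C.SmallL m n ∧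
        (u : D) = algebraMap F D a * (1 + n)}
      one_mem' := ⟨1, 0, one_ne_zero, C.smallL_zero m, by simp⟩
      mul_mem' := by
        rintro u u' ⟨a, n, ha, hn, e⟩ ⟨a', n', ha', hn', e'⟩
        refine ⟨a * a', n + n' + n * n', mul_ne_zero ha ha', (hn.add hn').add (hn.mul hn'), ?_⟩
        rw [Units.val_mul, e, e', map_mul, mul_assoc, ← mul_assoc (1 + n), ← Algebra.commutes a',
          mul_assoc, mul_assoc]
        noncomm_ring
      inv_mem' := by
        rintro u ⟨a, n, ha, hn, e⟩
        have h1 : C.abs (1 + n) = 1 := C.abs_eq_one_of_sub (by simpa using hn.1)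
        have h0 : C.nrd (1 + n) ≠ 0 := by
          intro h0
          rw [Coords.abs, h0, map_zero] at h1
          exact zero_ne_one h1
        refine ⟨a⁻¹ * (C.nrd (1 + n))⁻¹, C.conj n, mul_ne_zero (inv_ne_zero ha) (inv_ne_zero h0),
          hn.conj, ?_⟩
        have e2 : C.conj (1 + n) = 1 + C.conj n := by
          simp [Coords.conj]
        rw [← e2]
        apply mul_left_cancel₀ u.ne_zero
        rw [Units.mul_inv, e, ← mul_assoc, mul_assoc (algebraMap F D a), ← Algebra.commutes (_ * _),
          ← mul_assoc, mul_assoc _ (1 + n), C.mul_conj, ← map_mul, ← map_mul, eq_comm]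
        convert map_one (algebraMap F D) using 2
        field_simp }
  have hle : X.H₁' m ≤ S := by
    refine sup_le (sup_le (sup_le ?_ ?_) ?_) ?_
    · intro g hg
      obtain ⟨a, ha⟩ := (mem_center_iff g).1 hg
      refine ⟨a, 0, ?_, C.smallL_zero m, by simpa using ha⟩
      rintro rfl
      simp at ha
    · intro u hu
      rw [C.mem_UM_iff] at hu
      refine hsub u (C.smallL_of_abs_le ?_ ?_)
      · exact hu.2.2.trans_lt (pow_lt_one' X.p_lt_one (by norm_num))
      · rw [C.jPart_sub_one]
        have : C.jPart (u : D) = 0 := by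
          have := (C.mem_M_iff _).1 hu.1
          apply C.ext <;> simp [this]
        simp [this]
    · intro u hu
      rw [C.mem_UL_iff] at hu
      refine hsub u ⟨hu.2.2.trans_lt hp1, (C.abs_jPart_le _).trans hu.2.2, ?_⟩
      have := (C.imI_eq_zero_of_mem_L hu.1).2
      have : C.lPart ((u : D) - 1) = 0 := by
        simp [lPart, this]
      simp [this]
    · intro u hu
      rw [C.mem_UD_iff] at hu
      exact hsub u (C.smallL_of_abs_le (hu.2.trans_lt (pow_lt_one' X.p_lt_one (by omega)))
        ((C.abs_jPart_le _).trans hu.2))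
  exact hle hh

/-- On `K` the `ηϖ`-coordinate is zero, so `lPart` is the unit `t` times the `ϖ`-coordinate. The
bound on `lPart` therefore improves `p^m` to `p^(m+1)` for the whole `Mϖ`-component. -/
lemma H₁'_inf_torus (C : X.Coords) {m : ℕ} (hm : Odd m) :
    X.H₁' m ⊓ torus X.K = center F D ⊔ X.UK (m + 1) := by
  apply le_antisymm
  · rintro g ⟨hg, hK⟩
    have hK := (mem_torus_iff _ _).1 hK
    rw [C.mem_center_sup_UK_iff]
    refine ⟨hK, ?_⟩
    obtain ⟨a, n, ha, hn, e⟩ := C.exists_of_mem_H₁' hm hg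
    have ha' : algebraMap F D a ≠ 0 := by simpa using ha
    rw [e, C.near_mul_iff (X.M.algebraMap_mem a) ha', Near]
    have h1 : C.abs (1 + n) = 1 := C.abs_eq_one_of_sub (by simpa using hn.1)
    rw [C.abs_mPart_eq_one h1, mul_one]
    have hk : (C.e n).imK = 0 := by
      have h2 := ((C.mem_K_iff _).1 hK).2
      rw [e] at h2
      simpa [ha] using h2
    have h3 := hn.2.2
    rw [lPart, hk, mul_zero, sub_zero, map_mul, C.val_t, one_mul] at h3
    rw [abs_jPart]
    simpa [hk] using h3
  · rw [le_inf_iff]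
    refine ⟨C.center_sup_UK_le_H₁' m, fun g hg => ?_⟩
    rw [mem_torus_iff]
    exact ((C.mem_center_sup_UK_iff _ _).1 hg).1

end Groups

end Coords

end Frame

/-! ### Equivariant vectors in induced representations. -/

section Induced

variable {S G A W : Type*} [Group S] [Group G] [Group A] [AddCommGroup W] [Module ℂ W]
  {φ : S →* G} {j : G →* A} (hinj : Function.Injective (j.comp φ)) (ρ : Representation ℂ S W)

lemma supportedOn_apply (g₀ : A) (w : W) {x : G} {s : S} (h : j x = j (φ s) * g₀) :
    (supportedOn φ j hinj ρ g₀ w).1 x = ρ s w := by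
  have hex : ∃ s : S, j x = j (φ s) * g₀ := ⟨s, h⟩
  have key : hex.choose = s := by
    apply hinj
    exact mul_right_cancel (hex.choose_spec.symm.trans h)
  simp only [supportedOn]
  rw [dif_pos hex, key]

lemma supportedOn_apply_of_not (g₀ : A) (w : W) {x : G} (h : ¬ ∃ s : S, j x = j (φ s) * g₀) :
    (supportedOn φ j hinj ρ g₀ w).1 x = 0 := by
  simp only [supportedOn]
  rw [dif_neg h]

/-- Collects the sum over `a` in `v_χ` into a single vector of `W`. -/
lemma supportedOn_smul_sum {ι : Type*} (I : Finset ι) (g₀ : A) (a : ι → ℂ) (w : ι → W) :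
    supportedOn φ j hinj ρ g₀ (∑ i ∈ I, a i • w i) =
      ∑ i ∈ I, a i • supportedOn φ j hinj ρ g₀ (w i) := by
  apply Subtype.ext
  funext x
  rw [AddSubmonoidClass.coe_finsetSum, Finset.sum_apply]
  simp only [Submodule.coe_smul, Pi.smul_apply]
  by_cases h : ∃ s : S, j x = j (φ s) * g₀
  · obtain ⟨s, hs⟩ := h
    rw [supportedOn_apply hinj ρ _ _ hs, map_sum]
    refine Finset.sum_congr rfl fun i _ => ?_
    rw [supportedOn_apply hinj ρ _ _ hs, map_smul]
  · rw [supportedOn_apply_of_not hinj ρ _ _ h, eq_comm]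
    refine Finset.sum_eq_zero fun i _ => ?_
    rw [supportedOn_apply_of_not hinj ρ _ _ h, smul_zero]

variable {T ι : Type*} [Group T] (τ : T →* A) (χ : T →* ℂˣ) (I : Finset ι) (g : ι → T) (w : W)

/-- The vector of the representation induced from `S` to `G` supported on `S T` which is
`χ`-equivariant under `T`. -/
def equivariantVector : Representation.coindV φ ρ :=
  ∑ i ∈ I, (χ (g i) : ℂ) • supportedOn φ j hinj ρ (τ (g i)) w

lemma equivariantVector_eq : equivariantVector hinj ρ τ χ I g w =
    ∑ i ∈ I, (χ (g i) : ℂ) • supportedOn φ j hinj ρ (τ (g i)) w := rfl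

variable {τ χ I g w}

/-- By `hcov` and `hsep` exactly one summand is nonzero at `s·t`, and `hw` absorbs the element of `S
∩ T` relating `t` to its representative. The ambient group `A` is separate from `G` because for `G =
H'` the torus `T = K^×` is not contained in `G`; covering is required only for `t` in the image of
`G`. -/
lemma equivariantVector_apply
    (hw : ∀ (s : S) (t : T), j (φ s) = τ t → ρ s w = (χ t : ℂ) • w)
    (hcov : ∀ (x : G) (t : T), j x = τ t → ∃ i ∈ I, ∃ s : S, τ t = j (φ s) * τ (g i))
    (hsep : ∀ i ∈ I, ∀ i' ∈ I, ∀ s : S, τ (g i) = j (φ s) * τ (g i') → i = i')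
    {x : G} {s : S} {t : T} (h : j x = j (φ s) * τ t) :
    (equivariantVector hinj ρ τ χ I g w).1 x = (χ t : ℂ) • ρ s w := by
  obtain ⟨i, hi, s', hs'⟩ := hcov (φ s⁻¹ * x) t
    (by rw [map_mul, h, map_inv, map_inv, inv_mul_cancel_left])
  have hx : j x = j (φ (s * s')) * τ (g i) := by
    rw [h, hs', map_mul, map_mul, mul_assoc]
  rw [equivariantVector, AddSubmonoidClass.coe_finsetSum, Finset.sum_apply,
    Finset.sum_eq_single_of_mem i hi]
  · rw [Submodule.coe_smul, Pi.smul_apply, supportedOn_apply hinj ρ _ _ hx, map_mul,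
      Module.End.mul_apply, hw s' (t * (g i)⁻¹) (by rw [map_mul, hs', map_inv, mul_inv_cancel_right]),
      map_smul, smul_smul, ← Units.val_mul, mul_comm (χ _), ← map_mul,
      inv_mul_cancel_right]
  · intro i' hi' hne
    rw [Submodule.coe_smul, Pi.smul_apply, supportedOn_apply_of_not, smul_zero]
    rintro ⟨s'', hs''⟩
    refine hne (hsep i' hi' i hi (s''⁻¹ * (s * s')) ?_)
    rw [hx] at hs''
    rw [map_mul, map_mul, mul_assoc, hs'', map_inv, map_inv, inv_mul_cancel_left]

lemma equivariantVector_apply_of_not {x : G} (h : ¬ ∃ (s : S) (t : T), j x = j (φ s) * τ t) :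
    (equivariantVector hinj ρ τ χ I g w).1 x = 0 := by
  rw [equivariantVector, AddSubmonoidClass.coe_finsetSum, Finset.sum_apply]
  refine Finset.sum_eq_zero fun i _ => ?_
  rw [Submodule.coe_smul, Pi.smul_apply, supportedOn_apply_of_not, smul_zero]
  rintro ⟨s, hs⟩
  exact h ⟨s, g i, hs⟩

lemma equivariantVector_mul
    (hw : ∀ (s : S) (t : T), j (φ s) = τ t → ρ s w = (χ t : ℂ) • w)
    (hcov : ∀ (x : G) (t : T), j x = τ t → ∃ i ∈ I, ∃ s : S, τ t = j (φ s) * τ (g i))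
    (hsep : ∀ i ∈ I, ∀ i' ∈ I, ∀ s : S, τ (g i) = j (φ s) * τ (g i') → i = i')
    {x y : G} {t : T} (hy : j y = τ t) :
    (equivariantVector hinj ρ τ χ I g w).1 (x * y) =
      (χ t : ℂ) • (equivariantVector hinj ρ τ χ I g w).1 x := by
  by_cases h : ∃ (s : S) (t : T), j x = j (φ s) * τ t
  · obtain ⟨s, t', h⟩ := h
    have h' : j (x * y) = j (φ s) * τ (t' * t) := by rw [map_mul, h, hy, map_mul, mul_assoc]
    rw [equivariantVector_apply hinj ρ hw hcov hsep h,
      equivariantVector_apply hinj ρ hw hcov hsep h', smul_smul, map_mul, Units.val_mul, mul_comm]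
  · rw [equivariantVector_apply_of_not hinj ρ h, equivariantVector_apply_of_not hinj ρ, smul_zero]
    rintro ⟨s, t', h'⟩
    refine h ⟨s, t' * t⁻¹, ?_⟩
    rw [map_mul, hy] at h'
    rw [map_mul, ← mul_assoc, ← h', map_inv, mul_inv_cancel_right]

end Induced

/-! ### Coset representatives: the digits, `Δ_{i,α}` and `1 + aϖ^m`. -/

namespace Frame

variable {F D : Type*} [Field F] [ValuativeRel F] [TopologicalSpace F]
  [IsNonarchimedeanLocalField F] [DivisionRing D] [Algebra F D] {X : Frame F D}

namespace Coords

variable (C : X.Coords)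

lemma exists_digits (C : X.Coords) (n : ℕ) {b : F} (hb : valuation F b ≤ 1) :
    ∃ α ∈ Fintype.piFinset fun _ : Fin n => X.reps,
      valuation F (b - ∑ j, α j * (X.ϖF : F) ^ (j : ℕ)) ≤ X.p ^ n := by
  induction n generalizing b with
  | zero => exact ⟨Fin.elim0, Fintype.mem_piFinset.2 fun j => j.elim0, by simpa using hb⟩
  | succ n ih =>
    obtain ⟨a, ha, hba⟩ := C.exists_rep b hb
    rw [valuation_lt_one_iff X.irreducible_ϖF] at hba
    have h0 : (X.ϖF : F) ≠ 0 := (Valuation.ne_zero_iff _).1 X.p_ne_zero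
    obtain ⟨α, hα, h⟩ := ih (b := (b - a) / X.ϖF) (by
      rw [map_div₀]
      exact div_le_one_of_le₀ hba zero_le)
    refine ⟨Fin.cons a α, ?_, ?_⟩
    · rw [Fintype.mem_piFinset] at hα ⊢
      intro j
      refine Fin.cases ?_ (fun j => ?_) j
      · simpa using ha
      · simpa using hα j
    · have e : b - ∑ j : Fin (n + 1), (Fin.cons a α : Fin (n + 1) → F) j * (X.ϖF : F) ^ (j : ℕ) =
          X.ϖF * ((b - a) / X.ϖF - ∑ j, α j * (X.ϖF : F) ^ (j : ℕ)) := by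
        rw [Fin.sum_univ_succ, mul_sub, mul_div_cancel₀ _ h0, Finset.mul_sum]
        simp only [Fin.cons_zero, Fin.val_zero, pow_zero, mul_one, Fin.cons_succ, Fin.val_succ]
        rw [sub_sub]
        congr 2
        exact Finset.sum_congr rfl fun j _ => by ring
      rw [e, map_mul, pow_succ']
      exact mul_le_mul' le_rfl h

lemma valuation_sum_le (n : ℕ) (α : Fin n → F) (hα : ∀ j, valuation F (α j) ≤ 1) :
    valuation F (∑ j, α j * (X.ϖF : F) ^ (j : ℕ)) ≤ 1 := by
  refine Valuation.map_sum_le _ fun j _ => ?_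
  rw [map_mul, map_pow]
  exact mul_le_one' (hα j) (pow_le_one' X.p_lt_one.le _)

lemma digits_unique (C : X.Coords) (n : ℕ) {α α' : Fin n → F}
    (hα : α ∈ Fintype.piFinset fun _ : Fin n => X.reps)
    (hα' : α' ∈ Fintype.piFinset fun _ : Fin n => X.reps)
    (h : valuation F (∑ j, α j * (X.ϖF : F) ^ (j : ℕ) - ∑ j, α' j * (X.ϖF : F) ^ (j : ℕ)) ≤
      X.p ^ n) : α = α' := by
  rw [Fintype.mem_piFinset] at hα hα'
  induction n with
  | zero => exact Subsingleton.elim _ _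
  | succ n ih =>
    have e : ∑ j, α j * (X.ϖF : F) ^ (j : ℕ) - ∑ j, α' j * (X.ϖF : F) ^ (j : ℕ) =
        α 0 - α' 0 + X.ϖF * (∑ j : Fin n, α j.succ * (X.ϖF : F) ^ (j : ℕ) -
          ∑ j : Fin n, α' j.succ * (X.ϖF : F) ^ (j : ℕ)) := by
      have aux : ∀ β : Fin (n + 1) → F, ∑ j, β j * (X.ϖF : F) ^ (j : ℕ) =
          β 0 + X.ϖF * ∑ j : Fin n, β j.succ * (X.ϖF : F) ^ (j : ℕ) := by
        intro β
        rw [Fin.sum_univ_succ, Finset.mul_sum]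
        simp only [Fin.val_zero, pow_zero, mul_one, Fin.val_succ]
        congr 1
        exact Finset.sum_congr rfl fun j _ => by ring
      rw [aux, aux]
      ring
    rw [e] at h
    have hle : valuation F (∑ j : Fin n, α j.succ * (X.ϖF : F) ^ (j : ℕ) -
        ∑ j : Fin n, α' j.succ * (X.ϖF : F) ^ (j : ℕ)) ≤ 1 :=
      (Valuation.map_sub _ _ _).trans (max_le
        (valuation_sum_le n _ fun j => C.val_reps _ (hα _))
        (valuation_sum_le n _ fun j => C.val_reps _ (hα' _)))
    have h0 : α 0 = α' 0 := by
      refine C.reps_unique _ (hα 0) _ (hα' 0) ?_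
      have e2 : ∀ a b : F, a = (a + b) - b := fun a b => by ring
      rw [e2 (α 0 - α' 0)]
      refine (Valuation.map_sub _ _ _).trans_lt (max_lt (h.trans_lt ?_) ?_)
      · exact pow_lt_one' X.p_lt_one (Nat.succ_ne_zero n)
      · rw [map_mul]
        exact mul_lt_one_of_lt_of_le X.p_lt_one hle
    rw [h0, sub_self, zero_add, map_mul, pow_succ'] at h
    have ht := ih (α := fun j => α j.succ) (α' := fun j => α' j.succ) (fun j => hα _)
      (fun j => hα' _) (le_of_mul_le_mul_left h X.p_pos)
    funext j
    exact Fin.cases h0 (fun j => congrFun ht j) j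

lemma commute_of_mem_K (C : X.Coords) {k k' : D} (hk : k ∈ X.K) (hk' : k' ∈ X.K) : k * k' = k' * k := by
  rw [C.mem_K_iff] at hk hk'
  apply C.ext <;> simp [hk, hk'] <;> ring

/-- Here `s = d d'⁻¹`, and `d'⁻¹` is `conj d'` up to a scalar of `F^×`, to which `Near` is
insensitive. Quotients can thus be tested without computing inverses. -/
lemma near_iff_of_eq_mul [FiniteDimensional F D] {n : ℕ} {d d' s : D} (h : d = s * d')
    (hd' : d' ≠ 0) : C.Near n s ↔ C.Near n (d * C.conj d') := by
  have h0 : C.nrd d' ≠ 0 := fun h0 => C.abs_ne_zero hd' (by rw [abs, h0, map_zero])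
  rw [h, mul_assoc, C.mul_conj, ← Algebra.commutes, C.near_mul_iff (X.M.algebraMap_mem _)]
  simpa using h0

/-- The product is `(1 - bb'ϖ_F) + (b - b')ϖ`, whose first term is a unit. -/
lemma near_one_add_iff {n : ℕ} {b b' : F} (hb : valuation F b ≤ 1) (hb' : valuation F b' ≤ 1) :
    C.Near n ((1 + algebraMap F D b * X.ϖ) * C.conj (1 + algebraMap F D b' * X.ϖ)) ↔
      X.p * valuation F (b - b') ^ 2 ≤ X.p ^ n := by
  have e : C.e ((1 + algebraMap F D b * X.ϖ) * C.conj (1 + algebraMap F D b' * X.ϖ)) =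
      ⟨1 - b * b' * X.ϖF, 0, b - b', 0⟩ := by
    ext <;> simp [conj, C.e_ϖ] <;> ring
  have h1 : valuation F (1 - b * b' * X.ϖF) = 1 := by
    apply Valuation.map_one_sub_of_lt
    rw [map_mul, map_mul, mul_comm]
    exact mul_lt_one_of_lt_of_le X.p_lt_one (mul_le_one' hb hb')
  rw [Near, abs_jPart, abs_mPart, e]
  simp only [h1, map_zero, max_eq_left zero_le, one_pow, mul_one]

lemma Δ_eq (m i : ℕ) (α : Fin (m / 2) → F) : X.Δ m i α =
    X.ϖ ^ i * (1 + algebraMap F D (∑ j, α j * (X.ϖF : F) ^ (j : ℕ)) * X.ϖ) := by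
  rw [Δ, map_sum, Finset.sum_mul]
  congr 2
  refine Finset.sum_congr rfl fun j _ => ?_
  rw [ϖ_odd_pow, map_mul, mul_assoc]

lemma abs_one_add {b : F} (hb : valuation F b ≤ 1) :
    C.abs (1 + algebraMap F D b * X.ϖ) = 1 := by
  have e : C.e (1 + algebraMap F D b * X.ϖ) = ⟨1, 0, b, 0⟩ := by
    ext <;> simp [C.e_ϖ]
  rw [C.abs_eq_max, abs_mPart, abs_jPart, e]
  simp only [map_one, map_zero, max_eq_left zero_le, one_pow]
  exact max_eq_left (mul_le_one' X.p_lt_one.le (pow_le_one' hb 2))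

lemma mem_K_one_add (b : F) : 1 + algebraMap F D b * X.ϖ ∈ X.K :=
  add_mem (one_mem _) (mul_mem (X.K.algebraMap_mem _) X.ϖ_mem_K)

/-- Factor the dominant term out of `k = x + zϖ`: either `x(1 + (z/x)ϖ)`, or `ϖz(1 + (x/(zϖ_F))ϖ)`.
-/
lemma exists_eq_mul_one_add (C : X.Coords) {k : D} (hk : k ∈ X.K) (hk0 : k ≠ 0) :
    ∃ i ∈ Finset.range 2, ∃ a b : F, a ≠ 0 ∧ valuation F b ≤ 1 ∧
      k = X.ϖ ^ i * (algebraMap F D a * (1 + algebraMap F D b * X.ϖ)) := by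
  have hk := (C.mem_K_iff k).1 hk
  have hϖ := X.irreducible_ϖF
  have h0 : (X.ϖF : F) ≠ 0 := (Valuation.ne_zero_iff _).1 X.p_ne_zero
  set x := (C.e k).re with hx
  set z := (C.e k).imJ with hz
  have hek : C.e k = ⟨x, 0, z, 0⟩ := QuaternionAlgebra.ext rfl hk.1 rfl hk.2
  rcases lt_or_ge (X.p * valuation F z ^ 2) (valuation F x ^ 2) with h | h
  · have hx0 : x ≠ 0 := by
      rintro h1
      simp [h1] at h
    have hvx : valuation F x ≠ 0 := (Valuation.ne_zero_iff _).2 hx0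
    refine ⟨0, by simp, x, z / x, hx0, ?_, ?_⟩
    · have h2 := (sq_le_zpow_iff hϖ (z / x) (n := 0) (j := -1) (by norm_num)).1 (by
        rw [map_div₀, div_pow, zpow_neg_one, div_le_iff₀ (pow_pos (zero_lt_iff.2 hvx) 2)]
        rw [← div_eq_inv_mul, le_div_iff₀ X.p_pos, mul_comm]
        exact h.le)
      simpa using h2
    · apply C.e.injective
      have hx1 : x * (z / x) = z := mul_div_cancel₀ _ hx0
      rw [hek, map_mul, map_mul, C.e_algebraMap, map_add, map_mul, C.e_ϖ, C.e_algebraMap]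
      ext <;> simp [hx1]
  · have hz0 : z ≠ 0 := by
      intro h1
      rw [h1] at h
      have hx0 : x = 0 := by simpa using h
      apply hk0
      apply C.e.injective
      rw [map_zero, hek, hx0, h1]
      rfl
    have hvz : valuation F z ≠ 0 := (Valuation.ne_zero_iff _).2 hz0
    refine ⟨1, by simp, z, x / z / X.ϖF, hz0, ?_, ?_⟩
    · have h2 := (sq_le_zpow_iff hϖ (x / z) (n := 1) (j := 1) (by norm_num)).1 (by
        rw [map_div₀, div_pow, zpow_one, div_le_iff₀ (pow_pos (zero_lt_iff.2 hvz) 2)]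
        exact h)
      rw [zpow_one] at h2
      rw [map_div₀]
      exact div_le_one_of_le₀ h2 zero_le
    · apply C.e.injective
      have hx1 : X.ϖF * (z * (x / z / X.ϖF)) = x := by field_simp
      rw [hek, map_mul, map_mul, C.e_algebraMap, map_add, map_mul, pow_one, C.e_ϖ, C.e_algebraMap]
      ext <;> simp [hx1]

section Representatives

variable [FiniteDimensional F D]

/-- The factor `p` lowers the exponent to `m - 1`, and `⌈(m-1)/2⌉ = ⌊m/2⌋` is the number of odd
places below `m`. This is why exactly `m / 2` digits determine the coset of `1 + bϖ`. -/
lemma valuation_le_half_iff (m : ℕ) (b : F) :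
    X.p * valuation F b ^ 2 ≤ X.p ^ m ↔ valuation F b ≤ X.p ^ (m / 2) := by
  rw [← zpow_natCast _ (m / 2), ← sq_le_zpow_iff X.irreducible_ϖF b (j := (m : ℤ) - 1) (by omega),
    zpow_sub_one₀ X.p_ne_zero, zpow_natCast, ← div_eq_mul_inv, le_div_iff₀ X.p_pos, mul_comm]

lemma exists_Δ (C : X.Coords) (m : ℕ) (k : (↥X.K)ˣ) : ∃ x ∈ Finset.range 2 ×ˢ X.R' m, ∃ s : ↥(X.H m),
    toDUnits X.K k = s * toDUnits X.K (X.ΔK m x.1 x.2) := by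
  obtain ⟨i, hi, a, b, ha, hb, hk⟩ := C.exists_eq_mul_one_add (k : ↥X.K).2
    (toDUnits X.K k).ne_zero
  obtain ⟨α, hα, hbα⟩ := C.exists_digits (m / 2) hb
  refine ⟨(i, α), Finset.mem_product.2 ⟨hi, hα⟩, ⟨toDUnits X.K (k * (X.ΔK m i α)⁻¹), ?_⟩, ?_⟩
  · rw [C.mem_H_iff]
    set s := toDUnits X.K (k * (X.ΔK m i α)⁻¹) with hs
    have hsK : (s : D) ∈ X.K := ((k * (X.ΔK m i α)⁻¹ : (↥X.K)ˣ) : ↥X.K).2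
    have e : toDUnits X.K k = s * toDUnits X.K (X.ΔK m i α) := by
      rw [hs, ← map_mul, inv_mul_cancel_right]
    have e1 : ((k : ↥X.K) : D) = (s : D) * X.Δ m i α := congrArg Units.val e
    have hβ := valuation_sum_le (X := X) _ α fun j =>
      C.val_reps _ (Fintype.mem_piFinset.1 hα j)
    rw [hk, Δ_eq, ← mul_assoc (s : D), C.commute_of_mem_K hsK (pow_mem X.ϖ_mem_K i), mul_assoc,
      mul_right_inj' (pow_ne_zero _ X.ϖ_ne_zero)] at e1
    rw [C.near_iff_of_eq_mul e1 (X.one_add_ne_zero _), mul_assoc,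
      C.near_mul_iff (X.M.algebraMap_mem a) (by simpa using ha), C.near_one_add_iff hb hβ,
      valuation_le_half_iff]
    exact hbα
  · rw [← map_mul, inv_mul_cancel_right]

lemma Δ_unique (C : X.Coords) (m : ℕ) (x : ℕ × (Fin (m / 2) → F))
    (hx : x ∈ Finset.range 2 ×ˢ X.R' m)
    (x' : ℕ × (Fin (m / 2) → F)) (hx' : x' ∈ Finset.range 2 ×ˢ X.R' m) (s : ↥(X.H m))
    (h : toDUnits X.K (X.ΔK m x.1 x.2) = s * toDUnits X.K (X.ΔK m x'.1 x'.2)) : x = x' := by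
  obtain ⟨i, α⟩ := x
  obtain ⟨i', α'⟩ := x'
  rw [Finset.mem_product, Finset.mem_range] at hx hx'
  obtain ⟨hi, hα⟩ := hx
  obtain ⟨hi', hα'⟩ := hx'
  dsimp only at *
  have hβ := valuation_sum_le (X := X) _ α fun j => C.val_reps _ (Fintype.mem_piFinset.1 hα j)
  have hβ' := valuation_sum_le (X := X) _ α' fun j => C.val_reps _ (Fintype.mem_piFinset.1 hα' j)
  have hsK : ((s : Dˣ) : D) ∈ X.K := by
    rw [← mem_torus_iff, show (s : Dˣ) = toDUnits X.K (X.ΔK m i α * (X.ΔK m i' α')⁻¹) by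
      rw [map_mul, h, map_inv, mul_inv_cancel_right]]
    exact ⟨_, rfl⟩
  have hsn := (C.mem_H_iff m _).1 s.2
  have e : X.Δ m i α = ((s : Dˣ) : D) * X.Δ m i' α' := congrArg Units.val h
  rw [Δ_eq, Δ_eq] at e
  -- Elements of `H` have value an even power of `p`, since their `M`-component dominates; so the
  -- parity of the value of `Δ_{i,α}` determines `i`.
  have hii : i = i' := by
    have e1 := congrArg C.abs e
    rw [C.abs_mul, C.abs_mul, C.abs_mul, C.abs_pow, C.abs_pow, C.abs_ϖ, C.abs_one_add hβ,
      C.abs_one_add hβ', mul_one, mul_one, ← C.abs_mPart_eq_of_near hsn] at e1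
    obtain ⟨y, hy, hy0⟩ := C.exists_abs_mPart ((s : Dˣ) : D)
    have hy0 := hy0 (C.mPart_ne_zero_of_near hsn (Units.ne_zero _))
    rw [hy] at e1
    have hi : i = 0 ∨ i = 1 := by omega
    have hi' : i' = 0 ∨ i' = 1 := by omega
    rcases hi with rfl | rfl <;> rcases hi' with rfl | rfl
    · rfl
    · refine absurd ?_ (sq_ne_mul_sq X.irreducible_ϖF (x := (1 : F)) (y := y) one_ne_zero)
      simpa [mul_comm] using e1
    · refine absurd ?_ (sq_ne_mul_sq X.irreducible_ϖF (x := y) (y := (1 : F)) hy0)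
      simpa using e1.symm
    · rfl
  subst hii
  rw [← mul_assoc _ (X.ϖ ^ i), C.commute_of_mem_K hsK (pow_mem X.ϖ_mem_K i), mul_assoc,
      mul_right_inj' (pow_ne_zero _ X.ϖ_ne_zero)] at e
  rw [C.near_iff_of_eq_mul e (X.one_add_ne_zero _), C.near_one_add_iff hβ hβ',
    valuation_le_half_iff] at hsn
  rw [C.digits_unique (m / 2) hα hα' hsn]

/-- The quotient lies in `H₁' ∩ K^× = F^×(1 + 𝒫_K^(m+1))`, which forces `a ≡ a'` modulo `𝒫_F`. -/
lemma oneAdd_unique (C : X.Coords) {m : ℕ} (hm : Odd m) (a : F) (ha : a ∈ X.reps) (a' : F)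
    (ha' : a' ∈ X.reps) (s : ↥(X.H₁' m))
    (h : toDUnits X.K (X.oneAdd hm a) = s * toDUnits X.K (X.oneAdd hm a')) : a = a' := by
  have hs : (s : Dˣ) ∈ center F D ⊔ X.UK (m + 1) := by
    rw [← C.H₁'_inf_torus hm]
    refine ⟨s.2, X.oneAdd hm a * (X.oneAdd hm a')⁻¹, ?_⟩
    rw [map_mul, h, map_inv, mul_inv_cancel_right]
  have hsn := ((C.mem_center_sup_UK_iff _ _).1 hs).2
  obtain ⟨k, rfl⟩ := hm
  have e : (1 + algebraMap F D a * X.ϖ ^ (2 * k + 1) : D) =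
      ((s : Dˣ) : D) * (1 + algebraMap F D a' * X.ϖ ^ (2 * k + 1)) := congrArg Units.val h
  rw [ϖ_odd_pow, ← mul_assoc, ← mul_assoc, ← map_mul, ← map_mul] at e
  have hle : ∀ b ∈ X.reps, valuation F (b * (X.ϖF : F) ^ k) ≤ 1 := by
    intro b hb
    rw [map_mul, map_pow]
    exact mul_le_one' (C.val_reps b hb) (pow_le_one' X.p_lt_one.le k)
  rw [C.near_iff_of_eq_mul e (X.one_add_ne_zero _), C.near_one_add_iff (hle a ha) (hle a' ha'),
    valuation_le_half_iff, ← sub_mul, map_mul, map_pow,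
    show (2 * k + 1 + 1) / 2 = k + 1 by omega, pow_succ'] at hsn
  refine C.reps_unique a ha a' ha' ?_
  rw [valuation_lt_one_iff X.irreducible_ϖF]
  exact le_of_mul_le_mul_right hsn (pow_pos X.p_pos k)

/-- Modulo `𝒫_D^(m+1)`, an element of `1 + 𝒫_D^m` has the form `1 + wζϖ^m + aϖ^m`, because `ζϖ` and
`ϖ` span `Mϖ` integrally. The first correction belongs to `1 + 𝒫_L^m`, the second is the
representative. -/
lemma exists_oneAdd (C : X.Coords) {m : ℕ} (hm : Odd m) {h : Dˣ} (hh : h ∈ X.H' m) :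
    ∃ a ∈ X.reps, ∃ s : ↥(X.H₁' m), h = s * toDUnits X.K (X.oneAdd hm a) := by
  have := C.UD_normal m
  obtain ⟨y, hy, u, hu, rfl⟩ := Subgroup.mem_sup_of_normal_right.1 hh
  suffices H : ∃ a ∈ X.reps, ∃ l ∈ X.UL m, ∃ u' ∈ X.UD (m + 1),
      u = l * u' * toDUnits X.K (X.oneAdd hm a) by
    obtain ⟨a, ha, l, hl, u', hu', e⟩ := H
    refine ⟨a, ha, ⟨y * (l * u'), ?_⟩, by rw [e, mul_assoc y]⟩
    rw [H₁', sup_assoc]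
    exact Subgroup.mul_mem_sup hy (Subgroup.mul_mem_sup hl hu')
  rw [C.mem_UD_iff] at hu
  have hp1 : X.p ^ m < 1 := pow_lt_one' X.p_lt_one (by rcases hm with ⟨k, rfl⟩; omega)
  have ⟨k, hk⟩ := hm
  have h0 : (X.ϖF : F) ≠ 0 := (Valuation.ne_zero_iff _).1 X.p_ne_zero
  have hϖk : (X.ϖF : F) ^ k ≠ 0 := pow_ne_zero _ h0
  have hj := (C.abs_jPart_le _).trans hu.2
  rw [C.jPart_sub_one, abs_jPart] at hj
  obtain ⟨z, hz⟩ : ∃ z : F, (C.e (u : D)).imJ = z * X.ϖF ^ k :=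
    ⟨_, (div_mul_cancel₀ _ hϖk).symm⟩
  -- With `m = 2k + 1`, the coordinates of `ζϖ^m` along `ϖ` and `ηϖ` are `sϖ_F^k` and `tϖ_F^k`. So
  -- `w` is fixed by the `ηϖ`-coordinate, and `z - ws` is what remains along `ϖ`.
  obtain ⟨w, hw⟩ : ∃ w : F, (C.e (u : D)).imK = w * C.t * X.ϖF ^ k :=
    ⟨_ / C.t, by rw [div_mul_cancel₀ _ C.t_ne_zero, div_mul_cancel₀ _ hϖk]⟩
  have hle : ∀ x : F, X.p * valuation F (x * X.ϖF ^ k) ^ 2 ≤ X.p ^ m → valuation F x ≤ 1 := by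
    intro x hx
    rw [valuation_le_half_iff, map_mul, map_pow, hk, show (2 * k + 1) / 2 = k by omega] at hx
    exact (mul_le_iff_le_one_left (pow_pos X.p_pos k)).1 hx
  have hz1 : valuation F z ≤ 1 := by
    refine hle z (le_trans ?_ hj)
    rw [hz]
    exact mul_le_mul' le_rfl (pow_le_pow_left₀ zero_le (le_max_left _ _) 2)
  have hw1 : valuation F w ≤ 1 := by
    have : valuation F (w * C.t) ≤ 1 := by
      refine hle _ (le_trans ?_ hj)
      rw [hw]
      exact mul_le_mul' le_rfl (pow_le_pow_left₀ zero_le (le_max_right _ _) 2)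
    rwa [map_mul, C.val_t, mul_one] at this
  obtain ⟨a, ha, hza⟩ := C.exists_rep (z - w * C.s) ((Valuation.map_sub _ _ _).trans
    (max_le hz1 (by rw [map_mul]; exact mul_le_one' hw1 C.val_s_le)))
  have hpow : X.ϖ ^ m = algebraMap F D ((X.ϖF : F) ^ k) * X.ϖ := by rw [hk, ϖ_odd_pow]
  have hl1 : C.abs ((1 + algebraMap F D w * (X.ζ * X.ϖ ^ m)) - 1) ≤ X.p ^ m := by
    rw [add_sub_cancel_left, C.abs_mul, C.abs_mul, C.abs_ζ, C.abs_pow, C.abs_ϖ, one_mul,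
      C.abs_algebraMap]
    exact mul_le_of_le_one_left zero_le (pow_le_one' hw1 2)
  have hl2 := C.abs_eq_one_of_sub (hl1.trans_lt hp1)
  have hl0 : (1 + algebraMap F D w * (X.ζ * X.ϖ ^ m) : D) ≠ 0 := by
    intro h
    rw [h, C.abs_zero] at hl2
    exact zero_ne_one hl2
  set l : Dˣ := Units.mk0 _ hl0 with hl
  have hlL : l ∈ X.UL m := by
    rw [C.mem_UL_iff]
    refine ⟨?_, hl2, hl1⟩
    change 1 + algebraMap F D w * (X.ζ * X.ϖ ^ m) ∈ X.L
    rw [hpow, ← mul_assoc X.ζ, ← Algebra.commutes, mul_assoc (algebraMap F D _) X.ζ]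
    exact add_mem (one_mem _) (mul_mem (X.L.algebraMap_mem _) (mul_mem (X.L.algebraMap_mem _)
      (Algebra.subset_adjoin rfl)))
  set g := toDUnits X.K (X.oneAdd hm a) with hg
  have hgval : (g : D) = 1 + algebraMap F D a * X.ϖ ^ m := rfl
  have hg1 : C.abs (g : D) = 1 := by
    apply C.abs_eq_one_of_sub
    rw [hgval, add_sub_cancel_left, C.abs_mul, C.abs_algebraMap, C.abs_pow, C.abs_ϖ, mul_comm]
    exact mul_lt_one_of_lt_of_le hp1 (pow_le_one' (C.val_reps a ha) 2)
  refine ⟨a, ha, l, hlL, l⁻¹ * u * g⁻¹, ?_, by change u = l * (l⁻¹ * u * g⁻¹) * g; group⟩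
  have hli : C.abs ((l⁻¹ : Dˣ) : D) = 1 := by
    rw [Units.val_inv_eq_inv_val, C.abs_inv]
    exact inv_eq_one.2 hl2
  have hgi : C.abs ((g⁻¹ : Dˣ) : D) = 1 := by
    rw [Units.val_inv_eq_inv_val, C.abs_inv, hg1, inv_one]
  rw [C.mem_UD_iff]
  refine ⟨by rw [Units.val_mul, Units.val_mul, C.abs_mul, C.abs_mul, hli, hgi, hu.1]; simp, ?_⟩
  have e : ((l⁻¹ * u * g⁻¹ : Dˣ) : D) - 1 =
      ((l⁻¹ : Dˣ) : D) * ((u : D) - l * g) * ((g⁻¹ : Dˣ) : D) := by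
    rw [mul_sub, sub_mul, Units.inv_mul_cancel_left, Units.mul_inv]
    rfl
  rw [e, C.abs_mul, C.abs_mul, hli, hgi, one_mul, mul_one]
  have ed : (u : D) - l * g = ((u : D) - 1 - algebraMap F D (w * a) * (X.ζ * X.ϖ ^ m * X.ϖ ^ m)) -
      algebraMap F D w * (X.ζ * X.ϖ ^ m) - algebraMap F D a * X.ϖ ^ m := by
    change (u : D) - (1 + algebraMap F D w * (X.ζ * X.ϖ ^ m)) *
      (1 + algebraMap F D a * X.ϖ ^ m) = _
    rw [map_mul, mul_assoc _ (algebraMap F D a), ← mul_assoc (algebraMap F D a) (X.ζ * _),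
      Algebra.commutes a (X.ζ * _)]
    noncomm_ring
  set d := (u : D) - l * g with hd
  have hmd : C.mPart d =
      C.mPart ((u : D) - 1 - algebraMap F D (w * a) * (X.ζ * X.ϖ ^ m * X.ϖ ^ m)) := by
    rw [ed, hpow]
    obtain ⟨r, hr⟩ : ∃ r, r = (X.ϖF : F) ^ k := ⟨_, rfl⟩
    rw [← hr]
    apply C.ext <;> simp [C.e_ϖ, C.e_ζ]
  have hm1 : C.abs (C.mPart d) ≤ X.p ^ m := by
    rw [hmd]
    refine (C.abs_mPart_le _).trans ((C.abs_sub_le _ _).trans (max_le hu.2 ?_))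
    rw [C.abs_mul, C.abs_mul, C.abs_mul, C.abs_ζ, C.abs_pow, C.abs_ϖ, one_mul, C.abs_algebraMap,
      ← mul_assoc]
    refine mul_le_of_le_one_left zero_le (mul_le_one' (pow_le_one' ?_ 2) hp1.le)
    rw [map_mul]
    exact mul_le_one' hw1 (C.val_reps a ha)
  -- As `m` is odd and values on `M` are even powers of `p`, the bound `p^m` improves to `p^(m+1)`.
  have hm2 : C.abs (C.mPart d) ≤ X.p ^ (m + 1) := by
    obtain ⟨x, hx, -⟩ := C.exists_abs_mPart d
    rw [hx] at hm1 ⊢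
    have h1 := (sq_le_zpow_iff X.irreducible_ϖF x (n := k + 1) (j := m) (by omega)).1
      (by rwa [zpow_natCast])
    have h2 := (sq_le_zpow_iff X.irreducible_ϖF x (n := k + 1) (j := (m + 1 : ℕ))
      (by omega)).2 h1
    rwa [zpow_natCast] at h2
  have hj2 : C.abs (C.jPart d) ≤ X.p ^ (m + 1) := by
    obtain ⟨r, hr⟩ : ∃ r, r = (X.ϖF : F) ^ k := ⟨_, rfl⟩
    rw [← hr] at hz hw hpow
    have hk' : (C.e d).imK = 0 := by
      rw [ed, hpow]
      simp [C.e_ϖ, C.e_ζ, hw]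
      ring
    have hj' : (C.e d).imJ = (z - w * C.s - a) * r := by
      rw [ed, hpow]
      simp [C.e_ϖ, C.e_ζ, hz]
      ring
    rw [abs_jPart, hk', hj', map_zero, max_eq_left zero_le, valuation_le_half_iff, map_mul, hr, map_pow,
      hk, show (2 * k + 1 + 1) / 2 = k + 1 by omega, pow_succ']
    rw [valuation_lt_one_iff X.irreducible_ϖF] at hza
    exact mul_le_mul' hza le_rfl
  rw [C.abs_eq_max]
  exact max_le hm2 hj2

end Representatives

end Coords

end Frame

/-! ### Conjugates of `ψ_c` and the double coset `H K^×`. -/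

namespace Frame

variable {F D : Type*} [Field F] [ValuativeRel F] [TopologicalSpace F]
  [IsNonarchimedeanLocalField F] [DivisionRing D] [Algebra F D] {X : Frame F D}

namespace Coords

variable (C : X.Coords)

/-- The square root of `ω` in `M`. -/
def η : D := C.e.symm ⟨0, 1, 0, 0⟩

@[simp] lemma e_η : C.e C.η = ⟨0, 1, 0, 0⟩ := C.e.apply_symm_apply _

lemma re_mul_comm (x y : D) : (C.e (x * y)).re = (C.e (y * x)).re := by
  simp
  ring

lemma sq_valuation_re_le (x : D) : valuation F (C.e x).re ^ 2 ≤ C.abs x := by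
  refine le_trans ?_ (C.abs_mPart_le x)
  rw [abs_mPart]
  exact pow_le_pow_left₀ zero_le (le_max_left _ _) 2

lemma abs_η : C.abs C.η = 1 := by
  simp [abs, nrd, C.val_ω]

/-- `η` commutes with `M` and anticommutes with `Mϖ`, so its commutator with `d` measures the
distance of `d` from `M`. -/
lemma commutator_η (d : D) : C.η * d - d * C.η = algebraMap F D 2 * (C.η * C.jPart d) := by
  have e2 : C.e (algebraMap F D 2) = ⟨2, 0, 0, 0⟩ := C.e_algebraMap 2
  apply C.ext <;>
    simp only [map_sub, map_mul, e2, e_η, e_jPart] <;> simp <;> ring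

lemma abs_commutator_η (d : D) : C.abs (C.η * d - d * C.η) = C.abs (C.jPart d) := by
  rw [commutator_η, C.abs_mul, C.abs_mul, C.abs_η, C.abs_algebraMap, C.val_two]
  simp

lemma eq_add_mul_η {c : D} (hc : c ∈ X.M) :
    c = algebraMap F D (C.e c).re + algebraMap F D (C.e c).imI * C.η := by
  rw [C.mem_M_iff] at hc
  apply C.ext <;> simp [hc]

lemma ψc_eq (ψ₀ : AddChar F ℂ) (c : ↥X.M) (u : Dˣ) :
    X.ψc ψ₀ c u = ψ₀ (2 * (C.e ((c : D) * ((u : D) - 1))).re) := by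
  rw [ψc, C.reducedTrace_eq]

lemma ψc_conj (ψ₀ : AddChar F ℂ) (c : ↥X.M) (g u : Dˣ) : X.ψc ψ₀ c (g * u * g⁻¹) =
    ψ₀ (2 * (C.e (((g⁻¹ : Dˣ) : D) * c * g * ((u : D) - 1))).re) := by
  have e : ((g * u * g⁻¹ : Dˣ) : D) - 1 = g * ((u : D) - 1) * ((g⁻¹ : Dˣ) : D) := by
    rw [mul_sub, sub_mul, mul_one, Units.mul_inv]
    rfl
  rw [C.ψc_eq, e, ← mul_assoc, C.re_mul_comm, ← mul_assoc, ← mul_assoc]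

variable [FiniteDimensional F D]

/-- If `g⁻¹ηg = bη + aϖ + dηϖ` is close to `η` up to the action of `K^×`, then `g ∈ H K^×`. -/
lemma exists_mul_of_near_η (m : ℕ) (g : Dˣ) {a b d : F} {η' : D}
    (he : C.e η' = ⟨0, b, a, d⟩) (hη' : (g : D) * η' = C.η * g)
    (ha : valuation F a ≤ X.p ^ (m / 2)) (hb : valuation F (b - 1) < 1)
    (hn : b ^ 2 * C.ω + a ^ 2 * X.ϖF - d ^ 2 * C.ω * X.ϖF = C.ω)
    (hd : valuation F d ≤ 1) :
    ∃ h ∈ X.H m, ∃ t : (↥X.K)ˣ, g = h * toDUnits X.K t := by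
  have hω0 : C.ω ≠ 0 := by
    intro h
    have := C.val_ω
    simp [h] at this
  have ha1 : valuation F a ≤ 1 := ha.trans (pow_le_one' X.p_lt_one.le _)
  have hb1 : valuation F (1 + b) = 1 := by
    have e : 1 + b = 2 + (b - 1) := by ring
    rw [e, Valuation.map_add_eq_of_lt_left _ (by rwa [C.val_two]), C.val_two]
  -- Hilbert 90: if `a = 0`, then `η' = ηu` with `u = b + dϖ` of norm `1` in `K`, and `k = 1 + u`
  -- satisfies `kη' = ηk` exactly. In general the defect `kη' - ηk` is a multiple of `a`.
  set k : D := algebraMap F D (1 + b) + algebraMap F D d * X.ϖ with hk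
  have hek : C.e k = ⟨1 + b, 0, d, 0⟩ := by
    rw [hk, map_add, map_mul, C.e_algebraMap, C.e_algebraMap, C.e_ϖ]
    ext <;> simp
  have hkK : k ∈ X.K := (C.mem_K_iff k).2 (by rw [hek]; exact ⟨rfl, rfl⟩)
  have hk1 : C.abs k = 1 := by
    rw [C.abs_eq_max, abs_mPart, abs_jPart, hek]
    simp only [hb1, map_zero, max_eq_left zero_le, one_pow]
    exact max_eq_left (mul_le_one' X.p_lt_one.le (pow_le_one' hd 2))
  have hk0 : k ≠ 0 := by
    intro h
    rw [h, C.abs_zero] at hk1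
    exact zero_ne_one hk1
  set t : (↥X.K)ˣ := unitOfMem X.K k hkK hk0
  have htk : ((toDUnits X.K t : Dˣ) : D) = k := rfl
  set g' : Dˣ := g * (toDUnits X.K t)⁻¹ with hg'
  have hgg : (g : D) = g' * k := by
    rw [← htk, ← Units.val_mul, hg', inv_mul_cancel_right]
  refine ⟨g', ?_, t, by rw [hg', inv_mul_cancel_right]⟩
  have h1 : (C.η * g' - g' * C.η) * k = g' * (k * η' - C.η * k) := by
    have h2 : C.η * (g' * k) = g' * k * η' := by rw [← hgg, hη']
    rw [sub_mul, mul_assoc, h2]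
    noncomm_ring
  have h2 : k * η' - C.η * k =
      algebraMap F D a * (k * X.ϖ - algebraMap F D (a * X.ϖF / C.ω) * C.η) := by
    obtain ⟨r, hr⟩ : ∃ r, r = a * X.ϖF / C.ω := ⟨_, rfl⟩
    have hr' : r * C.ω = a * X.ϖF := by rw [hr, div_mul_cancel₀ _ hω0]
    rw [← hr]
    apply C.ext <;>
      simp only [map_sub, map_mul, C.e_algebraMap, hek, C.e_ϖ, he, e_η] <;> simp
    · ring
    · apply mul_left_cancel₀ hω0
      linear_combination hn + a * hr'
    · ring
    · ring
  have h3 : C.abs (k * X.ϖ - algebraMap F D (a * X.ϖF / C.ω) * C.η) ≤ X.p := by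
    refine (C.abs_sub_le _ _).trans (max_le ?_ ?_)
    · rw [C.abs_mul, hk1, C.abs_ϖ, one_mul]
    · rw [C.abs_mul, C.abs_η, C.abs_algebraMap, map_div₀, C.val_ω, map_mul, div_one, mul_one,
        pow_two]
      exact (mul_le_of_le_one_left zero_le (mul_le_one' ha1 X.p_lt_one.le)).trans
        (mul_le_of_le_one_left zero_le ha1)
  -- The scalar `a` contributes `2[m/2]` to the exponent, since `|a| = v(a)²`, and its cofactor
  -- contributes `1`. The total `2[m/2] + 1` is at least `m`.
  have h4 : C.abs (C.jPart (g' : D)) ≤ X.p ^ (2 * (m / 2) + 1) * C.abs (g' : D) := by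
    have h5 := congrArg C.abs h1
    rw [C.abs_mul, C.abs_mul, h2, C.abs_mul, C.abs_algebraMap, abs_commutator_η, hk1,
      mul_one] at h5
    have e : X.p ^ (2 * (m / 2) + 1) = (X.p ^ (m / 2)) ^ 2 * X.p := by
      rw [pow_succ, mul_comm 2, pow_mul]
    rw [h5, mul_comm, e]
    exact mul_le_mul' (mul_le_mul' (pow_le_pow_left₀ zero_le ha 2) h3) le_rfl
  have h5 : C.abs (C.mPart (g' : D)) = C.abs (g' : D) := by
    apply C.abs_mPart_eq_of_lt
    refine h4.trans_lt (mul_lt_of_lt_one_left (C.abs_pos g'.ne_zero) ?_)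
    exact pow_lt_one' X.p_lt_one (by omega)
  rw [C.mem_H_iff, Near, h5]
  exact h4.trans (mul_le_mul' (pow_le_pow_right_of_le_one' X.p_lt_one.le (by omega)) le_rfl)

/-- The component of `c` along `η` has value `p ^ (-m - 1)`. -/
lemma valuation_imI_of_represents {m : ℕ} {ψ₀ : AddChar F ℂ} {ψ : (↥X.M)ˣ →* ℂˣ} {c : ↥X.M}
    (hc : X.Represents m ψ₀ ψ c) :
    valuation F (C.e (c : D)).imI = X.p ^ (-(m : ℤ) - 1) := by
  have hϖ := X.irreducible_ϖF
  have hpow : ∀ n : ℤ, (X.p ^ 2) ^ n = X.p ^ (2 * n) := fun n => by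
    rw [zpow_mul]
    norm_cast
  apply le_antisymm
  · have h := hc.1.2
    rw [C.dAbs_le_iff, C.abs_ϖM, hpow] at h
    rw [← sq_le_zpow_iff hϖ _ (Or.inl rfl)]
    refine le_trans ?_ ((C.abs_mPart_le _).trans h)
    rw [abs_mPart]
    exact pow_le_pow_left₀ zero_le (le_max_right _ _) 2
  · have h := hc.2.1 (C.e (c : D)).re
    rw [← not_lt, valuation_lt_zpow_iff hϖ, sub_add_cancel]
    intro h1
    refine h ⟨sub_mem c.2 (X.M.algebraMap_mem _), ?_⟩
    have e : (c : D) - algebraMap F D (C.e (c : D)).re =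
        algebraMap F D (C.e (c : D)).imI * C.η := by
      conv_lhs => rw [C.eq_add_mul_η c.2]
      simp
    rw [C.dAbs_le_iff, C.abs_ϖM, hpow, e, C.abs_mul, C.abs_algebraMap, C.abs_η, mul_one,
      sq_le_zpow_iff hϖ _ (Or.inl rfl)]
    exact h1

/-- If `ψ_c` and its conjugate by `g` agree on `1 + 𝒫_K ^ (m + 1)`, then `g ∈ H K^×`. -/
lemma exists_mul_of_ψc_conj_eq (C : X.Coords) {m : ℕ} {ψ₀ : AddChar F ℂ}
    (hψ₀ : IsConductorZero (X.ϖF : F) ψ₀)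
    {ψ : (↥X.M)ˣ →* ℂˣ} {c : ↥X.M} (hc : X.Represents m ψ₀ ψ c) (g : Dˣ)
    (h : ∀ k ∈ X.UK (m + 1), X.ψc ψ₀ c (g * k * g⁻¹) = X.ψc ψ₀ c k) :
    ∃ h ∈ X.H m, ∃ t : (↥X.K)ˣ, g = h * toDUnits X.K t := by
  have hϖ := X.irreducible_ϖF
  have hc1 := C.valuation_imI_of_represents hc
  set η' : D := ((g⁻¹ : Dˣ) : D) * C.η * g with hη'
  obtain ⟨b, hb⟩ : ∃ b, b = (C.e η').imI := ⟨_, rfl⟩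
  obtain ⟨a, ha⟩ : ∃ a, a = (C.e η').imJ := ⟨_, rfl⟩
  obtain ⟨d, hd⟩ : ∃ d, d = (C.e η').imK := ⟨_, rfl⟩
  have hre : (C.e η').re = 0 := by
    rw [hη', C.re_mul_comm, ← mul_assoc, Units.mul_inv, one_mul, e_η]
  have he : C.e η' = ⟨0, b, a, d⟩ := QuaternionAlgebra.ext hre hb.symm ha.symm hd.symm
  have hgη : (g : D) * η' = C.η * g := by
    rw [hη', ← mul_assoc, Units.mul_inv_cancel_left]
  have hsq : η' * η' = algebraMap F D C.ω := by
    have h1 : C.η * C.η = algebraMap F D C.ω := by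
      apply C.ext <;> simp
    apply mul_left_cancel₀ g.ne_zero
    rw [← mul_assoc, hgη, mul_assoc, hgη, ← mul_assoc, h1, Algebra.commutes]
  have hn : b ^ 2 * C.ω + a ^ 2 * X.ϖF - d ^ 2 * C.ω * X.ϖF = C.ω := by
    have h1 := congrArg (fun x => (C.e x).re) hsq
    simp only [map_mul, C.e_algebraMap, he] at h1
    simp at h1
    linear_combination h1
  have habs : C.abs η' = 1 := by
    rw [hη', C.abs_mul, C.abs_mul, C.abs_η, mul_one, ← C.abs_mul, Units.inv_mul, C.abs_one]
  have hd1 : valuation F d ≤ 1 := by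
    have h1 := C.abs_jPart_le η'
    rw [abs_jPart, he, habs] at h1
    have h2 := (valuation_le_half_iff (X := X) 0 d).1 (by
      rw [pow_zero]
      refine le_trans ?_ h1
      exact mul_le_mul' le_rfl (pow_le_pow_left₀ zero_le (le_max_right _ _) 2))
    simpa using h2
  -- Test on `k = 1 + zϖ`. Here `Trd(czϖ) = 0`, whereas `Trd(g⁻¹cg zϖ) = 2c₁aϖ_F z` with `c₁` the
  -- `η`-coordinate of `c`, of value `p^(-m-1)`.
  have ha1 : valuation F a ≤ X.p ^ (m / 2) := by
    have key : ∀ τ : F, valuation F τ ≤ 1 →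
        ψ₀ (τ * (2 * (C.e (c : D)).imI * a * X.ϖF ^ ((m + 1) / 2 + 1))) = 1 := by
      intro τ hτ
      -- The exponent `⌈m/2⌉` is the least one that puts `zϖ` in `𝒫_D^(m+1)`.
      set z : F := τ * X.ϖF ^ ((m + 1) / 2) with hz
      have hx : C.abs ((1 + algebraMap F D z * X.ϖ) - 1) ≤ X.p ^ (m + 1) := by
        rw [add_sub_cancel_left, C.abs_mul, C.abs_algebraMap, C.abs_ϖ, mul_comm,
          valuation_le_half_iff, hz, map_mul, map_pow]
        exact mul_le_of_le_one_left zero_le hτ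
      have hx1 := C.abs_eq_one_of_sub (hx.trans_lt (pow_lt_one' X.p_lt_one (by omega)))
      have hk := h (Units.mk0 _ (X.one_add_ne_zero z))
        ((C.mem_UK_iff _ _).2 ⟨mem_K_one_add z, hx1, hx⟩)
      have e1 : ((g⁻¹ : Dˣ) : D) * c * g = algebraMap F D (C.e (c : D)).re +
          algebraMap F D (C.e (c : D)).imI * η' := by
        conv_lhs => rw [C.eq_add_mul_η c.2]
        rw [mul_add, ← Algebra.commutes, add_mul, mul_assoc, Units.inv_mul, mul_one, hη',
          ← mul_assoc, ← Algebra.commutes, mul_assoc, mul_assoc, mul_assoc]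
      rw [C.ψc_conj, e1, C.ψc_eq, Units.val_mk0, add_sub_cancel_left] at hk
      have e2 : (C.e ((algebraMap F D (C.e (c : D)).re +
          algebraMap F D (C.e (c : D)).imI * η') * (algebraMap F D z * X.ϖ))).re =
          (C.e (c : D)).imI * a * X.ϖF * z := by
        simp only [map_mul, map_add, C.e_algebraMap, C.e_ϖ, he]
        simp
        exact Or.inl (by ring)
      have e3 : (C.e ((c : D) * (algebraMap F D z * X.ϖ))).re = 0 := by
        have := (C.mem_M_iff _).1 c.2
        simp only [map_mul, C.e_algebraMap, C.e_ϖ]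
        simp [this.1, this.2]
      rw [e2, e3, mul_zero, AddChar.map_zero_eq_one] at hk
      rw [← hk, hz]
      congr 1
      ring
    have h1 := valuation_le_one_of_addChar hϖ hψ₀ key
    rw [map_mul, map_mul, map_mul, C.val_two, one_mul, hc1, map_pow] at h1
    have h2 : X.p ^ (-(m : ℤ) - 1) * X.p ^ ((m + 1) / 2 + 1) = (X.p ^ (m / 2))⁻¹ := by
      rw [← zpow_natCast, ← zpow_add₀ X.p_ne_zero, ← zpow_natCast, ← zpow_neg]
      congr 1
      omega
    rw [mul_right_comm, h2, ← div_eq_inv_mul, div_le_one₀ (pow_pos X.p_pos _)] at h1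
    exact h1
  have ha2 : valuation F a ≤ 1 := ha1.trans (pow_le_one' X.p_lt_one.le _)
  -- The relation `η'² = ω` gives `b² ≡ 1` modulo `𝒫_F`, so `b` is close to `1` or to `-1`.
  have hb2 : valuation F (b - 1) * valuation F (b + 1) < 1 := by
    have e : C.ω * ((b - 1) * (b + 1)) = X.ϖF * (d ^ 2 * C.ω - a ^ 2) := by
      linear_combination hn
    have h1 := congrArg (valuation F) e
    rw [map_mul, C.val_ω, one_mul, map_mul, map_mul] at h1
    rw [h1]
    refine mul_lt_one_of_lt_of_le X.p_lt_one ((Valuation.map_sub _ _ _).trans (max_le ?_ ?_))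
    · rw [map_mul, C.val_ω, mul_one, map_pow]
      exact pow_le_one' hd1 2
    · rw [map_pow]
      exact pow_le_one' ha2 2
  rcases lt_or_ge (valuation F (b - 1)) 1 with hb3 | hb3
  · exact C.exists_mul_of_near_η m g he hgη ha1 hb3 hn hd1
  · have hb4 : valuation F (b + 1) < 1 := by
      by_contra hb4
      exact absurd hb2 (not_lt.2 (one_le_mul hb3 (not_lt.1 hb4)))
    -- When `b` is close to `-1`, replace `g` by `gϖ`: conjugation by `ϖ ∈ K^×` changes the signs of
    -- `b` and `d` and keeps `a`.
    set w : (↥X.K)ˣ := unitOfMem X.K X.ϖ X.ϖ_mem_K X.ϖ_ne_zero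
    have hw : ((toDUnits X.K w : Dˣ) : D) = X.ϖ := rfl
    obtain ⟨h, hh, t, ht⟩ := C.exists_mul_of_near_η m (g * toDUnits X.K w) (a := a) (b := -b)
      (d := -d) (η' := C.e.symm ⟨0, -b, a, -d⟩) (by simp)
      (by
        have e : X.ϖ * C.e.symm ⟨0, -b, a, -d⟩ = η' * X.ϖ := by
          apply C.e.injective
          rw [map_mul, map_mul, he, C.e_ϖ]
          ext <;> simp
        rw [Units.val_mul, hw, mul_assoc, e, ← mul_assoc, hgη, mul_assoc])
      ha1 (by
        rw [show -b - 1 = -(b + 1) by ring, Valuation.map_neg]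
        exact hb4)
      (by linear_combination hn) (by rwa [Valuation.map_neg])
    refine ⟨h, hh, t * w⁻¹, ?_⟩
    rw [map_mul, ← mul_assoc, ← ht, map_inv, mul_inv_cancel_right]

/-- `ψ_c` on `1 + 𝒫_D ^ (m + 1)` is invariant under conjugation by `H`. -/
lemma ψc_conj_eq (C : X.Coords) {m : ℕ} {ψ₀ : AddChar F ℂ} (hψ₀ : IsConductorZero (X.ϖF : F) ψ₀)
    {ψ : (↥X.M)ˣ →* ℂˣ} {c : ↥X.M} (hc : X.Represents m ψ₀ ψ c) {h u : Dˣ}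
    (hh : h ∈ X.H m) (hu : u ∈ X.UD (m + 1)) :
    X.ψc ψ₀ c (h * u * h⁻¹) = X.ψc ψ₀ c u := by
  have hϖ := X.irreducible_ϖF
  have hc1 := C.valuation_imI_of_represents hc
  rw [C.mem_H_iff, Near] at hh
  rw [C.mem_UD_iff] at hu
  rw [C.ψc_conj, C.ψc_eq]
  have e1 : (c : D) * h - h * c =
      algebraMap F D (C.e (c : D)).imI * (C.η * h - h * C.η) := by
    conv_lhs => rw [C.eq_add_mul_η c.2]
    rw [add_mul, mul_add, ← Algebra.commutes, ← mul_assoc (h : D), ← Algebra.commutes]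
    noncomm_ring
  have e2 : ((h⁻¹ : Dˣ) : D) * c * h * ((u : D) - 1) = c * ((u : D) - 1) +
      ((h⁻¹ : Dˣ) : D) * ((c : D) * h - h * c) * ((u : D) - 1) := by
    have e3 : ((h⁻¹ : Dˣ) : D) * ((c : D) * h - h * c) = ((h⁻¹ : Dˣ) : D) * c * h - c := by
      rw [mul_sub, Units.inv_mul_cancel_left, mul_assoc]
    rw [e3, sub_mul, add_sub_cancel]
  rw [e2, map_add, QuaternionAlgebra.re_add, mul_add, AddChar.map_add_eq_mul]
  -- The exponent is `2(-m-1) + m + (m+1) = -1`: the square of the value of the `η`-coordinate of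
  -- `c`, then the commutator of `η` with `h ∈ H`, then `u - 1`. A real part whose squared value is
  -- at most `p⁻¹` is integral, so `ψ₀` does not see it.
  have h3 : C.abs (((h⁻¹ : Dˣ) : D) * ((c : D) * h - h * c) * ((u : D) - 1)) ≤
      X.p ^ (-1 : ℤ) := by
    rw [e1, C.abs_mul, C.abs_mul, C.abs_mul, abs_commutator_η, C.abs_algebraMap, hc1,
      Units.val_inv_eq_inv_val, C.abs_inv]
    have hh' : C.abs (C.jPart (h : D)) ≤ X.p ^ m * C.abs (h : D) :=
      hh.trans (mul_le_mul' le_rfl (C.abs_mPart_le _))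
    calc (C.abs (h : D))⁻¹ * ((X.p ^ (-(m : ℤ) - 1)) ^ 2 * C.abs (C.jPart (h : D))) *
          C.abs ((u : D) - 1)
        ≤ (C.abs (h : D))⁻¹ * ((X.p ^ (-(m : ℤ) - 1)) ^ 2 * (X.p ^ m * C.abs (h : D))) *
          X.p ^ (m + 1) :=
          mul_le_mul' (mul_le_mul' le_rfl (mul_le_mul' le_rfl hh')) hu.2
      _ = (X.p ^ (-(m : ℤ) - 1)) ^ 2 * X.p ^ m * X.p ^ (m + 1) := by
          rw [mul_comm (C.abs (h : D))⁻¹, ← mul_assoc _ _ (C.abs (h : D)), mul_assoc _ (C.abs _),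
            mul_inv_cancel₀ (C.abs_unit_ne_zero h), mul_one]
      _ = X.p ^ (-1 : ℤ) := by
          rw [← zpow_natCast, ← zpow_natCast X.p m, ← zpow_natCast X.p (m + 1), ← zpow_mul,
            ← zpow_add₀ X.p_ne_zero, ← zpow_add₀ X.p_ne_zero]
          congr 1
          push_cast
          ring
  have h4 := (sq_le_zpow_iff hϖ _ (n := 0) (j := -1) (by norm_num)).1
    ((C.sq_valuation_re_le _).trans h3)
  rw [zpow_zero] at h4
  rw [hψ₀.1 (2 * (C.e (((h⁻¹ : Dˣ) : D) * ((c : D) * h - h * c) * ((u : D) - 1))).re) (by rw [map_mul, C.val_two, one_mul]; exact h4), mul_one]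

end Coords

end Frame

lemma charRep_apply {G : Type*} [Group G] (χ : G →* ℂˣ) (g : G) (x : ℂ) :
    charRep χ g x = (χ g : ℂ) * x := rfl

/-! ### Multiplicity one from a single double coset. -/

section MultiplicityOne

variable {G T W ι : Type*} [Group G] [Group T] [AddCommGroup W] [Module ℂ W] {S : Subgroup G}
  (hinj : Function.Injective ((MonoidHom.id G).comp S.subtype)) (ρ : Representation ℂ S W)
  {τ : T →* G} {χ : T →* ℂˣ} {I : Finset ι} {g : ι → T} {w : W}

/-- If the `χ`-isotypic functions in `Ind_S^G ρ` are supported on `S T`, then the `χ`-isotypic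
component is a line as soon as the space of vectors of `ρ` on which `S ∩ T` acts by `χ` is. -/
lemma finrank_isotypic_coind_eq_one (hw0 : w ≠ 0)
    (hw : ∀ (s : S) (t : T), (s : G) = τ t → ρ s w = (χ t : ℂ) • w)
    (hcov : ∀ t : T, ∃ i ∈ I, ∃ s : S, τ t = s * τ (g i))
    (hsep : ∀ i ∈ I, ∀ i' ∈ I, ∀ s : S, τ (g i) = s * τ (g i') → i = i')
    (hsupp : ∀ f ∈ isotypic τ (Representation.coind S.subtype ρ) χ, ∀ x : G, f.1 x ≠ 0 →
      ∃ (s : S) (t : T), x = s * τ t)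
    (huniq : ∀ x : W, (∀ (s : S) (t : T), (s : G) = τ t → ρ s x = (χ t : ℂ) • x) →
      ∃ a : ℂ, x = a • w) :
    Module.finrank ℂ (isotypic τ (Representation.coind S.subtype ρ) χ) = 1 ∧
      equivariantVector hinj ρ τ χ I g w ≠ 0 ∧
      equivariantVector hinj ρ τ χ I g w ∈ isotypic τ (Representation.coind S.subtype ρ) χ := by
  have hcov' : ∀ (x : G) (t : T), MonoidHom.id G x = τ t →
      ∃ i ∈ I, ∃ s : S, τ t = MonoidHom.id G (S.subtype s) * τ (g i) := fun _ t _ => hcov t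
  set v := equivariantVector hinj ρ τ χ I g w with hv
  have hv1 : ∀ (s : S) (t : T), v.1 (s * τ t) = (χ t : ℂ) • ρ s w := fun s t =>
    equivariantVector_apply hinj ρ hw hcov' hsep rfl
  have hmem : v ∈ isotypic τ (Representation.coind S.subtype ρ) χ := by
    intro z
    apply Subtype.ext
    funext x
    exact equivariantVector_mul hinj ρ hw hcov' hsep (x := x) (y := τ z) (t := z) rfl
  have hne : v ≠ 0 := by
    intro h
    have h1 := hv1 1 1
    rw [h] at h1
    simp at h1
    exact hw0 h1.symm
  refine ⟨?_, hne, hmem⟩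
  suffices h : Function.Bijective (LinearMap.toSpanSingleton ℂ
      (isotypic τ (Representation.coind S.subtype ρ) χ) ⟨v, hmem⟩) by
    rw [← (LinearEquiv.ofBijective _ h).finrank_eq, Module.finrank_self]
  refine ⟨fun a b hab => ?_, ?_⟩
  · have h1 : a • v.1 1 = b • v.1 1 :=
      congrFun (congrArg (fun f => f.1.1) hab) 1
    have h2 := hv1 1 1
    rw [OneMemClass.coe_one, map_one, map_one, mul_one, map_one, Units.val_one, one_smul,
      Module.End.one_apply] at h2
    rw [h2] at h1
    exact smul_left_injective ℂ hw0 h1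
  rintro ⟨f, hf⟩
  have hf1 : ∀ (x : G) (t : T), f.1 (x * τ t) = (χ t : ℂ) • f.1 x := fun x t =>
    congrFun (congrArg Subtype.val (hf t)) x
  have hf2 : ∀ (s : S) (x : G), f.1 (s * x) = ρ s (f.1 x) := fun s x => f.2 s x
  -- For `s = τ t`, left equivariance gives `f(s) = ρ(s) f(1)` and right equivariance gives `f(s) =
  -- χ(t) f(1)`, so `f(1)` is an admissible vector.
  obtain ⟨a, ha⟩ := huniq (f.1 1) (by
    intro s t hst
    rw [← hf2, mul_one, hst, ← hf1, one_mul])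
  refine ⟨a, Subtype.ext (Subtype.ext ?_)⟩
  funext x
  change a • v.1 x = f.1 x
  by_cases hx : ∃ (s : S) (t : T), x = s * τ t
  · obtain ⟨s, t, rfl⟩ := hx
    have h3 : f.1 (τ t) = (χ t : ℂ) • f.1 1 := by rw [← hf1, one_mul]
    rw [hv1, hf2, h3, ha, map_smul, map_smul, smul_smul, smul_smul, mul_comm]
  · have h3 : v.1 x = 0 := equivariantVector_apply_of_not hinj ρ hx
    have h4 : f.1 x = 0 := by
      by_contra h4
      exact hx (hsupp f hf x h4)
    rw [h3, h4, smul_zero]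

end MultiplicityOne

/-! ### The even and the odd case. -/

namespace Frame

namespace Coords

variable {F D : Type*} [Field F] [ValuativeRel F] [TopologicalSpace F]
  [IsNonarchimedeanLocalField F] [DivisionRing D] [Algebra F D] [FiniteDimensional F D]
  {X : Frame F D}

lemma UD_succ_le_H (m : ℕ) : X.UD (m + 1) ≤ X.H m := (X.UD_succ_le m).trans le_sup_right

lemma exists_toDUnits_eq (C : X.Coords) {n : ℕ} {k : Dˣ} (hk : k ∈ X.UK n) :
    ∃ z : (↥X.K)ˣ, toDUnits X.K z = k :=
  (mem_torus_iff X.K k).2 ((C.mem_UK_iff n k).1 hk).1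

/-- Write `gk = (gkg⁻¹)g` for `k ∈ 1 + 𝒫_K^(m+1)`. As `1 + 𝒫_D^(m+1)` is normal in `D^×` and acts
through the scalars `ψ_c`, the two evaluations of `f(gk)` give `χ(k) = ψ_c(gkg⁻¹)`, and `χ(k) =
ψ_c(k)`. -/
lemma support_subset (C : X.Coords) {m : ℕ} {ψ₀ : AddChar F ℂ}
    (hψ₀ : IsConductorZero (X.ϖF : F) ψ₀) {ψ : (↥X.M)ˣ →* ℂˣ} {c : ↥X.M}
    (hc : X.Represents m ψ₀ ψ c) {V : Type*} [AddCommGroup V] [Module ℂ V]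
    (Θ : Representation ℂ ↥(X.H m) V)
    (hΘ : ∀ u : ↥(X.H m), (u : Dˣ) ∈ X.UD (m + 1) → ∀ x, Θ u x = X.ψc ψ₀ c u • x)
    {χ : (↥X.K)ˣ →* ℂˣ}
    (hχ : ∀ z : (↥X.K)ˣ, toDUnits X.K z ∈ X.UK (m + 1) →
      (χ z : ℂ) = X.ψc ψ₀ c (toDUnits X.K z))
    (f : Representation.coindV (X.H m).subtype Θ)
    (hf : f ∈ isotypic (toDUnits X.K) (Representation.coind (X.H m).subtype Θ) χ) (g : Dˣ)
    (hg : f.1 g ≠ 0) : ∃ (s : ↥(X.H m)) (t : (↥X.K)ˣ), g = s * toDUnits X.K t := by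
  suffices h : ∃ h ∈ X.H m, ∃ t : (↥X.K)ˣ, g = h * toDUnits X.K t by
    obtain ⟨h, hh, t, ht⟩ := h
    exact ⟨⟨h, hh⟩, t, ht⟩
  refine C.exists_mul_of_ψc_conj_eq hψ₀ hc g fun k hk => ?_
  obtain ⟨z, rfl⟩ := C.exists_toDUnits_eq hk
  have h1 : f.1 (g * toDUnits X.K z) = (χ z : ℂ) • f.1 g :=
    congrFun (congrArg Subtype.val (hf z)) g
  have hu : g * toDUnits X.K z * g⁻¹ ∈ X.UD (m + 1) := C.conj_mem_UD (C.UK_le_UD _ hk) g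
  have h2 := f.2 ⟨_, UD_succ_le_H m hu⟩ g
  rw [hΘ _ hu] at h2
  change f.1 (g * toDUnits X.K z * g⁻¹ * g) = _ at h2
  rw [inv_mul_cancel_right, h1, hχ z hk] at h2
  exact (smul_left_injective ℂ hg h2).symm

/-- `χ` and `θ` agree on all of `H ∩ K^×`, so `1 ∈ ℂ` is an admissible vector, and the only one up
to scalars. -/
lemma even_case (C : X.Coords) {m : ℕ} {ψ₀ : AddChar F ℂ}
    (hψ₀ : IsConductorZero (X.ϖF : F) ψ₀) {ψ : (↥X.M)ˣ →* ℂˣ} {c : ↥X.M}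
    (hc : X.Represents m ψ₀ ψ c) {θ : ↥(X.H m) →* ℂˣ} (hθ : X.IsThetaEven m ψ₀ ψ c θ)
    {χ : (↥X.K)ˣ →* ℂˣ}
    (hχ : ∀ (z : (↥X.K)ˣ) (h : ↥(X.H m)), (h : Dˣ) = toDUnits X.K z →
      (h : Dˣ) ∈ center F D ⊔ X.UK m → χ z = θ h) :
    Module.finrank ℂ (isotypic (toDUnits X.K) (X.πψ m (charRep θ)) χ) = 1 ∧
      X.vEven m θ χ ≠ 0 ∧
      X.vEven m θ χ ∈ isotypic (toDUnits X.K) (X.πψ m (charRep θ)) χ := by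
  have hinj : Function.Injective ((MonoidHom.id Dˣ).comp (X.H m).subtype) :=
    Subtype.coe_injective
  have hv : X.vEven m θ χ = equivariantVector hinj
      (charRep θ) (toDUnits X.K) χ (Finset.range 2 ×ˢ X.R' m) (fun x => X.ΔK m x.1 x.2) 1 := by
    rw [equivariantVector_eq, Finset.sum_product]
    rfl
  have hχ' : ∀ (s : ↥(X.H m)) (z : (↥X.K)ˣ), (s : Dˣ) = toDUnits X.K z → χ z = θ s := by
    intro s z hs
    refine hχ z s hs ?_
    rw [← C.H_inf_torus]
    exact ⟨s.2, z, hs.symm⟩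
  have hθ' : ∀ u : ↥(X.H m), (u : Dˣ) ∈ X.UD (m + 1) → (θ u : ℂ) = X.ψc ψ₀ c u := by
    intro u hu
    have := hθ u 1 u hu (by rw [map_one, one_mul])
    rwa [map_one, Units.val_one, one_mul] at this
  rw [hv]
  refine finrank_isotypic_coind_eq_one _ (charRep θ) one_ne_zero ?_ (fun t => C.exists_Δ m t)
    (fun x hx x' hx' s h => C.Δ_unique m x hx x' hx' s h) ?_ ?_
  · intro s t hst
    rw [charRep_apply, hχ' s t hst, smul_eq_mul]
  · refine C.support_subset hψ₀ hc (charRep θ) ?_ ?_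
    · intro u hu x
      rw [charRep_apply, hθ' u hu, smul_eq_mul]
    · intro z hz
      have hu := UD_succ_le_H m (C.UK_le_UD _ hz)
      rw [hχ' ⟨_, hu⟩ z rfl, hθ' ⟨_, hu⟩ (C.UK_le_UD _ hz)]
  · intro x _
    exact ⟨x, by simp⟩

lemma coe_incl {m : ℕ} (s : ↥(X.H₁' m)) : (X.H' m).subtype (X.incl m s) = (s : Dˣ) := by
  rw [Subgroup.subtype_apply, incl, Subgroup.coe_inclusion]

/-- `H ∩ K^×` lies in `H'`, and `H'` is `H₁'` times elements of `K^×`. Therefore `χ` occurs once in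
the restriction of `θ_ψ` to `H ∩ K^×`, on the line spanned by `w = ∑ χ(1 + aϖ^m) f_a`. -/
lemma odd_case (C : X.Coords) {m : ℕ} (hm : Odd m) {ψ₀ : AddChar F ℂ}
    (hψ₀ : IsConductorZero (X.ϖF : F) ψ₀) {ψ : (↥X.M)ˣ →* ℂˣ} {c : ↥X.M}
    (hc : X.Represents m ψ₀ ψ c) {ψ' : ↥(X.H₁' m) →* ℂˣ} (hψ' : X.IsPsiPrime m ψ₀ ψ c ψ')
    {Θ : Representation ℂ ↥(X.H m) (X.W m ψ')}
    (hΘ : ∀ (h : ↥(X.H m)) (h' : ↥(X.H' m)), (h : Dˣ) = h' → Θ h = X.θψ m ψ' h')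
    {χ : (↥X.K)ˣ →* ℂˣ}
    (hχ : ∀ (z : (↥X.K)ˣ) (h : ↥(X.H₁' m)), (h : Dˣ) = toDUnits X.K z →
      (h : Dˣ) ∈ center F D ⊔ X.UK (m + 1) → χ z = ψ' h) :
    Module.finrank ℂ (isotypic (toDUnits X.K) (X.πψ m Θ) χ) = 1 ∧
      X.vOdd hm ψ' Θ χ ≠ 0 ∧
      X.vOdd hm ψ' Θ χ ∈ isotypic (toDUnits X.K) (X.πψ m Θ) χ := by
  have hinj : Function.Injective ((X.H' m).subtype.comp (X.incl m)) :=
    Subtype.coe_injective.comp (Subgroup.inclusion_injective (X.H₁'_le_H' m))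
  set w : X.W m ψ' := equivariantVector hinj (charRep ψ') (toDUnits X.K) χ X.reps
    (X.oneAdd hm) 1 with hwdef
  have hinj₁ : Function.Injective ((MonoidHom.id Dˣ).comp (X.H m).subtype) :=
    Subtype.coe_injective
  have hv : X.vOdd hm ψ' Θ χ = equivariantVector hinj₁
      Θ (toDUnits X.K) χ (Finset.range 2 ×ˢ X.R' m) (fun x => X.ΔK m x.1 x.2) w := by
    rw [equivariantVector_eq, Finset.sum_product]
    refine Finset.sum_congr rfl fun i _ => Finset.sum_congr rfl fun α _ => ?_
    rw [hwdef, equivariantVector_eq, supportedOn_smul_sum, Finset.smul_sum]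
    refine Finset.sum_congr rfl fun a _ => ?_
    rw [smul_smul]
    rfl
  have hχ' : ∀ (s : ↥(X.H₁' m)) (z : (↥X.K)ˣ), (s : Dˣ) = toDUnits X.K z → χ z = ψ' s := by
    intro s z hs
    refine hχ z s hs ?_
    rw [← C.H₁'_inf_torus hm]
    exact ⟨s.2, z, hs.symm⟩
  have hψ'' : ∀ u : ↥(X.H₁' m), (u : Dˣ) ∈ X.UD (m + 1) → (ψ' u : ℂ) = X.ψc ψ₀ c u := by
    intro u hu
    have := hψ' u 1 1 u (by rw [map_one]; exact one_mem _) (by rw [map_one]; exact one_mem _) hu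
      (by rw [map_one, one_mul, one_mul])
    rwa [map_one, Units.val_one, one_mul, one_mul] at this
  have hw1 : ∀ (s : ↥(X.H₁' m)) (t : (↥X.K)ˣ), (X.H' m).subtype (X.incl m s) = toDUnits X.K t →
      charRep ψ' s (1 : ℂ) = (χ t : ℂ) • (1 : ℂ) := by
    intro s t hst
    rw [coe_incl] at hst
    rw [charRep_apply, hχ' s t hst, smul_eq_mul]
  have hcov1 : ∀ (x : ↥(X.H' m)) (t : (↥X.K)ˣ), (X.H' m).subtype x = toDUnits X.K t →
      ∃ a ∈ X.reps, ∃ s : ↥(X.H₁' m), toDUnits X.K t =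
        (X.H' m).subtype (X.incl m s) * toDUnits X.K (X.oneAdd hm a) := by
    intro x t hx
    rw [← hx]
    simp only [coe_incl]
    exact C.exists_oneAdd hm x.2
  have hsep1 : ∀ a ∈ X.reps, ∀ a' ∈ X.reps, ∀ s : ↥(X.H₁' m), toDUnits X.K (X.oneAdd hm a) =
      (X.H' m).subtype (X.incl m s) * toDUnits X.K (X.oneAdd hm a') → a = a' := by
    simp only [coe_incl]
    exact fun a ha a' ha' s h => C.oneAdd_unique hm a ha a' ha' s h
  have hwapp : ∀ (x : ↥(X.H' m)) (s : ↥(X.H₁' m)) (t : (↥X.K)ˣ),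
      (x : Dˣ) = s * toDUnits X.K t → w.1 x = (χ t : ℂ) * ψ' s := by
    intro x s t h
    have := equivariantVector_apply hinj (charRep ψ') hw1 hcov1 hsep1 (x := x) (s := s) (t := t)
      (by rw [coe_incl]; exact h)
    rw [charRep_apply, mul_one] at this
    exact this
  have hH' : ∀ (s : ↥(X.H m)) (t : (↥X.K)ˣ), (s : Dˣ) = toDUnits X.K t → (s : Dˣ) ∈ X.H' m := by
    intro s t hst
    apply C.center_sup_UK_le_H' m
    rw [← C.H_inf_torus]
    exact ⟨s.2, t, hst.symm⟩
  rw [hv]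
  refine finrank_isotypic_coind_eq_one _ Θ ?_ ?_ (fun t => C.exists_Δ m t)
    (fun x hx x' hx' s h => C.Δ_unique m x hx x' hx' s h) ?_ ?_
  · intro h0
    have h1 := hwapp 1 1 1 (by simp)
    rw [h0] at h1
    simp at h1
  · intro s t hst
    rw [hΘ s ⟨s, hH' s t hst⟩ rfl]
    apply Subtype.ext
    funext x
    exact equivariantVector_mul hinj (charRep ψ') hw1 hcov1 hsep1 (x := x)
      (y := ⟨s, hH' s t hst⟩) (t := t) hst
  · refine C.support_subset hψ₀ hc Θ ?_ ?_
    · intro u hu x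
      have huH' : (u : Dˣ) ∈ X.H' m := (X.UD_succ_le m).trans le_sup_right hu
      rw [hΘ u ⟨u, huH'⟩ rfl]
      apply Subtype.ext
      funext y
      -- Moving `u` to the left of `y` produces `ψ_c(yuy⁻¹)`, which equals `ψ_c(u)` because `y ∈ H'
      -- ⊆ H`; so `u` acts on `W` by a scalar.
      have hy : (y : Dˣ) * u * (y : Dˣ)⁻¹ ∈ X.UD (m + 1) := C.conj_mem_UD hu y
      have hy1 : (y : Dˣ) * u * (y : Dˣ)⁻¹ ∈ X.H₁' m :=
        (le_sup_right : X.UD (m + 1) ≤ X.H₁' m) hy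
      have h1 := x.2 ⟨_, hy1⟩ y
      rw [charRep_apply, hψ'' _ hy, C.ψc_conj_eq hψ₀ hc (H'_le_H y.2) hu] at h1
      change x.1 (y * ⟨u, huH'⟩) = X.ψc ψ₀ c u * x.1 y
      rw [← h1]
      refine congrArg x.1 (Subtype.ext ?_)
      rw [Subgroup.coe_mul, Subgroup.coe_mul, ← Subgroup.subtype_apply (X.incl m _), coe_incl,
        inv_mul_cancel_right]
    · intro z hz
      have hu : toDUnits X.K z ∈ X.H₁' m :=
        (le_sup_right : X.UD (m + 1) ≤ X.H₁' m) (C.UK_le_UD _ hz)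
      rw [hχ' ⟨_, hu⟩ z rfl, hψ'' ⟨_, hu⟩ (C.UK_le_UD _ hz)]
  · intro x hx
    refine ⟨x.1 1, Subtype.ext ?_⟩
    funext y
    change x.1 y = x.1 1 * w.1 y
    -- Factoring `y = s(1 + aϖ^m)` expresses `x(y)` through `x(1)`: `s` acts by `ψ'`, and the second
    -- factor, lying in `H ∩ K^×`, by `χ`.
    obtain ⟨a, ha, s, hs⟩ := C.exists_oneAdd hm y.2
    have hk : toDUnits X.K (X.oneAdd hm a) ∈ X.H' m := by
      rw [← inv_mul_cancel_left (s : Dˣ) (toDUnits X.K (X.oneAdd hm a)), ← hs]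
      exact mul_mem (inv_mem (X.H₁'_le_H' m s.2)) y.2
    have h1 := hx ⟨_, H'_le_H hk⟩ (X.oneAdd hm a) rfl
    rw [hΘ _ ⟨_, hk⟩ rfl] at h1
    have h2 : x.1 (1 * ⟨_, hk⟩) = (χ (X.oneAdd hm a) : ℂ) * x.1 1 :=
      congrFun (congrArg Subtype.val h1) 1
    have h3 := x.2 s ⟨_, hk⟩
    rw [charRep_apply] at h3
    have h4 : y = X.incl m s * ⟨_, hk⟩ := by
      apply Subtype.ext
      rw [Subgroup.coe_mul, ← Subgroup.subtype_apply (X.incl m _), coe_incl, hs]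
    rw [hwapp y s _ hs, h4, h3, ← one_mul (⟨_, hk⟩ : ↥(X.H' m)), h2]
    ring

end Coords

end Frame

end

end QuaternionTori

theorem proposition4p1 {F D : Type*} [Field F] [ValuativeRel F] [TopologicalSpace F]
    [IsNonarchimedeanLocalField F] [CharZero F] (hp : ringChar 𝓀[F] ≠ 2)
    [DivisionRing D] [Algebra F D] [Algebra.IsCentral F D] [FiniteDimensional F D]
    (hD : Module.finrank F D = 4) (X : QuaternionTori.Frame F D)
    (ψ₀ : AddChar F ℂ) (hψ₀ : QuaternionTori.IsConductorZero (X.ϖF : F) ψ₀)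
    (m : ℕ) (ψ : (↥X.M)ˣ →* ℂˣ) (hψ : QuaternionTori.IsSmooth X.M X.ϖM ψ)
    (hmin : QuaternionTori.IsMinimal X.M X.ϖM (X.ϖF : F) ψ)
    (hcond : QuaternionTori.conductor X.M X.ϖM ψ = m + 1)
    (c : ↥X.M) (hc : X.Represents m ψ₀ ψ c) :
    -- the case of odd `m`
    (∀ hm : Odd m,
      X.H₁' m ⊓ QuaternionTori.torus X.K = QuaternionTori.center F D ⊔ X.UK (m + 1) ∧
      ∀ (ψ' : ↥(X.H₁' m) →* ℂˣ), X.IsPsiPrime m ψ₀ ψ c ψ' →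
      ∀ (Θ : Representation ℂ ↥(X.H m) (X.W m ψ')), X.IsThetaOdd m ψ ψ' Θ →
      ∀ (χ : (↥X.K)ˣ →* ℂˣ), QuaternionTori.IsSmooth X.K X.ϖ χ →
        (∀ (z : (↥X.K)ˣ) (h : ↥(X.H₁' m)), (h : Dˣ) = QuaternionTori.toDUnits X.K z →
          (h : Dˣ) ∈ QuaternionTori.center F D ⊔ X.UK (m + 1) → χ z = ψ' h) →
        Module.finrank ℂ
          (QuaternionTori.isotypic (QuaternionTori.toDUnits X.K) (X.πψ m Θ) χ) = 1 ∧
        X.vOdd hm ψ' Θ χ ≠ 0 ∧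
        X.vOdd hm ψ' Θ χ ∈
          QuaternionTori.isotypic (QuaternionTori.toDUnits X.K) (X.πψ m Θ) χ) ∧
    -- the case of even `m`
    (Even m →
      X.H m ⊓ QuaternionTori.torus X.K = QuaternionTori.center F D ⊔ X.UK m ∧
      ∀ (θ : ↥(X.H m) →* ℂˣ), X.IsThetaEven m ψ₀ ψ c θ →
      ∀ (χ : (↥X.K)ˣ →* ℂˣ), QuaternionTori.IsSmooth X.K X.ϖ χ →
        (∀ (z : (↥X.K)ˣ) (h : ↥(X.H m)), (h : Dˣ) = QuaternionTori.toDUnits X.K z →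
          (h : Dˣ) ∈ QuaternionTori.center F D ⊔ X.UK m → χ z = θ h) →
        Module.finrank ℂ
          (QuaternionTori.isotypic (QuaternionTori.toDUnits X.K)
            (X.πψ m (QuaternionTori.charRep θ)) χ) = 1 ∧
        X.vEven m θ χ ≠ 0 ∧
        X.vEven m θ χ ∈
          QuaternionTori.isotypic (QuaternionTori.toDUnits X.K)
            (X.πψ m (QuaternionTori.charRep θ)) χ) := by
  obtain ⟨C⟩ := X.nonempty_coords hp hD
  refine ⟨fun hm => ⟨C.H₁'_inf_torus hm, fun ψ' hψ' Θ hΘ χ _ hχ =>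
    C.odd_case hm hψ₀ hc hψ' hΘ.1 hχ⟩, fun _ => ⟨C.H_inf_torus m, fun θ hθ χ _ hχ =>
    C.even_case hψ₀ hc hθ hχ⟩⟩
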